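/- **Setting.** Let $d\ge 1$. Write $|\cdot|=\|\cdot\|_2$ for the Euclidean norm on $\mathbb R^d$ and $\|\cdot\|_p$ for the norm of $\ell^p(\mathbb Z^d)$. For $f:\mathbb Z^d\to\mathbb R$ and $\mu\in\mathbb R^d$ let $f^{(\mu)}(x)=f(x)e^{\mu\cdot x}$, $\hat f(k)=\sum_{x\in\mathbb Z^d}f(x)e^{-ik\cdot x}$ and $(f*h)(x)=\sum_{y\in\mathbb Z^d}f(x-y)h(y)$. Call $f$ *symmetric* if $f(x)$ is unchanged when a component of $x$ is multiplied by $-1$ or the components of $x$ are permuted. Let $M,K,\zeta>0$. Let $\mathcal Q_{M,K,\zeta}$ be the set of pairs $(Q,g)$ of functions $\mathbb Z^d\to\mathbb R$ such that * $\|Q\|_1\le M$ and $\||y|^{2+\zeta}Q(y)\|_1\le M$; * $\operatorname{Re}[\hat Q(0)-\hat Q(k)]\ge K|k|^2$ for all $k\in[-\pi,\pi]^d$; * $\|g\|_1\le M$, $\||y|^{\zeta}g(y)\|_1\le M$ and $\||y|^2g(y)\|_{\min\{p_d,2\}}\le M$, where $p_1=2$ and $p_d=\frac{d}{d-2+\min\{\zeta,2\}}$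 for $d\ge 2$; * if $d\ge 4$, also $\||y|^{d-1}Q(y)\|_{\min\{d/3,2\}}\le M$ and $\||y|^{d-1}g(y)\|_2\le M$. For $S:\mathbb Z^d\to[0,\infty)$ let $\Omega=\{\mu\in\mathbb R^d:\sum_{x}S^{(\mu)}(x)<\infty\}$ and $m_S=\sup\{t\ge 0: te_1\in\Omega\}$. **Assumptions.** 1. $S:\mathbb Z^d\to[0,\infty)$ is symmetric, $\Omega$ is open, $0\in\Omega$, and $\mu_1e_1\notin\Omega$ for some $\mu_1>0$. 2. $S=g+J*S$ with symmetric $J,g\in \ell^1(\mathbb Z^d)$, and for every $\mu\in\overline\Omega$ one has $(J^{(\mu)},g^{(\mu)})\in\mathcal Q_{M,K,\zeta}$ and $\hat g^{(\mu)}(0)>0$. **Claim.** Under these assumptions, for every nonzero $x\in\mathbb Z^d$, with $\hat x=x/|x|$, there is a unique $\mu_{\hat x}\in\partial\Omega$ with $\mu_{\hat x}\cdot \hat x=\max_{\mu\in\overline\Omega}\mu\cdot \hat x$. Let $$\eta_{\hat x,j}=\sum_{y}y_jJ^{(\mu_{\hat x})}(y),\qquad \Lambda_{\hat x,jl}=\sum_{y}y_jy_lJ^{(\mu_{\hat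 x})}(y),\qquad |x|_S=\frac{\mu_{\hat x}\cdot x}{m_S}.$$ Then, as $|x|\to\infty$, $$S(x)=\frac{1}{(2\pi)^{(d-1)/2}\sqrt{\det\Lambda_{\hat x}}}\;\frac{1}{(\hat x\cdot\Lambda_{\hat x}^{-1}\hat x)^{1/2}}\;\frac{|\eta_{\hat x}|^{(d-3)/2}}{|x|^{(d-1)/2}}\;e^{-m_S|x|_S}\,\bigl[\hat g^{(\mu_{\hat x})}(0)+o(1)\bigr],$$ where the $o(1)$ depends only on $d,M,K,\zeta,m_S$. That is, for all $d,M,K,\zeta,m$ and every $\varepsilon>0$ there is an $R$ such that, for all $S,g,J$ satisfying the assumptions with these constants and with $m_S=m$, and for all nonzero $x\in\mathbb Z^d$ with $|x|\ge R$, the formula holds with a real number of absolute value at most $\varepsilon$ in place of $o(1)$. -/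

import Mathlib

open scoped ENNReal

noncomputable section

namespace OZ

/-- The integer lattice in dimension `d`. -/
abbrev Lat (d : ℕ) : Type := Fin d → ℤ

/-- Euclidean space of dimension `d`, with the Euclidean norm. -/
abbrev Vec (d : ℕ) : Type := EuclideanSpace ℝ (Fin d)

/-- A lattice point, viewed as a vector of Euclidean space. -/
def toVec {d : ℕ} (x : Lat d) : Vec d := WithLp.toLp 2 (fun j => (x j : ℝ))

/-- The direction (unit vector) `x / |x|` of a nonzero vector. -/
def dir {d : ℕ} (x : Vec d) : Vec d := ‖x‖⁻¹ • x

/-- Lattice symmetry: invariance under changing the sign of a component and under permuting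
the components. -/
def LatticeSymmetric {d : ℕ} (f : Lat d → ℝ) : Prop :=
  (∀ (x : Lat d) (j : Fin d), f (Function.update x j (-x j)) = f x) ∧
    ∀ (x : Lat d) (σ : Equiv.Perm (Fin d)), f (fun j => x (σ j)) = f x

/-- The exponential tilt `x ↦ f x * exp (μ · x)`. -/
def tilt {d : ℕ} (f : Lat d → ℝ) (μ : Vec d) (x : Lat d) : ℝ :=
  f x * Real.exp (inner ℝ μ (toVec x))

/-- The Fourier transform `k ↦ ∑ x, f x * exp (-i k · x)`, a function that is `2π`-periodic in each
coordinate of `k`. -/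
def fourierSum {d : ℕ} (f : Lat d → ℝ) (k : Vec d) : ℂ :=
  ∑' x : Lat d, (f x : ℂ) * Complex.exp (-(Complex.I * ((inner ℝ k (toVec x) : ℝ) : ℂ)))

/-- The convolution of two functions on the lattice. -/
def conv {d : ℕ} (f g : Lat d → ℝ) (x : Lat d) : ℝ := ∑' y : Lat d, f (x - y) * g y

/-- The norm of `ℓ^p` of the lattice, with value `∞` for functions outside `ℓ^p`. -/
def ellNorm {d : ℕ} (p : ℝ) (f : Lat d → ℝ) : ℝ≥0∞ :=
  MeasureTheory.eLpNorm f (ENNReal.ofReal p) MeasureTheory.Measure.count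

/-- The function `y ↦ |y|^a * f y`. -/
def weight {d : ℕ} (a : ℝ) (f : Lat d → ℝ) (y : Lat d) : ℝ := ‖toVec y‖ ^ a * f y

/-- The tilted susceptibility `∑ x, S x * exp (μ · x)` of a nonnegative function `S`. -/
def susceptibility {d : ℕ} (S : Lat d → ℝ) (μ : Vec d) : ℝ≥0∞ :=
  ∑' x : Lat d, ENNReal.ofReal (tilt S μ x)

/-- The set of tilts with finite susceptibility. Its closure is the Wulff shape. -/
def Omega {d : ℕ} (S : Lat d → ℝ) : Set (Vec d) := {μ | susceptibility S μ < ∞}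

/-- The first standard basis vector. -/
def e1 (d : ℕ) [NeZero d] : Vec d := EuclideanSpace.single 0 1

/-- The mass: the supremum of the `t ≥ 0` for which the tilt `t e₁` has finite susceptibility. -/
def mass {d : ℕ} [NeZero d] (S : Lat d → ℝ) : ℝ :=
  sSup {t : ℝ | 0 ≤ t ∧ susceptibility S (t • e1 d) < ∞}

/-- Averaged exponential decay of a nonnegative lattice symmetric function. -/
structure AveragedDecay {d : ℕ} [NeZero d] (S : Lat d → ℝ) : Prop where
  nonneg : ∀ x, 0 ≤ S x
  symm : LatticeSymmetric S
  isOpen : IsOpen (Omega S)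
  zero_mem : 0 ∈ Omega S
  exists_notMem : ∃ t : ℝ, 0 < t ∧ t • e1 d ∉ Omega S

/-- The exponent `p_d`: it is `2` for `d = 1`, and `d / (d - 2 + min ζ 2)` for `d ≥ 2`. -/
def pExp (d : ℕ) (ζ : ℝ) : ℝ := if d = 1 then 2 else (d : ℝ) / ((d : ℝ) - 2 + min ζ 2)

/-- The class of pairs `(Q, g)` with the moment bounds and the infrared bound with constants
`M`, `K`, `ζ`. The torus is represented by the cube `[-π, π]^d`. -/
structure KernelClass {d : ℕ} (M K ζ : ℝ) (Q g : Lat d → ℝ) : Prop where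
  Q_one : ellNorm 1 Q ≤ ENNReal.ofReal M
  Q_moment : ellNorm 1 (weight (2 + ζ) Q) ≤ ENNReal.ofReal M
  infrared : ∀ k : Vec d, (∀ j, |k j| ≤ Real.pi) → K * ‖k‖ ^ 2 ≤ (fourierSum Q 0 - fourierSum Q k).re
  g_one : ellNorm 1 g ≤ ENNReal.ofReal M
  g_moment : ellNorm 1 (weight ζ g) ≤ ENNReal.ofReal M
  g_second : ellNorm (min (pExp d ζ) 2) (weight 2 g) ≤ ENNReal.ofReal M
  Q_high : 4 ≤ d → ellNorm (min ((d : ℝ) / 3) 2) (weight ((d : ℝ) - 1) Q) ≤ ENNReal.ofReal M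
  g_high : 4 ≤ d → ellNorm 2 (weight ((d : ℝ) - 1) g) ≤ ENNReal.ofReal M

/-- The generalised Ornstein-Zernike equation `S = g + J * S`, with summable lattice symmetric `J`
and `g` whose tilts are in the class with constants `M`, `K`, `ζ`, uniformly over the Wulff shape,
and with tilts of `g` of positive total sum (the Fourier transform at `0` of a real function is
real). -/
structure OZEquation {d : ℕ} (M K ζ : ℝ) (S g J : Lat d → ℝ) : Prop where
  J_symm : LatticeSymmetric J
  g_symm : LatticeSymmetric g
  J_summable : Summable J
  g_summable : Summable g
  equation : ∀ x, S x = g x + conv J S x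
  mem_class : ∀ μ ∈ closure (Omega S), KernelClass M K ζ (tilt J μ) (tilt g μ)
  g_pos : ∀ μ ∈ closure (Omega S), 0 < (fourierSum (tilt g μ) 0).re

/-- `μ` is a point of the boundary of `Omega S` that maximises `μ · x` over the Wulff shape. -/
def IsOptimalTilt {d : ℕ} (S : Lat d → ℝ) (x μ : Vec d) : Prop :=
  μ ∈ frontier (Omega S) ∧ ∀ ν ∈ closure (Omega S), inner ℝ ν x ≤ (inner ℝ μ x : ℝ)

/-- The optimal tilt in direction `u` (an arbitrary vector if there is none). -/
def optimalTilt {d : ℕ} (S : Lat d → ℝ) (u : Vec d) : Vec d :=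
  Classical.epsilon (IsOptimalTilt S u)

/-- The vector of first moments. -/
def firstMoment {d : ℕ} (Q : Lat d → ℝ) : Vec d :=
  WithLp.toLp 2 (fun j => ∑' y : Lat d, (y j : ℝ) * Q y)

/-- The matrix of second moments. -/
def secondMoment {d : ℕ} (Q : Lat d → ℝ) : Matrix (Fin d) (Fin d) ℝ :=
  Matrix.of (fun j l => ∑' y : Lat d, (y j : ℝ) * (y l : ℝ) * Q y)

/-- The drift in direction `u`: the first moments of `J` tilted by the optimal tilt. -/
def drift {d : ℕ} (S J : Lat d → ℝ) (u : Vec d) : Vec d := firstMoment (tilt J (optimalTilt S u))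

/-- The matrix in direction `u`: the second moments of `J` tilted by the optimal tilt. -/
def covariance {d : ℕ} (S J : Lat d → ℝ) (u : Vec d) : Matrix (Fin d) (Fin d) ℝ :=
  secondMoment (tilt J (optimalTilt S u))

/-- The norm `|x|_S = (μ · x) / m_S`, with `μ` the optimal tilt in the direction of `x`. -/
def normS {d : ℕ} [NeZero d] (S : Lat d → ℝ) (x : Vec d) : ℝ :=
  inner ℝ (optimalTilt S (dir x)) x / mass S

/-- The quadratic form `u · A⁻¹ u` of the inverse of a matrix. -/
def invForm {d : ℕ} (A : Matrix (Fin d) (Fin d) ℝ) (u : Vec d) : ℝ :=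
  u.ofLp ⬝ᵥ A⁻¹.mulVec u.ofLp

end OZ

end

open MeasureTheory Filter Topology

noncomputable section

namespace OZ

/-! Tilting by the optimal boundary point `μ` removes the exponential decay of `S`, so what remains
is a polynomial asymptotic with a critical kernel `A = tilt J μ`. Criticality means that the total
mass of `A` is one. The mass of the tilts of `J` is below one in the open domain, where `S` is
summable. If it were below one at a boundary point, `S` would be summable there as well, against
openness (`OZEquation.tsum_tilt_eq_one`). Along the closed Wulff shape this mass is uniformly convex
and smooth, because the infrared bound controls second moments from below and `M` controls them from
above (`OZEquation.tsum_tilt_bounds`). Hence the Wulff shape is strictly convex, the maximiser is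
unique (`OZEquation.isOptimalTilt_unique`), and the first moment `η` of `A` is an outward normal,
thus parallel to `x` (`OZEquation.drift_eq`). Its length is bounded below in terms of the mass
(`OZEquation.mass_le_norm_drift`).

The Green function is written as the time integral of the semigroup with symbol `exp (-t (1 - Â))`.
Tilting commutes with convolution powers, hence with the semigroup (`heat_tilt`). Fourier inversion
is therefore needed only at tilt zero, where the kernel is subcritical, and the representation of
`S` as `g` convolved with the Green function transfers to the boundary with no analyticity in the
tilt (`tilt_eq_tsum_mul_green`).

At time `t` the semigroup lives within distance of order `√t` of `t η`, so the point `T η` is seen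
only during a time window of width of order `√T` around `T`. In the window a local limit theorem
applies (`exists_heat_sub_gaussQ_le`), and the Gaussian integral over time turns `T^(-d/2)` into
`T^(-(d-1)/2)` and produces the constant `greenConst`. Off the window the kernel is truncated at
radius `1 / a`: the near part obeys a Chernoff bound, and the far part is a small perturbation by
the moment assumptions (`exists_norm_heat_le_far`, and `exists_norm_heat_le_far_sq` for high
dimension). This gives `exists_green_sub_const_le` and the uniform bound `exists_green_le`.

The convolution with the source is treated in `exists_tsum_mul_green_sub_le`: short jumps of `g` see
the asymptotic value, long jumps have small mass, and jumps landing near the origin, where the Green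
function is not small, are controlled by Cauchy–Schwarz and the `ℓ²` moment of `g`. All constants
depend only on `d`, `M`, `K`, `ζ` and the mass, and a lower bound on `greenConst` makes the error
relative. -/

/-! ### Fourier series on the torus -/

/-- The cube `[-π, π]^d`. -/
def cube (d : ℕ) : Set (Vec d) := {k | ∀ j, |k j| ≤ Real.pi}

/-- The character `k ↦ exp (i k · x)`. -/
def chr {d : ℕ} (k : Vec d) (x : Lat d) : ℂ :=
  Complex.exp (Complex.I * ((inner ℝ k (toVec x) : ℝ) : ℂ))

lemma inner_toVec {d : ℕ} (k : Vec d) (x : Lat d) :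
    (inner ℝ k (toVec x) : ℝ) = ∑ j, k j * (x j : ℝ) := by
  simp [PiLp.inner_apply, toVec, mul_comm]

lemma toVec_zero {d : ℕ} : toVec (0 : Lat d) = 0 := by
  ext j; simp [toVec]

lemma toVec_sub {d : ℕ} (x y : Lat d) : toVec (x - y) = toVec x - toVec y := by
  ext j; simp [toVec]

lemma toVec_add {d : ℕ} (x y : Lat d) : toVec (x + y) = toVec x + toVec y := by
  ext j; simp [toVec]

lemma toVec_neg {d : ℕ} (x : Lat d) : toVec (-x) = -toVec x := by
  ext j; simp [toVec]

lemma one_le_norm_toVec {d : ℕ} {x : Lat d} (hx : x ≠ 0) : 1 ≤ ‖toVec x‖ := by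
  obtain ⟨j, hj⟩ := Function.ne_iff.mp hx
  have h1 : (1 : ℝ) ≤ ‖(toVec x) j‖ := by
    simp only [toVec, Real.norm_eq_abs]
    exact_mod_cast Int.one_le_abs hj
  exact h1.trans (PiLp.norm_apply_le (toVec x) j)

lemma chr_add {d : ℕ} (k : Vec d) (x y : Lat d) : chr k (x + y) = chr k x * chr k y := by
  simp [chr, toVec_add, inner_add_right, mul_add, Complex.exp_add]

lemma chr_zero {d : ℕ} (k : Vec d) : chr k 0 = 1 := by
  simp [chr, toVec_zero]

lemma norm_chr {d : ℕ} (k : Vec d) (x : Lat d) : ‖chr k x‖ = 1 := by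
  rw [chr, mul_comm, Complex.norm_exp_ofReal_mul_I]

lemma chr_neg {d : ℕ} (k : Vec d) (x : Lat d) :
    chr k (-x) = Complex.exp (-(Complex.I * ((inner ℝ k (toVec x) : ℝ) : ℂ))) := by
  simp [chr, toVec_neg]

lemma conj_chr {d : ℕ} (k : Vec d) (x : Lat d) : starRingEnd ℂ (chr k x) = chr k (-x) := by
  rw [chr_neg, chr, ← Complex.exp_conj]
  simp

lemma continuous_chr {d : ℕ} (x : Lat d) : Continuous fun k : Vec d => chr k x := by
  unfold chr; fun_prop

lemma fourierSum_eq {d : ℕ} (f : Lat d → ℝ) (k : Vec d) :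
    fourierSum f k = ∑' x, (f x : ℂ) * chr k (-x) := by
  simp only [fourierSum, chr_neg]

lemma summable_mul_chr {d : ℕ} {f : Lat d → ℝ} (hf : Summable f) (k : Vec d) :
    Summable fun x => (f x : ℂ) * chr k (-x) := by
  refine Summable.of_norm ?_
  simpa [norm_chr] using hf.abs

lemma norm_fourierSum_le {d : ℕ} {f : Lat d → ℝ} (hf : Summable f) (k : Vec d) :
    ‖fourierSum f k‖ ≤ ∑' x, |f x| := by
  rw [fourierSum_eq]
  refine (norm_tsum_le_tsum_norm ?_).trans_eq ?_
  · simpa [norm_chr] using hf.abs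
  · simp [norm_chr]

lemma continuous_fourierSum {d : ℕ} {f : Lat d → ℝ} (hf : Summable f) :
    Continuous (fourierSum f) := by
  have : fourierSum f = fun k => ∑' x, (f x : ℂ) * chr k (-x) := funext (fourierSum_eq f)
  rw [this]
  refine continuous_tsum (u := fun x => |f x|) (fun x => ?_) hf.abs (fun x k => ?_)
  · exact continuous_const.mul (continuous_chr _)
  · simp [norm_chr]

lemma fourierSum_add {d : ℕ} {f h : Lat d → ℝ} (hf : Summable f) (hh : Summable h) (k : Vec d) :
    fourierSum (fun x => f x + h x) k = fourierSum f k + fourierSum h k := by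
  simp only [fourierSum_eq]
  rw [← (summable_mul_chr hf k).tsum_add (summable_mul_chr hh k)]
  simp [add_mul]

lemma cube_eq_preimage (d : ℕ) :
    cube d = (WithLp.ofLp : Vec d → (Fin d → ℝ)) ⁻¹' Set.pi Set.univ fun _ => Set.Icc (-Real.pi) Real.pi := by
  ext k; simp [cube, abs_le, Set.mem_pi, -Set.pi_univ_Icc]

lemma isCompact_cube (d : ℕ) : IsCompact (cube d) := by
  rw [cube_eq_preimage]
  exact (PiLp.homeomorph 2 (fun _ : Fin d => ℝ)).isCompact_preimage.mpr
    (isCompact_univ_pi fun _ => isCompact_Icc)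

lemma measurableSet_cube (d : ℕ) : MeasurableSet (cube d) := (isCompact_cube d).measurableSet

lemma setIntegral_cube {d : ℕ} (F : (Fin d → ℝ) → ℂ) :
    ∫ k in cube d, F k.ofLp = ∫ k in Set.pi Set.univ fun _ => Set.Icc (-Real.pi) Real.pi, F k := by
  rw [cube_eq_preimage]
  exact (PiLp.volume_preserving_ofLp (Fin d)).setIntegral_preimage_emb
    (MeasurableEquiv.toLp 2 (Fin d → ℝ)).symm.measurableEmbedding _ _

lemma integral_exp_int (n : ℤ) :
    ∫ s in Set.Icc (-Real.pi) Real.pi, Complex.exp (Complex.I * ((s * (n : ℝ) : ℝ) : ℂ))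
      = if n = 0 then ((2 * Real.pi : ℝ) : ℂ) else 0 := by
  rw [integral_Icc_eq_integral_Ioc, ← intervalIntegral.integral_of_le (by linarith [Real.pi_pos])]
  split_ifs with h
  · subst h; simp; ring
  · have hc : Complex.I * (n : ℂ) ≠ 0 := by simp [h]
    have : ∀ s : ℝ, Complex.I * ((s * (n : ℝ) : ℝ) : ℂ) = Complex.I * n * s := fun s => by
      push_cast; ring
    simp only [this]
    rw [integral_exp_mul_complex hc]
    have e : Complex.exp (Complex.I * n * ((Real.pi : ℝ) : ℂ)) =
        Complex.exp (Complex.I * n * (((-Real.pi : ℝ)) : ℂ)) := by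
      rw [Complex.exp_eq_exp_iff_exists_int]
      exact ⟨n, by push_cast; ring⟩
    rw [e]; simp

lemma integral_chr {d : ℕ} (x : Lat d) :
    ∫ k in cube d, chr k x = if x = 0 then (((2 * Real.pi) ^ d : ℝ) : ℂ) else 0 := by
  have h1 : ∀ k : Vec d, chr k x =
      (fun k : Fin d → ℝ => ∏ j, Complex.exp (Complex.I * ((k j * (x j : ℝ) : ℝ) : ℂ))) k.ofLp := by
    intro k
    simp only [chr, inner_toVec]
    rw [← Complex.exp_sum]
    congr 1
    push_cast
    rw [Finset.mul_sum]
  simp only [h1]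
  rw [setIntegral_cube (fun k : Fin d → ℝ => ∏ j, Complex.exp (Complex.I * ((k j * (x j : ℝ) : ℝ) : ℂ)))]
  rw [volume_pi, Measure.restrict_pi_pi]
  rw [integral_fintype_prod_eq_prod (μ := fun _ : Fin d => (volume : Measure ℝ).restrict (Set.Icc (-Real.pi) Real.pi))
    (fun j (s : ℝ) => Complex.exp (Complex.I * ((s * (x j : ℝ) : ℝ) : ℂ)))]
  simp only [integral_exp_int]
  split_ifs with h
  · subst h; simp
  · obtain ⟨j, hj⟩ := Function.ne_iff.mp h
    exact Finset.prod_eq_zero (Finset.mem_univ j) (by simpa using hj)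

/-- The Fourier coefficient `(2π)^{-d} ∫ F(k) exp (i k · x) dk` over the cube. -/
def fcoef {d : ℕ} (F : Vec d → ℂ) (x : Lat d) : ℂ :=
  (((2 * Real.pi) ^ d : ℝ) : ℂ)⁻¹ * ∫ k in cube d, chr k x * F k

lemma two_pi_pow_pos (d : ℕ) : 0 < (2 * Real.pi) ^ d := by positivity

lemma fcoef_one {d : ℕ} (x : Lat d) : fcoef (fun _ => 1) x = if x = 0 then 1 else 0 := by
  have := two_pi_pow_pos d
  simp only [fcoef, mul_one, integral_chr]
  split_ifs
  · rw [inv_mul_cancel₀]; exact_mod_cast this.ne'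
  · simp

lemma norm_fcoef_le {d : ℕ} (F : Vec d → ℂ) (x : Lat d) :
    ‖fcoef F x‖ ≤ ((2 * Real.pi) ^ d)⁻¹ * ∫ k in cube d, ‖F k‖ := by
  have := two_pi_pow_pos d
  rw [fcoef, norm_mul, norm_inv, Complex.norm_real, Real.norm_of_nonneg this.le]
  gcongr
  refine (norm_integral_le_integral_norm _).trans_eq ?_
  simp [norm_chr]

/-- Multiplying by a Fourier series acts on coefficients as convolution; sum and integral may be
exchanged because `f` is summable and `F` is integrable on the compact cube. Inversion is the case
of constant `F`, and Parseval the case where `F` is the conjugate series. -/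
lemma fcoef_fourierSum_mul {d : ℕ} {f : Lat d → ℝ} (hf : Summable f) {F : Vec d → ℂ}
    (hF : ContinuousOn F (cube d)) (x : Lat d) :
    fcoef (fun k => fourierSum f k * F k) x = ∑' y, (f y : ℂ) * fcoef F (x - y) := by
  have hint : ∀ y : Lat d, IntegrableOn (fun k => (f y : ℂ) * (chr k (x - y) * F k)) (cube d) :=
    fun y => (continuousOn_const.mul ((continuous_chr _).continuousOn.mul hF)).integrableOn_compact
      (isCompact_cube d)
  have hsum : Summable fun y => ∫ k in cube d, ‖(f y : ℂ) * (chr k (x - y) * F k)‖ := by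
    have : ∀ y, ∫ k in cube d, ‖(f y : ℂ) * (chr k (x - y) * F k)‖ =
        |f y| * ∫ k in cube d, ‖F k‖ := by
      intro y
      rw [← integral_const_mul]
      simp [norm_chr]
    simp only [this]
    exact hf.abs.mul_right _
  have key := integral_tsum_of_summable_integral_norm hint hsum
  simp only [fcoef]
  have e : ∀ k, chr k x * (fourierSum f k * F k) = ∑' y, (f y : ℂ) * (chr k (x - y) * F k) := by
    intro k
    rw [fourierSum_eq, ← tsum_mul_right, ← tsum_mul_left]
    congr 1; ext y
    rw [sub_eq_add_neg, chr_add]; ring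
  simp only [e]
  rw [← key, ← tsum_mul_left]
  congr 1; ext y
  rw [integral_const_mul]; ring

lemma fcoef_fourierSum {d : ℕ} {f : Lat d → ℝ} (hf : Summable f) (x : Lat d) :
    fcoef (fourierSum f) x = f x := by
  have := fcoef_fourierSum_mul hf (F := fun _ => 1) continuousOn_const x
  simp only [mul_one, fcoef_one] at this
  rw [show fourierSum f = fun k => fourierSum f k from rfl, this, tsum_eq_single x]
  · simp
  · intro y hy
    rw [if_neg (sub_ne_zero.mpr hy.symm), mul_zero]

lemma integral_norm_fourierSum_sq {d : ℕ} {f : Lat d → ℝ} (hf : Summable f) :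
    ∫ k in cube d, ‖fourierSum f k‖ ^ 2 = (2 * Real.pi) ^ d * ∑' x, f x ^ 2 := by
  have hpos := two_pi_pow_pos d
  have hc : Continuous fun k => starRingEnd ℂ (fourierSum f k) :=
    Complex.continuous_conj.comp (continuous_fourierSum hf)
  have h1 := fcoef_fourierSum_mul hf hc.continuousOn 0
  have h2 : ∀ y : Lat d, fcoef (fun k => starRingEnd ℂ (fourierSum f k)) (0 - y) = f y := by
    intro y
    have : fcoef (fun k => starRingEnd ℂ (fourierSum f k)) (0 - y)
        = starRingEnd ℂ (fcoef (fourierSum f) y) := by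
      simp only [fcoef, map_mul, map_inv₀, Complex.conj_ofReal, zero_sub]
      rw [← integral_conj]
      simp [conj_chr]
    rw [this, fcoef_fourierSum hf, Complex.conj_ofReal]
  simp only [h2] at h1
  have h3 : fcoef (fun k => fourierSum f k * starRingEnd ℂ (fourierSum f k)) 0 =
      ((((2 * Real.pi) ^ d)⁻¹ * ∫ k in cube d, ‖fourierSum f k‖ ^ 2 : ℝ) : ℂ) := by
    simp only [fcoef, chr_zero, one_mul, Complex.mul_conj, Complex.normSq_eq_norm_sq]
    rw [integral_complex_ofReal]
    push_cast; rfl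
  rw [h3] at h1
  have h4 : ∑' y, (f y : ℂ) * f y = ((∑' y, f y ^ 2 : ℝ) : ℂ) := by
    rw [Complex.ofReal_tsum]; congr 1; ext y; push_cast; ring
  rw [h4] at h1
  have h5 := Complex.ofReal_injective h1
  rw [← h5]; field_simp

/-! ### Convolution, the semigroup, and the effect of a tilt -/

/-- The shear `(x, y) ↦ (x - y, y)` of pairs of lattice points. -/
def shear (d : ℕ) : Lat d × Lat d ≃ Lat d × Lat d where
  toFun p := (p.1 - p.2, p.2)
  invFun p := (p.1 + p.2, p.2)
  left_inv p := by simp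
  right_inv p := by simp


lemma tsum_conv_mul {d : ℕ} {a b : Lat d → ℂ} (ha : Summable fun x => ‖a x‖)
    (hb : Summable fun x => ‖b x‖) :
    (∑' x, a x) * (∑' y, b y) = ∑' x, ∑' y, a (x - y) * b y := by
  have h1 : Summable fun p : Lat d × Lat d => a p.1 * b p.2 :=
    summable_mul_of_summable_norm ha hb
  have h2 : Summable fun p : Lat d × Lat d => a (p.1 - p.2) * b p.2 :=
    (shear d).summable_iff (f := fun p : Lat d × Lat d => a p.1 * b p.2) |>.mpr h1
  rw [tsum_mul_tsum_of_summable_norm ha hb, ← h2.tsum_prod]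
  exact ((shear d).tsum_eq (fun p : Lat d × Lat d => a p.1 * b p.2)).symm

lemma fourierSum_conv {d : ℕ} {f h : Lat d → ℝ} (hf : Summable f) (hh : Summable h) (k : Vec d) :
    fourierSum (conv f h) k = fourierSum f k * fourierSum h k := by
  rw [fourierSum_eq f, fourierSum_eq h,
    tsum_conv_mul (summable_mul_chr hf k).norm (summable_mul_chr hh k).norm, fourierSum_eq]
  congr 1; ext x
  rw [conv, Complex.ofReal_tsum, ← tsum_mul_right]
  congr 1; ext y
  have : chr k (-x) = chr k (-(x - y)) * chr k (-y) := by rw [← chr_add]; congr 1; abel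
  rw [this]
  push_cast; ring

/-- The continuous-time semigroup with kernel `f`, at time `t`. -/
def heat {d : ℕ} (t : ℝ) (f : Lat d → ℝ) (z : Lat d) : ℂ :=
  fcoef (fun k => Complex.exp (-(t * (1 - fourierSum f k)))) z

/-- The Green function of the semigroup with kernel `f`. -/
def green {d : ℕ} (f : Lat d → ℝ) (z : Lat d) : ℂ := ∫ t in Set.Ioi (0 : ℝ), heat t f z

lemma tilt_sub_mul {d : ℕ} (f : Lat d → ℝ) (μ : Vec d) (x y : Lat d) :
    tilt f μ y * Real.exp (inner ℝ μ (toVec (x - y))) = Real.exp (inner ℝ μ (toVec x)) * f y := by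
  rw [tilt, mul_assoc, ← Real.exp_add, toVec_sub, inner_sub_right, add_sub_cancel, mul_comm]

/-- The coefficients of a power of the symbol are a convolution power, and the exponential weight is
multiplicative along a sum of steps, so it factors out of each convolution. -/
lemma fcoef_pow_tilt {d : ℕ} {f : Lat d → ℝ} {μ : Vec d} (hf : Summable f)
    (hfμ : Summable (tilt f μ)) (n : ℕ) (x : Lat d) :
    fcoef (fun k => fourierSum (tilt f μ) k ^ n) x =
      Real.exp (inner ℝ μ (toVec x)) * fcoef (fun k => fourierSum f k ^ n) x := by
  induction n generalizing x with
  | zero =>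
    simp only [pow_zero, fcoef_one]
    split_ifs with h
    · simp [h, toVec_zero]
    · simp
  | succ n ih =>
    simp only [pow_succ']
    rw [fcoef_fourierSum_mul hfμ (F := fun k => fourierSum (tilt f μ) k ^ n)
        ((continuous_fourierSum hfμ).pow n).continuousOn,
      fcoef_fourierSum_mul hf (F := fun k => fourierSum f k ^ n)
        ((continuous_fourierSum hf).pow n).continuousOn, ← tsum_mul_left]
    congr 1; ext y
    rw [ih, ← mul_assoc, ← mul_assoc]
    congr 1
    exact_mod_cast tilt_sub_mul f μ x y

/-- Poissonisation of the discrete walk: the exponential series may be integrated term by term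
because the symbol is bounded by the `ℓ¹` norm of `f`. It carries the tilt rule from powers to the
semigroup. -/
lemma heat_eq_tsum {d : ℕ} {f : Lat d → ℝ} (hf : Summable f) (t : ℝ) (z : Lat d) :
    heat t f z = Complex.exp (-t) *
      ∑' n : ℕ, ((t : ℂ) ^ n / n.factorial) * fcoef (fun k => fourierSum f k ^ n) z := by
  set B := ∑' x, |f x|
  have hint : ∀ n : ℕ, IntegrableOn
      (fun k => ((t : ℂ) ^ n / n.factorial) * (chr k z * fourierSum f k ^ n)) (cube d) := fun n =>
    ((continuous_const.mul ((continuous_chr _).mul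
      ((continuous_fourierSum hf).pow n))).continuousOn).integrableOn_compact (isCompact_cube d)
  have hvol : volume (cube d) < ⊤ := (isCompact_cube d).measure_lt_top
  have hsum : Summable fun n : ℕ => ∫ k in cube d,
      ‖((t : ℂ) ^ n / n.factorial) * (chr k z * fourierSum f k ^ n)‖ := by
    refine Summable.of_nonneg_of_le (fun n => integral_nonneg fun k => norm_nonneg _) (fun n => ?_)
      ((Real.summable_pow_div_factorial (|t| * B)).mul_right (volume.real (cube d)))
    have : ∀ k ∈ cube d, ‖((t : ℂ) ^ n / n.factorial) * (chr k z * fourierSum f k ^ n)‖ ≤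
        (|t| * B) ^ n / n.factorial := by
      intro k _
      simp only [norm_mul, norm_chr, norm_div, norm_pow, one_mul, Complex.norm_real,
        Real.norm_eq_abs, Complex.norm_natCast, mul_pow]
      rw [div_mul_eq_mul_div]
      gcongr
      exact norm_fourierSum_le hf k
    have := setIntegral_mono_on (hint n).norm (integrableOn_const hvol.ne) (measurableSet_cube d) this
    rw [setIntegral_const] at this
    simpa [mul_comm] using this
  have key := integral_tsum_of_summable_integral_norm hint hsum
  have e : ∀ k, chr k z * Complex.exp (-(t * (1 - fourierSum f k))) = Complex.exp (-t) *
      ∑' n : ℕ, ((t : ℂ) ^ n / n.factorial) * (chr k z * fourierSum f k ^ n) := by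
    intro k
    have h1 : Complex.exp (t * fourierSum f k) =
        ∑' n : ℕ, ((t : ℂ) * fourierSum f k) ^ n / n.factorial := by
      rw [Complex.exp_eq_exp_ℂ, NormedSpace.exp_eq_tsum_div]
    rw [show -((t : ℂ) * (1 - fourierSum f k)) = -t + t * fourierSum f k by ring, Complex.exp_add, h1,
      mul_left_comm, ← tsum_mul_left]
    congr 2; ext n
    rw [mul_pow]; ring
  simp only [heat, fcoef, e]
  rw [integral_const_mul, ← key, mul_left_comm, ← tsum_mul_left]
  congr 2; ext n
  rw [integral_const_mul]; ring

/-- This identity replaces a shift of the integration contour. Only summability at the two tilts is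
used, so it reaches boundary points of the Wulff shape. -/
lemma heat_tilt {d : ℕ} {f : Lat d → ℝ} {μ : Vec d} (hf : Summable f)
    (hfμ : Summable (tilt f μ)) (t : ℝ) (z : Lat d) :
    heat t (tilt f μ) z = Real.exp (inner ℝ μ (toVec z)) * heat t f z := by
  rw [heat_eq_tsum hf, heat_eq_tsum hfμ, mul_left_comm]
  congr 1
  rw [← tsum_mul_left]
  refine tsum_congr fun n => ?_
  rw [fcoef_pow_tilt hf hfμ]; ring

/-- A constant factor leaves the time integral whether or not the integrand is integrable, so no
integrability has to be known at this point. -/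
lemma green_tilt {d : ℕ} {f : Lat d → ℝ} {μ : Vec d} (hf : Summable f)
    (hfμ : Summable (tilt f μ)) (z : Lat d) :
    green (tilt f μ) z = Real.exp (inner ℝ μ (toVec z)) * green f z := by
  simp only [green, heat_tilt hf hfμ, integral_const_mul]

lemma continuous_heat {d : ℕ} {f : Lat d → ℝ} (hf : Summable f) (z : Lat d) :
    Continuous fun t : ℝ => heat t f z := by
  have hc := continuous_fourierSum hf
  refine continuous_const.mul ?_
  refine continuous_parametric_integral_of_continuous ?_ (isCompact_cube d)
  have := (continuous_chr (d := d) z)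
  simp only [Function.uncurry_def]
  fun_prop

lemma norm_exp_heat {d : ℕ} (f : Lat d → ℝ) (t : ℝ) (k : Vec d) :
    ‖Complex.exp (-(t * (1 - fourierSum f k)))‖ = Real.exp (-(t * (1 - fourierSum f k).re)) := by
  rw [Complex.norm_exp]; simp

/-- Fubini, with the integrand dominated by `exp (-s t)`. The gap `s` is available only for
subcritical kernels; at criticality only the time integral is used. -/
lemma green_eq_fcoef {d : ℕ} {f : Lat d → ℝ} (hf : Summable f) {s : ℝ} (hs : 0 < s)
    (hre : ∀ k ∈ cube d, s ≤ (1 - fourierSum f k).re) (z : Lat d) :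
    green f z = fcoef (fun k => (1 - fourierSum f k)⁻¹) z := by
  have hc := continuous_fourierSum hf
  have hvol : volume (cube d) < ⊤ := (isCompact_cube d).measure_lt_top
  have hch := (continuous_chr (d := d) z)
  simp only [green, heat, fcoef]
  rw [integral_const_mul]
  congr 1
  rw [integral_integral_swap]
  · refine setIntegral_congr_fun (measurableSet_cube d) fun k hk => ?_
    rw [integral_const_mul]
    congr 1
    have hneg : (-(1 - fourierSum f k)).re < 0 := by
      have := hre k hk
      rw [Complex.neg_re]; linarith
    have := integral_exp_mul_complex_Ioi hneg 0
    have e : ∀ t : ℝ, -((t : ℂ) * (1 - fourierSum f k)) = -(1 - fourierSum f k) * t := fun t => by ring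
    simp only [e, this]
    rw [Complex.ofReal_zero, mul_zero, Complex.exp_zero, neg_div_neg_eq, one_div]
  · have hm : Continuous (Function.uncurry fun (t : ℝ) (k : Vec d) =>
        chr k z * Complex.exp (-(t * (1 - fourierSum f k)))) := by
      simp only [Function.uncurry_def]; fun_prop
    rw [integrable_prod_iff hm.aestronglyMeasurable]
    refine ⟨.of_forall fun t => ?_, ?_⟩
    · exact (Continuous.continuousOn (by fun_prop)).integrableOn_compact (isCompact_cube d)
    · refine Integrable.mono' (g := fun t => volume.real (cube d) * Real.exp (-s * t))
        ((exp_neg_integrableOn_Ioi 0 hs).const_mul _) ?_ ?_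
      · exact hm.norm.stronglyMeasurable.integral_prod_right'.aestronglyMeasurable
      · refine (ae_restrict_iff' measurableSet_Ioi).mpr (.of_forall fun t ht => ?_)
        have ht' : (0 : ℝ) < t := ht
        rw [Real.norm_of_nonneg (integral_nonneg fun _ => norm_nonneg _)]
        have hb : ∀ k ∈ cube d, ‖chr k z * Complex.exp (-(t * (1 - fourierSum f k)))‖ ≤
            Real.exp (-s * t) := by
          intro k hk
          rw [norm_mul, norm_chr, one_mul, norm_exp_heat]
          have := mul_le_mul_of_nonneg_left (hre k hk) ht'.le
          apply Real.exp_le_exp.mpr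
          linarith
        have := setIntegral_mono_on (μ := volume) ((Continuous.continuousOn (by fun_prop)).integrableOn_compact
          (isCompact_cube d)) (integrableOn_const hvol.ne) (measurableSet_cube d) hb
        rw [setIntegral_const] at this
        simpa using this

/-- A summable solution of `S = g + J * S` is the convolution of `g` with the Green function
of `J`. -/
lemma eq_tsum_mul_green {d : ℕ} {S g J : Lat d → ℝ} (hS : Summable S) (hg : Summable g)
    (hJ : Summable J) (heq : ∀ x, S x = g x + conv J S x) {s : ℝ} (hs : 0 < s)
    (hre : ∀ k ∈ cube d, s ≤ (1 - fourierSum J k).re) (x : Lat d) :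
    (S x : ℂ) = ∑' y, (g y : ℂ) * green J (x - y) := by
  have hne : ∀ k ∈ cube d, 1 - fourierSum J k ≠ 0 := by
    intro k hk h
    have := hre k hk
    rw [h, Complex.zero_re] at this
    linarith
  have hcS : Summable (conv J S) := by
    have : conv J S = fun x => S x - g x := by ext x; rw [heq x]; ring
    rw [this]; exact hS.sub hg
  have hF : ∀ k ∈ cube d, fourierSum S k = fourierSum g k * (1 - fourierSum J k)⁻¹ := by
    intro k hk
    have h1 : fourierSum S k = fourierSum g k + fourierSum J k * fourierSum S k := by
      rw [← fourierSum_conv hJ hS, ← fourierSum_add hg hcS]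
      congr 1; ext x; exact heq x
    rw [eq_mul_inv_iff_mul_eq₀ (hne k hk)]
    linear_combination h1
  have hcont : ContinuousOn (fun k => (1 - fourierSum J k)⁻¹) (cube d) :=
    (continuous_const.sub (continuous_fourierSum hJ)).continuousOn.inv₀ hne
  rw [← fcoef_fourierSum hS x]
  have : fcoef (fourierSum S) x = fcoef (fun k => fourierSum g k * (1 - fourierSum J k)⁻¹) x := by
    simp only [fcoef]
    congr 1
    exact setIntegral_congr_fun (measurableSet_cube d) fun k hk => by simp only [hF k hk]
  rw [this, fcoef_fourierSum_mul hg hcont]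
  simp only [green_eq_fcoef hJ hs hre]

/-- The tilt of the Green function representation. -/
lemma tilt_eq_tsum_mul_green {d : ℕ} {S g J : Lat d → ℝ} (hS : Summable S) (hg : Summable g)
    (hJ : Summable J) (heq : ∀ x, S x = g x + conv J S x) {s : ℝ} (hs : 0 < s)
    (hre : ∀ k ∈ cube d, s ≤ (1 - fourierSum J k).re) {μ : Vec d} (hJμ : Summable (tilt J μ))
    (x : Lat d) :
    (tilt S μ x : ℂ) = ∑' y, (tilt g μ y : ℂ) * green (tilt J μ) (x - y) := by
  have h1 := eq_tsum_mul_green hS hg hJ heq hs hre x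
  rw [tilt, Complex.ofReal_mul, h1, ← tsum_mul_right]
  congr 1; ext y
  rw [green_tilt hJ hJμ, ← mul_assoc]
  have : ((tilt g μ y : ℝ) : ℂ) * (Real.exp (inner ℝ μ (toVec (x - y))) : ℝ) =
      (Real.exp (inner ℝ μ (toVec x)) : ℝ) * (g y : ℝ) := by
    exact_mod_cast tilt_sub_mul g μ x y
  rw [this]; ring

/-! ### Critical kernels and their moments -/

/-- A critical kernel: total mass one, `2 + ζ` moments, an infrared bound, a nonzero drift and, in
high dimensions, an `ℓ²` moment of order `d - 1`. -/
structure CritKernel {d : ℕ} (M K ζ c : ℝ) (A : Lat d → ℝ) : Prop where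
  summable : Summable A
  abs_le : ∑' y, |A y| ≤ M
  mom_summable : Summable fun y => ‖toVec y‖ ^ (2 + ζ) * |A y|
  mom_le : ∑' y, ‖toVec y‖ ^ (2 + ζ) * |A y| ≤ M
  infrared : ∀ k ∈ cube d, K * ‖k‖ ^ 2 ≤ (1 - fourierSum A k).re
  tsum_eq : ∑' y, A y = 1
  drift_le : c ≤ ‖firstMoment A‖
  high_summable : 6 ≤ d → Summable fun y => (‖toVec y‖ ^ (d - 1) * A y) ^ 2
  high_le : 6 ≤ d → ∑' y, (‖toVec y‖ ^ (d - 1) * A y) ^ 2 ≤ M ^ 2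

/-- Nonzero lattice points have norm at least one; positivity of `p` avoids the value `0 ^ 0 = 1` at
the origin. -/
lemma rpow_norm_toVec_mono {d : ℕ} {p q : ℝ} (hp : 0 < p) (hpq : p ≤ q) (y : Lat d) :
    ‖toVec y‖ ^ p ≤ ‖toVec y‖ ^ q := by
  by_cases hy : y = 0
  · rw [hy, toVec_zero, norm_zero, Real.zero_rpow hp.ne', Real.zero_rpow (hp.trans_le hpq).ne']
  · exact Real.rpow_le_rpow_of_exponent_le (one_le_norm_toVec hy) hpq

lemma summable_norm_mul {d : ℕ} {f : Lat d → ℝ} {p q : ℝ} (hp : 0 < p) (hpq : p ≤ q)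
    (h : Summable fun y => ‖toVec y‖ ^ q * |f y|) :
    Summable fun y => ‖toVec y‖ ^ p * |f y| :=
  Summable.of_nonneg_of_le (fun y => by positivity)
    (fun y => mul_le_mul_of_nonneg_right (rpow_norm_toVec_mono hp hpq y) (abs_nonneg _)) h

lemma tsum_norm_mul_le {d : ℕ} {f : Lat d → ℝ} {p q : ℝ} (hp : 0 < p) (hpq : p ≤ q)
    (h : Summable fun y => ‖toVec y‖ ^ q * |f y|) :
    ∑' y, ‖toVec y‖ ^ p * |f y| ≤ ∑' y, ‖toVec y‖ ^ q * |f y| :=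
  (summable_norm_mul hp hpq h).tsum_le_tsum
    (fun y => mul_le_mul_of_nonneg_right (rpow_norm_toVec_mono hp hpq y) (abs_nonneg _)) h

lemma abs_inner_toVec_le {d : ℕ} (v : Vec d) (y : Lat d) :
    |(inner ℝ v (toVec y) : ℝ)| ≤ ‖v‖ * ‖toVec y‖ := abs_real_inner_le_norm _ _

lemma summable_inner_mul {d : ℕ} {f : Lat d → ℝ} (h : Summable fun y => ‖toVec y‖ * |f y|)
    (v : Vec d) : Summable fun y => (inner ℝ v (toVec y) : ℝ) * f y := by
  refine Summable.of_norm_bounded (h.mul_left ‖v‖) fun y => ?_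
  rw [norm_mul, Real.norm_eq_abs, Real.norm_eq_abs, ← mul_assoc]
  exact mul_le_mul_of_nonneg_right (abs_inner_toVec_le v y) (abs_nonneg _)

lemma inner_firstMoment {d : ℕ} {f : Lat d → ℝ} (h : Summable fun y => ‖toVec y‖ * |f y|)
    (v : Vec d) : (inner ℝ v (firstMoment f) : ℝ) = ∑' y, (inner ℝ v (toVec y) : ℝ) * f y := by
  have h1 : ∀ j : Fin d, Summable fun y : Lat d => (y j : ℝ) * f y := by
    intro j
    have := summable_inner_mul h (EuclideanSpace.single j 1)
    simpa [inner_toVec] using this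
  simp only [inner_toVec, Finset.sum_mul]
  rw [Summable.tsum_finsetSum (fun j _ => by simpa [mul_assoc] using (h1 j).mul_left (v j))]
  simp only [firstMoment, PiLp.inner_apply, mul_assoc, tsum_mul_left]
  simp [mul_comm]

lemma norm_firstMoment_le {d : ℕ} {f : Lat d → ℝ} (h : Summable fun y => ‖toVec y‖ * |f y|) :
    ‖firstMoment f‖ ≤ ∑' y, ‖toVec y‖ * |f y| := by
  set v := firstMoment f with hv
  by_cases h0 : ‖v‖ = 0
  · rw [h0]; exact tsum_nonneg fun y => by positivity
  have h1 : ‖v‖ * ‖v‖ ≤ ‖v‖ * ∑' y, ‖toVec y‖ * |f y| := by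
    rw [← real_inner_self_eq_norm_mul_norm]
    nth_rw 2 [hv]
    rw [inner_firstMoment h, ← tsum_mul_left]
    refine (summable_inner_mul h v).tsum_le_tsum (fun y => ?_) (h.mul_left _)
    refine (le_abs_self _).trans ?_
    rw [abs_mul, ← mul_assoc]
    exact mul_le_mul_of_nonneg_right (abs_inner_toVec_le v y) (abs_nonneg _)
  exact le_of_mul_le_mul_left h1 (lt_of_le_of_ne (norm_nonneg _) (Ne.symm h0))

lemma re_fourierSum {d : ℕ} {f : Lat d → ℝ} (hf : Summable f) (k : Vec d) :
    (fourierSum f k).re = ∑' y, f y * Real.cos (inner ℝ k (toVec y)) := by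
  rw [fourierSum_eq, Complex.re_tsum (summable_mul_chr hf k)]
  congr 1; ext y
  rw [Complex.re_ofReal_mul, ← conj_chr, Complex.conj_re, chr, Complex.exp_re]
  simp

lemma summable_mul_cos {d : ℕ} {f : Lat d → ℝ} (hf : Summable f) (k : Vec d) :
    Summable fun y => f y * Real.cos (inner ℝ k (toVec y)) := by
  refine Summable.of_norm_bounded hf.abs fun y => ?_
  rw [norm_mul, Real.norm_eq_abs]
  exact mul_le_of_le_one_right (abs_nonneg _) (Real.abs_cos_le_one _)

/-! ### Gaussian integrals over the cube and truncation of the kernel -/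

lemma norm_exp_sub_one_le_mul_exp (w : ℂ) : ‖Complex.exp w - 1‖ ≤ ‖w‖ * Real.exp ‖w‖ := by
  simpa using Complex.norm_exp_sub_sum_le_norm_mul_exp w 1

lemma integrable_exp_neg_mul_norm_sq (d : ℕ) {b : ℝ} (hb : 0 < b) :
    Integrable fun v : Vec d => Real.exp (-b * ‖v‖ ^ 2) := by
  have h := GaussianFourier.integrable_cexp_neg_mul_sq_norm_add (V := Vec d) (b := b)
    (by simpa using hb) 0 0
  have := h.norm
  simpa [Complex.norm_exp, ← Complex.ofReal_pow] using this

lemma integral_exp_neg_mul_norm_sq (d : ℕ) {b : ℝ} (hb : 0 < b) :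
    ∫ v : Vec d, Real.exp (-b * ‖v‖ ^ 2) = (Real.pi / b) ^ ((d : ℝ) / 2) := by
  simpa using GaussianFourier.integral_rexp_neg_mul_sq_norm (V := Vec d) hb

lemma norm_sq_le_of_mem_cube {d : ℕ} {k : Vec d} (hk : k ∈ cube d) :
    ‖k‖ ^ 2 ≤ d * Real.pi ^ 2 := by
  rw [EuclideanSpace.norm_sq_eq]
  calc ∑ j, ‖k j‖ ^ 2 ≤ ∑ _j : Fin d, Real.pi ^ 2 := by
        refine Finset.sum_le_sum fun j _ => ?_
        rw [Real.norm_eq_abs]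
        exact pow_le_pow_left₀ (abs_nonneg _) (hk j) 2
    _ = d * Real.pi ^ 2 := by simp

/-- Gaussian integrals over the cube decay like `(1 + t)^(-d/2)`. -/
lemma exists_integral_cube_exp_le (d : ℕ) {κ : ℝ} (hκ : 0 < κ) : ∃ C : ℝ, 0 < C ∧ ∀ t : ℝ, 0 ≤ t →
    ((2 * Real.pi) ^ d)⁻¹ * ∫ k in cube d, Real.exp (-(t * (κ * ‖k‖ ^ 2))) ≤
      C * (1 + t) ^ (-(d : ℝ) / 2) := by
  have hpos := two_pi_pow_pos d
  refine ⟨((2 * Real.pi) ^ d)⁻¹ * (Real.exp (κ * (d * Real.pi ^ 2)) * (Real.pi / κ) ^ ((d : ℝ) / 2)),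
    by positivity, fun t ht => ?_⟩
  rw [mul_assoc, mul_assoc]
  refine mul_le_mul_of_nonneg_left ?_ (by positivity)
  have hb : 0 < κ * (1 + t) := by positivity
  -- Replacing `t` by `1 + t` in the exponent costs a constant, since `‖k‖ ^ 2` is bounded on the
  -- cube, and makes the bound uniform down to `t = 0`.
  have h1 : ∀ k ∈ cube d, Real.exp (-(t * (κ * ‖k‖ ^ 2))) ≤
      Real.exp (κ * (d * Real.pi ^ 2)) * Real.exp (-(κ * (1 + t)) * ‖k‖ ^ 2) := by
    intro k hk
    rw [← Real.exp_add]
    apply Real.exp_le_exp.mpr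
    have := mul_le_mul_of_nonneg_left (norm_sq_le_of_mem_cube hk) hκ.le
    linarith
  have hint := (integrable_exp_neg_mul_norm_sq d hb).const_mul (Real.exp (κ * (d * Real.pi ^ 2)))
  calc ∫ k in cube d, Real.exp (-(t * (κ * ‖k‖ ^ 2)))
      ≤ ∫ k in cube d, Real.exp (κ * (d * Real.pi ^ 2)) * Real.exp (-(κ * (1 + t)) * ‖k‖ ^ 2) := by
        refine setIntegral_mono_on ?_ hint.integrableOn (measurableSet_cube d) h1
        exact (Continuous.continuousOn (by fun_prop)).integrableOn_compact (isCompact_cube d)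
    _ ≤ ∫ k, Real.exp (κ * (d * Real.pi ^ 2)) * Real.exp (-(κ * (1 + t)) * ‖k‖ ^ 2) :=
        setIntegral_le_integral hint (.of_forall fun k => by positivity)
    _ = _ := by
        rw [integral_const_mul, integral_exp_neg_mul_norm_sq d hb]
        congr 1
        rw [← div_div, Real.div_rpow (by positivity) (by positivity), neg_div,
          Real.rpow_neg (by positivity), div_eq_mul_inv]

/-- The part of `A` on the ball of radius `1 / a`. -/
def near {d : ℕ} (a : ℝ) (A : Lat d → ℝ) (y : Lat d) : ℝ := if a * ‖toVec y‖ ≤ 1 then A y else 0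

/-- The part of `A` off the ball of radius `1 / a`. -/
def far {d : ℕ} (a : ℝ) (A : Lat d → ℝ) (y : Lat d) : ℝ := if a * ‖toVec y‖ ≤ 1 then 0 else A y

lemma near_add_far {d : ℕ} (a : ℝ) (A : Lat d → ℝ) : (fun y => near a A y + far a A y) = A := by
  ext y; unfold near far; split_ifs <;> simp

lemma abs_near_le {d : ℕ} (a : ℝ) (A : Lat d → ℝ) (y : Lat d) : |near a A y| ≤ |A y| := by
  unfold near; split_ifs <;> simp

lemma abs_far_le {d : ℕ} (a : ℝ) (A : Lat d → ℝ) (y : Lat d) : |far a A y| ≤ |A y| := by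
  unfold far; split_ifs <;> simp

lemma summable_near {d : ℕ} (a : ℝ) {A : Lat d → ℝ} (h : Summable A) : Summable (near a A) :=
  Summable.of_norm_bounded h.abs (abs_near_le a A)

lemma summable_far {d : ℕ} (a : ℝ) {A : Lat d → ℝ} (h : Summable A) : Summable (far a A) :=
  Summable.of_norm_bounded h.abs (abs_far_le a A)

lemma abs_far_le_rpow {d : ℕ} {a p : ℝ} (ha : 0 ≤ a) (hp : 0 ≤ p) (A : Lat d → ℝ) (y : Lat d) :
    |far a A y| ≤ a ^ p * (‖toVec y‖ ^ p * |A y|) := by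
  unfold far
  split_ifs with h
  · simp only [abs_zero]; positivity
  · rw [← mul_assoc, ← Real.mul_rpow ha (norm_nonneg _)]
    exact le_mul_of_one_le_left (abs_nonneg _) (Real.one_le_rpow (not_le.mp h).le hp)

namespace CritKernel

variable {d : ℕ} {M K ζ c : ℝ} {A : Lat d → ℝ}

lemma mom_two (h : CritKernel M K ζ c A) (hζ : 0 < ζ) :
    (Summable fun y => ‖toVec y‖ ^ 2 * |A y|) ∧ ∑' y, ‖toVec y‖ ^ 2 * |A y| ≤ M := by
  have h1 := summable_norm_mul (p := 2) (by norm_num) (by linarith) h.mom_summable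
  have h2 := (tsum_norm_mul_le (p := 2) (by norm_num) (by linarith) h.mom_summable).trans h.mom_le
  simp only [Real.rpow_two] at h1 h2
  exact ⟨h1, h2⟩

lemma mom_one (h : CritKernel M K ζ c A) (hζ : 0 < ζ) :
    (Summable fun y => ‖toVec y‖ * |A y|) ∧ ∑' y, ‖toVec y‖ * |A y| ≤ M := by
  have h1 := summable_norm_mul (p := 1) (by norm_num) (by linarith) h.mom_summable
  have h2 := (tsum_norm_mul_le (p := 1) (by norm_num) (by linarith) h.mom_summable).trans h.mom_le
  simp only [Real.rpow_one] at h1 h2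
  exact ⟨h1, h2⟩

lemma M_nonneg (h : CritKernel M K ζ c A) : 0 ≤ M :=
  (tsum_nonneg fun _ => abs_nonneg _).trans h.abs_le

lemma norm_drift_le (h : CritKernel M K ζ c A) (hζ : 0 < ζ) : ‖firstMoment A‖ ≤ M :=
  (norm_firstMoment_le (h.mom_one hζ).1).trans (h.mom_one hζ).2

lemma summable_tilt_near (h : CritKernel M K ζ c A) {a : ℝ} (ha : 0 ≤ a) {u : Vec d}
    (hu : ‖u‖ ≤ 1) : Summable (tilt (near a A) (a • u)) := by
  refine Summable.of_norm_bounded (h.summable.abs.mul_left (Real.exp 1)) fun y => ?_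
  rw [tilt, norm_mul, Real.norm_eq_abs, Real.norm_of_nonneg (Real.exp_pos _).le, mul_comm]
  unfold near
  split_ifs with hy
  · gcongr
    rw [real_inner_smul_left]
    have := (le_abs_self _).trans (abs_inner_toVec_le u y)
    calc a * inner ℝ u (toVec y) ≤ a * (‖u‖ * ‖toVec y‖) := by gcongr
      _ ≤ a * (1 * ‖toVec y‖) := by gcongr
      _ ≤ 1 := by simpa using hy
  · simp only [abs_zero, mul_zero]; positivity

/-- One term of the change of the symbol under truncation and tilt, with `s` the exponent of the
tilt and `θ` the phase. Inside the ball the corrections beyond `s * A` are quadratic. Outside the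
ball the linear term is kept too, so that it sums to the exact drift; its cost is quadratic because
`a * r ≥ 1` there. -/
lemma pointwise_tilt_near {A r s θ a κ : ℝ} (hr : 0 ≤ r) (ha : 0 ≤ a) (hκ : 0 ≤ κ) (hs : |s| ≤ a * r)
    (hθ : |θ| ≤ κ * r) :
    (if a * r ≤ 1 then A else 0) * Real.exp s * Real.cos θ - A * Real.cos θ ≤
      s * A + (3 * a ^ 2 + 2 * a * κ) * (r ^ 2 * |A|) := by
  have hcos : |Real.cos θ - 1| ≤ |θ| := by simpa using Real.abs_cos_sub_cos_le θ 0
  have hs2 : s ^ 2 ≤ a ^ 2 * r ^ 2 := by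
    rw [← mul_pow]; exact sq_le_sq' (by linarith [neg_abs_le s]) ((le_abs_self s).trans hs)
  split_ifs with hy
  · have h1 := Real.abs_exp_sub_one_sub_id_le (hs.trans hy)
    have h2 := Real.abs_exp_sub_one_le (hs.trans hy)
    have e : A * Real.exp s * Real.cos θ - A * Real.cos θ = s * A +
        (A * (Real.exp s - 1 - s) + A * ((Real.exp s - 1) * (Real.cos θ - 1))) := by ring
    rw [e]
    gcongr
    refine (le_abs_self _).trans ((abs_add_le _ _).trans ?_)
    rw [abs_mul, abs_mul, abs_mul]
    have h3 : |Real.exp s - 1| * |Real.cos θ - 1| ≤ 2 * (a * r) * (κ * r) := by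
      apply mul_le_mul (h2.trans (by linarith)) (hcos.trans hθ) (abs_nonneg _) (by positivity)
    have h4 : |Real.exp s - 1 - s| ≤ 3 * (a ^ 2 * r ^ 2) := h1.trans (by nlinarith [sq_nonneg (a * r)])
    calc |A| * |Real.exp s - 1 - s| + |A| * (|Real.exp s - 1| * |Real.cos θ - 1|)
        ≤ |A| * (3 * (a ^ 2 * r ^ 2)) + |A| * (2 * (a * r) * (κ * r)) := by gcongr
      _ = _ := by ring
  · have hy' : 1 ≤ a * r := (not_le.mp hy).le
    have h5 : (1 : ℝ) + a * r ≤ 3 * (a ^ 2 * r ^ 2) := by nlinarith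
    have h6 : -(A * Real.cos θ) - s * A ≤ |A| * (1 + a * r) := by
      have e1 : -(A * Real.cos θ) ≤ |A| * 1 := by
        refine (neg_le_abs _).trans ?_
        rw [abs_mul]
        exact mul_le_mul_of_nonneg_left (Real.abs_cos_le_one _) (abs_nonneg _)
      have e2 : -(s * A) ≤ |A| * (a * r) := by
        refine (neg_le_abs _).trans ?_
        rw [abs_mul, mul_comm]
        exact mul_le_mul_of_nonneg_left hs (abs_nonneg _)
      linarith
    have h7 : |A| * (1 + a * r) ≤ |A| * (3 * (a ^ 2 * r ^ 2)) := by gcongr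
    have h8 : 0 ≤ 2 * a * κ * (r ^ 2 * |A|) := by positivity
    nlinarith

/-- The infrared bound survives a truncated tilt of size `a`, up to the drift term and an error of
order `a ^ 2`. The cross term `2 * a * ‖k‖ * M` is absorbed by completing a square, at the price of
half of the infrared bound. -/
lemma re_one_sub_tilt_near (h : CritKernel M K ζ c A) (hζ : 0 < ζ) (hK : 0 < K) {a : ℝ} (ha : 0 ≤ a)
    {u : Vec d} (hu : ‖u‖ ≤ 1) {k : Vec d} (hk : k ∈ cube d) :
    K / 2 * ‖k‖ ^ 2 - (3 * M + 2 * M ^ 2 / K) * a ^ 2 - a * inner ℝ u (firstMoment A) ≤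
      (1 - fourierSum (tilt (near a A) (a • u)) k).re := by
  have hsum := h.summable_tilt_near ha hu
  have hir := h.infrared k hk
  rw [Complex.sub_re, Complex.one_re] at hir ⊢
  rw [re_fourierSum h.summable] at hir
  rw [re_fourierSum hsum]
  have s1 := summable_mul_cos h.summable k
  have s2 := summable_mul_cos hsum k
  have s3 := (summable_inner_mul (h.mom_one hζ).1 (a • u))
  have s4 := (h.mom_two hζ).1.mul_left (3 * a ^ 2 + 2 * a * ‖k‖)
  have key := (s2.sub s1).tsum_le_tsum (fun y => by
    simp only [tilt]
    refine pointwise_tilt_near (norm_nonneg (toVec y)) ha (norm_nonneg k) ?_ (abs_inner_toVec_le k y)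
    rw [real_inner_smul_left, abs_mul, abs_of_nonneg ha]
    gcongr
    exact (abs_inner_toVec_le u y).trans (mul_le_of_le_one_left (norm_nonneg _) hu)) (s3.add s4)
  rw [s2.tsum_sub s1, s3.tsum_add s4, tsum_mul_left, ← inner_firstMoment (h.mom_one hζ).1,
    real_inner_smul_left] at key
  have hM := h.M_nonneg
  have h5 : (3 * a ^ 2 + 2 * a * ‖k‖) * ∑' y, ‖toVec y‖ ^ 2 * |A y| ≤ (3 * a ^ 2 + 2 * a * ‖k‖) * M :=
    mul_le_mul_of_nonneg_left (h.mom_two hζ).2 (by positivity)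
  have h6 : 2 * a * ‖k‖ * M ≤ K / 2 * ‖k‖ ^ 2 + 2 * M ^ 2 / K * a ^ 2 := by
    have : 0 ≤ (K * ‖k‖ - 2 * M * a) ^ 2 / (2 * K) := by positivity
    have e : (K * ‖k‖ - 2 * M * a) ^ 2 / (2 * K) =
      K / 2 * ‖k‖ ^ 2 + 2 * M ^ 2 / K * a ^ 2 - 2 * a * ‖k‖ * M := by field_simp; ring
    linarith
  linarith

end CritKernel

/-! ### Pointwise bounds on the semigroup -/

lemma norm_heat_le {d : ℕ} (f : Lat d → ℝ) (t : ℝ) (z : Lat d) :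
    ‖heat t f z‖ ≤ ((2 * Real.pi) ^ d)⁻¹ * ∫ k in cube d, Real.exp (-(t * (1 - fourierSum f k).re)) := by
  refine (norm_fcoef_le _ z).trans_eq ?_
  simp only [norm_exp_heat]

lemma setIntegral_cube_mono {d : ℕ} {F G : Vec d → ℝ} (hF : Continuous F) (hG : Continuous G)
    (h : ∀ k ∈ cube d, F k ≤ G k) : ∫ k in cube d, F k ≤ ∫ k in cube d, G k :=
  setIntegral_mono_on (hF.continuousOn.integrableOn_compact (isCompact_cube d))
    (hG.continuousOn.integrableOn_compact (isCompact_cube d)) (measurableSet_cube d) h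

lemma norm_heat_le_of_le {d : ℕ} {f : Lat d → ℝ} (hf : Summable f) {t b κ : ℝ} (ht : 0 ≤ t)
    (h : ∀ k ∈ cube d, κ * ‖k‖ ^ 2 - b ≤ (1 - fourierSum f k).re) (z : Lat d) :
    ‖heat t f z‖ ≤ Real.exp (t * b) *
      (((2 * Real.pi) ^ d)⁻¹ * ∫ k in cube d, Real.exp (-(t * (κ * ‖k‖ ^ 2)))) := by
  refine (norm_heat_le f t z).trans ?_
  rw [mul_left_comm, ← integral_const_mul (Real.exp (t * b))]
  have hc := continuous_fourierSum hf
  refine mul_le_mul_of_nonneg_left (setIntegral_cube_mono ?_ ?_ fun k hk => ?_)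
    (by have := two_pi_pow_pos d; positivity)
  rotate_left
  · fun_prop
  rotate_left
  · exact Real.continuous_exp.comp
      (continuous_const.mul (Complex.continuous_re.comp (continuous_const.sub hc))).neg
  · rw [← Real.exp_add]
    apply Real.exp_le_exp.mpr
    have := mul_le_mul_of_nonneg_left (h k hk) ht
    linarith

lemma exists_unit_dual {d : ℕ} (w : Vec d) : ∃ u : Vec d, ‖u‖ ≤ 1 ∧ (inner ℝ u w : ℝ) = ‖w‖ := by
  refine ⟨‖w‖⁻¹ • w, ?_, ?_⟩
  · rw [norm_smul, norm_inv, norm_norm]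
    exact inv_mul_le_one
  · rw [real_inner_smul_left, real_inner_self_eq_norm_sq]
    by_cases h : ‖w‖ = 0
    · simp [h]
    · field_simp

lemma fcoef_sub {d : ℕ} {F G : Vec d → ℂ} (hF : Continuous F) (hG : Continuous G) (z : Lat d) :
    fcoef F z - fcoef G z = fcoef (fun k => F k - G k) z := by
  have hch := continuous_chr (d := d) z
  simp only [fcoef, mul_sub]
  rw [integral_sub, mul_sub]
  · exact (hch.mul hF).continuousOn.integrableOn_compact (isCompact_cube d)
  · exact (hch.mul hG).continuousOn.integrableOn_compact (isCompact_cube d)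

namespace CritKernel

variable {d : ℕ} {M K ζ c : ℝ} {A : Lat d → ℝ}

lemma re_one_sub_near (h : CritKernel M K ζ c A) (hζ : 0 < ζ) (hK : 0 < K) {a : ℝ} (ha : 0 ≤ a)
    {k : Vec d} (hk : k ∈ cube d) :
    K / 2 * ‖k‖ ^ 2 - (3 * M + 2 * M ^ 2 / K) * a ^ 2 ≤ (1 - fourierSum (near a A) k).re := by
  have := h.re_one_sub_tilt_near hζ hK ha (u := 0) (by simp) hk
  have e : tilt (near a A) (a • (0 : Vec d)) = near a A := by ext y; simp [tilt]
  rw [e] at this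
  simpa using this

lemma tsum_abs_far_le (h : CritKernel M K ζ c A) {a p : ℝ} (ha : 0 ≤ a) (hp : 0 < p)
    (hp' : p ≤ 2 + ζ) : ∑' y, |far a A y| ≤ a ^ p * M := by
  have h1 := summable_norm_mul hp hp' h.mom_summable
  have h2 := (tsum_norm_mul_le hp hp' h.mom_summable).trans h.mom_le
  calc ∑' y, |far a A y| ≤ ∑' y, a ^ p * (‖toVec y‖ ^ p * |A y|) :=
        (summable_far a h.summable).abs.tsum_le_tsum (fun y => abs_far_le_rpow ha hp.le A y)
          (h1.mul_left _)
    _ ≤ a ^ p * M := by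
        rw [tsum_mul_left]
        exact mul_le_mul_of_nonneg_left h2 (Real.rpow_nonneg ha p)

lemma tsum_far_sq_le (h : CritKernel M K ζ c A) (hd : 6 ≤ d) {a : ℝ} (ha : 0 ≤ a) :
    ∑' y, far a A y ^ 2 ≤ (a ^ (d - 1)) ^ 2 * M ^ 2 := by
  have h1 := h.high_summable hd
  have hle : ∀ y, far a A y ^ 2 ≤ (a ^ (d - 1)) ^ 2 * (‖toVec y‖ ^ (d - 1) * A y) ^ 2 := by
    intro y
    have := abs_far_le_rpow ha (Nat.cast_nonneg (d - 1)) A y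
    rw [Real.rpow_natCast, Real.rpow_natCast] at this
    rw [← mul_pow, sq_le_sq]
    refine this.trans_eq ?_
    rw [abs_mul, abs_mul, abs_of_nonneg (pow_nonneg ha _), abs_of_nonneg (pow_nonneg (norm_nonneg _) _)]
  calc ∑' y, far a A y ^ 2 ≤ ∑' y, (a ^ (d - 1)) ^ 2 * (‖toVec y‖ ^ (d - 1) * A y) ^ 2 :=
        (Summable.of_nonneg_of_le (fun y => sq_nonneg _) hle (h1.mul_left _)).tsum_le_tsum hle
          (h1.mul_left _)
    _ ≤ _ := by
        rw [tsum_mul_left]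
        exact mul_le_mul_of_nonneg_left (h.high_le hd) (sq_nonneg _)

/-- The difference of the kernels of the semigroups of `A` and of its truncation. -/
lemma norm_heat_sub_near_le (h : CritKernel M K ζ c A) (hζ : 0 < ζ) (hK : 0 < K) {a t : ℝ}
    (ha : 0 ≤ a) (ht : 0 ≤ t) (hta : t * a ^ 2 ≤ 1) (z : Lat d) :
    ‖heat t A z - heat t (near a A) z‖ ≤ ((2 * Real.pi) ^ d)⁻¹ * ∫ k in cube d,
      Real.exp (4 * M + 2 * M ^ 2 / K) * Real.exp (-(t * (K / 2 * ‖k‖ ^ 2))) *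
        (t * ‖fourierSum (far a A) k‖) := by
  have hN := continuous_fourierSum (summable_near a h.summable)
  have hF := continuous_fourierSum (summable_far a h.summable)
  have hA := continuous_fourierSum h.summable
  have hM := h.M_nonneg
  rw [heat, heat, fcoef_sub (by fun_prop) (by fun_prop)]
  refine (norm_fcoef_le _ z).trans ?_
  refine mul_le_mul_of_nonneg_left (setIntegral_cube_mono (by fun_prop) (by fun_prop) fun k hk => ?_)
    (by have := two_pi_pow_pos d; positivity)
  have e1 : fourierSum A k = fourierSum (near a A) k + fourierSum (far a A) k := by
    rw [← fourierSum_add (summable_near a h.summable) (summable_far a h.summable), near_add_far]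
  have e2 : Complex.exp (-(t * (1 - fourierSum A k))) - Complex.exp (-(t * (1 - fourierSum (near a A) k)))
      = Complex.exp (-(t * (1 - fourierSum (near a A) k))) *
        (Complex.exp (t * fourierSum (far a A) k) - 1) := by
    rw [mul_sub_one, ← Complex.exp_add, e1]; congr 2; ring
  have e3 : ‖(t : ℂ) * fourierSum (far a A) k‖ = t * ‖fourierSum (far a A) k‖ := by
    rw [norm_mul, Complex.norm_real, Real.norm_of_nonneg ht]
  -- The second moment and `t * a ^ 2 ≤ 1` keep the far exponent bounded, so its exponential is a
  -- perturbation linear in the far symbol; the extra factor `exp M` is what turns `3 * M` into `4 *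
  -- M`.
  have h4 : t * ‖fourierSum (far a A) k‖ ≤ M := by
    have h5 := (norm_fourierSum_le (summable_far a h.summable) k).trans
      (h.tsum_abs_far_le ha (p := 2) (by norm_num) (by linarith))
    rw [Real.rpow_two] at h5
    calc t * ‖fourierSum (far a A) k‖ ≤ t * (a ^ 2 * M) := by gcongr
      _ = (t * a ^ 2) * M := by ring
      _ ≤ M := mul_le_of_le_one_left hM hta
  have h6 := h.re_one_sub_near hζ hK ha hk
  have hC : 0 ≤ 3 * M + 2 * M ^ 2 / K := by positivity
  have h7 : -(t * (1 - fourierSum (near a A) k).re) ≤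
      (3 * M + 2 * M ^ 2 / K) + -(t * (K / 2 * ‖k‖ ^ 2)) := by
    have h8 := mul_le_mul_of_nonneg_left h6 ht
    have h9 := mul_le_mul_of_nonneg_left hta hC
    linarith
  rw [e2, norm_mul, norm_exp_heat]
  calc Real.exp (-(t * (1 - fourierSum (near a A) k).re)) *
        ‖Complex.exp (t * fourierSum (far a A) k) - 1‖
      ≤ Real.exp ((3 * M + 2 * M ^ 2 / K) + -(t * (K / 2 * ‖k‖ ^ 2))) *
        (t * ‖fourierSum (far a A) k‖ * Real.exp M) := by
        gcongr
        refine (norm_exp_sub_one_le_mul_exp _).trans ?_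
        rw [e3]
        gcongr
    _ = _ := by
        rw [show 4 * M + 2 * M ^ 2 / K = (3 * M + 2 * M ^ 2 / K) + M by ring, Real.exp_add _ M,
          Real.exp_add _ (-(t * (K / 2 * ‖k‖ ^ 2)))]
        ring

/-- A Chernoff bound: the truncated kernel is tilted by `a` in the direction of `z - t η`. The drift
term of the tilted symbol supplies the shift by `t η`, and `t * a ^ 2 ≤ 1` bounds the quadratic
cost. -/
lemma norm_heat_near_le (h : CritKernel M K ζ c A) (hζ : 0 < ζ) (hK : 0 < K) {a t : ℝ}
    (ha : 0 ≤ a) (ht : 0 ≤ t) (hta : t * a ^ 2 ≤ 1) (z : Lat d) :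
    ‖heat t (near a A) z‖ ≤ Real.exp (3 * M + 2 * M ^ 2 / K) *
      Real.exp (-(a * ‖toVec z - t • firstMoment A‖)) *
      (((2 * Real.pi) ^ d)⁻¹ * ∫ k in cube d, Real.exp (-(t * (K / 2 * ‖k‖ ^ 2)))) := by
  obtain ⟨u, hu, huw⟩ := exists_unit_dual (toVec z - t • firstMoment A)
  have hM := h.M_nonneg
  have hs := h.summable_tilt_near ha hu
  have h1 := heat_tilt (summable_near a h.summable) hs t z
  have h2 := norm_heat_le_of_le hs ht (κ := K / 2)
    (b := (3 * M + 2 * M ^ 2 / K) * a ^ 2 + a * inner ℝ u (firstMoment A))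
    (fun k hk => by have := h.re_one_sub_tilt_near hζ hK ha hu hk; linarith) z
  rw [h1, norm_mul, Complex.norm_real, Real.norm_of_nonneg (Real.exp_pos _).le] at h2
  set I := ((2 * Real.pi) ^ d)⁻¹ * ∫ k in cube d, Real.exp (-(t * (K / 2 * ‖k‖ ^ 2)))
  have hI : 0 ≤ I := mul_nonneg (by positivity) (integral_nonneg fun k => (Real.exp_pos _).le)
  have h3 : ‖heat t (near a A) z‖ = Real.exp (-(inner ℝ (a • u) (toVec z))) *
      (Real.exp (inner ℝ (a • u) (toVec z)) * ‖heat t (near a A) z‖) := by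
    rw [← mul_assoc, ← Real.exp_add]; simp
  rw [h3]
  refine (mul_le_mul_of_nonneg_left h2 (Real.exp_pos _).le).trans ?_
  rw [← mul_assoc]
  refine mul_le_mul_of_nonneg_right ?_ hI
  rw [← Real.exp_add, ← Real.exp_add]
  apply Real.exp_le_exp.mpr
  rw [← huw, inner_sub_right, real_inner_smul_left, real_inner_smul_right]
  have h9 := mul_le_mul_of_nonneg_left hta (show 0 ≤ 3 * M + 2 * M ^ 2 / K by positivity)
  linarith

end CritKernel

lemma exists_norm_heat_le (d : ℕ) {K : ℝ} (hK : 0 < K) : ∃ C : ℝ, 0 < C ∧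
    ∀ (M ζ c : ℝ) (A : Lat d → ℝ), CritKernel M K ζ c A → ∀ (t : ℝ) (z : Lat d), 0 ≤ t →
      ‖heat t A z‖ ≤ C * (1 + t) ^ (-(d : ℝ) / 2) := by
  obtain ⟨C, hC, hC'⟩ := exists_integral_cube_exp_le d hK
  refine ⟨C, hC, fun M ζ c A h t z ht => ?_⟩
  refine (norm_heat_le_of_le h.summable ht (κ := K) (b := 0) (fun k hk => ?_) z).trans ?_
  · simpa using h.infrared k hk
  · simpa using hC' t ht

/-- The two errors are the Chernoff factor of the near part and the mass of the far part accumulated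
up to time `t`. The truncation parameter `a` stays free, to be optimised for each range of times. -/
lemma exists_norm_heat_le_far (d : ℕ) {M K ζ : ℝ} (hM : 0 < M) (hK : 0 < K) (hζ : 0 < ζ) :
    ∃ C : ℝ, 0 < C ∧ ∀ (c : ℝ) (A : Lat d → ℝ), CritKernel M K ζ c A → ∀ (a t : ℝ) (z : Lat d),
      0 < a → 0 ≤ t → t * a ^ 2 ≤ 1 → ‖heat t A z‖ ≤ C * (1 + t) ^ (-(d : ℝ) / 2) *
        (Real.exp (-(a * ‖toVec z - t • firstMoment A‖)) + t * a ^ (2 + ζ)) := by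
  obtain ⟨C, hC, hC'⟩ := exists_integral_cube_exp_le d (half_pos hK)
  refine ⟨C * (Real.exp (4 * M + 2 * M ^ 2 / K) * (1 + M)), by positivity,
    fun c A h a t z ha ht hta => ?_⟩
  have hI := hC' t ht
  set I := ((2 * Real.pi) ^ d)⁻¹ * ∫ k in cube d, Real.exp (-(t * (K / 2 * ‖k‖ ^ 2))) with hIdef
  have hI0 : 0 ≤ I := mul_nonneg (by positivity) (integral_nonneg fun k => (Real.exp_pos _).le)
  set E := Real.exp (-(a * ‖toVec z - t • firstMoment A‖))
  have h1 := h.norm_heat_near_le hζ hK ha.le ht hta z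
  have h2 := h.norm_heat_sub_near_le hζ hK ha.le ht hta z
  have h3 : ((2 * Real.pi) ^ d)⁻¹ * ∫ k in cube d,
      Real.exp (4 * M + 2 * M ^ 2 / K) * Real.exp (-(t * (K / 2 * ‖k‖ ^ 2))) *
        (t * ‖fourierSum (far a A) k‖) ≤
      Real.exp (4 * M + 2 * M ^ 2 / K) * (t * (a ^ (2 + ζ) * M)) * I := by
    rw [hIdef, mul_left_comm (_ * _), ← integral_const_mul (_ * _)]
    have hF := continuous_fourierSum (summable_far a h.summable)
    refine mul_le_mul_of_nonneg_left (setIntegral_cube_mono ?_ ?_ fun k hk => ?_) (by positivity)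
    · fun_prop
    · fun_prop
    have := (norm_fourierSum_le (summable_far a h.summable) k).trans
      (h.tsum_abs_far_le ha.le (p := 2 + ζ) (by linarith) le_rfl)
    calc _ ≤ Real.exp (4 * M + 2 * M ^ 2 / K) * Real.exp (-(t * (K / 2 * ‖k‖ ^ 2))) *
          (t * (a ^ (2 + ζ) * M)) := by gcongr
      _ = _ := by ring
  have h4 : Real.exp (3 * M + 2 * M ^ 2 / K) ≤ Real.exp (4 * M + 2 * M ^ 2 / K) :=
    Real.exp_le_exp.mpr (by linarith)
  have hp : 0 < a ^ (2 + ζ) := Real.rpow_pos_of_pos ha _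
  have hE : 0 < E := Real.exp_pos _
  set X := Real.exp (4 * M + 2 * M ^ 2 / K)
  have hX : 0 < X := Real.exp_pos _
  calc ‖heat t A z‖ ≤ ‖heat t (near a A) z‖ + ‖heat t A z - heat t (near a A) z‖ :=
        norm_le_insert' _ _
    _ ≤ X * E * I + X * (t * (a ^ (2 + ζ) * M)) * I := by
        refine add_le_add (h1.trans ?_) (h2.trans h3)
        gcongr
    _ = X * I * (E + M * (t * a ^ (2 + ζ))) := by ring
    _ ≤ X * I * ((1 + M) * (E + t * a ^ (2 + ζ))) := by
        gcongr
        have : 0 ≤ t * a ^ (2 + ζ) := by positivity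
        nlinarith
    _ ≤ X * (C * (1 + t) ^ (-(d : ℝ) / 2)) * ((1 + M) * (E + t * a ^ (2 + ζ))) := by
        gcongr
    _ = _ := by ring

/-- The far part is now measured in `ℓ²` by Parseval, which gains `a ^ (d - 1)` but gives up the
decay in time of that term. The inequality `φ ≤ b + b⁻¹ * φ ^ 2` with `b = a ^ (d - 1)` plays the
role of Cauchy–Schwarz. -/
lemma exists_norm_heat_le_far_sq (d : ℕ) (hd : 6 ≤ d) {M K ζ : ℝ} (hM : 0 < M) (hK : 0 < K)
    (hζ : 0 < ζ) :
    ∃ C : ℝ, 0 < C ∧ ∀ (c : ℝ) (A : Lat d → ℝ), CritKernel M K ζ c A → ∀ (a t : ℝ) (z : Lat d),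
      0 < a → 0 ≤ t → t * a ^ 2 ≤ 1 → ‖heat t A z‖ ≤ C *
        ((1 + t) ^ (-(d : ℝ) / 2) * Real.exp (-(a * ‖toVec z - t • firstMoment A‖)) +
          t * a ^ (d - 1)) := by
  obtain ⟨C, hC, hC'⟩ := exists_integral_cube_exp_le d (half_pos hK)
  set X := Real.exp (4 * M + 2 * M ^ 2 / K) with hXdef
  have hX : 0 < X := Real.exp_pos _
  set V := volume.real (cube d) with hV
  have hV0 : 0 ≤ V := measureReal_nonneg
  set P := (2 * Real.pi) ^ d with hP
  have hP0 : 0 < P := two_pi_pow_pos d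
  refine ⟨X * (C + P⁻¹ * (V + P * M ^ 2)), by positivity, fun c A h a t z ha ht hta => ?_⟩
  have hI := hC' t ht
  set I := P⁻¹ * ∫ k in cube d, Real.exp (-(t * (K / 2 * ‖k‖ ^ 2))) with hIdef
  set E := Real.exp (-(a * ‖toVec z - t • firstMoment A‖))
  have hE : 0 < E := Real.exp_pos _
  have h1 := h.norm_heat_near_le hζ hK ha.le ht hta z
  have h2 := h.norm_heat_sub_near_le hζ hK ha.le ht hta z
  have hF := continuous_fourierSum (summable_far a h.summable)
  set b := a ^ (d - 1) with hb
  have hb0 : 0 < b := by positivity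
  have h3 : ∫ k in cube d, X * Real.exp (-(t * (K / 2 * ‖k‖ ^ 2))) *
        (t * ‖fourierSum (far a A) k‖) ≤ X * t * (b * V + b⁻¹ * (P * (b ^ 2 * M ^ 2))) := by
    calc _ ≤ ∫ k in cube d, X * t * (b + b⁻¹ * ‖fourierSum (far a A) k‖ ^ 2) := by
          refine setIntegral_cube_mono (by fun_prop) (by fun_prop) fun k hk => ?_
          set φ := ‖fourierSum (far a A) k‖
          have e1 : Real.exp (-(t * (K / 2 * ‖k‖ ^ 2))) ≤ 1 := by
            apply Real.exp_le_one_iff.mpr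
            have : 0 ≤ t * (K / 2 * ‖k‖ ^ 2) := by positivity
            linarith
          have e2 : φ ≤ b + b⁻¹ * φ ^ 2 := by
            have e3 : 0 ≤ b⁻¹ * ((φ - b / 2) ^ 2 + 3 / 4 * b ^ 2) := by positivity
            have e4 : b⁻¹ * ((φ - b / 2) ^ 2 + 3 / 4 * b ^ 2) = b⁻¹ * φ ^ 2 - φ + b := by
              field_simp; ring
            linarith
          calc X * Real.exp (-(t * (K / 2 * ‖k‖ ^ 2))) * (t * φ) ≤ X * 1 * (t * (b + b⁻¹ * φ ^ 2)) := by
                gcongr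
            _ = _ := by ring
      _ = X * t * (b * V + b⁻¹ * ∫ k in cube d, ‖fourierSum (far a A) k‖ ^ 2) := by
          rw [integral_const_mul, integral_add, integral_const_mul, setIntegral_const, smul_eq_mul,
            mul_comm V b]
          · exact continuousOn_const.integrableOn_compact (isCompact_cube d)
          · exact (Continuous.continuousOn (by fun_prop)).integrableOn_compact (isCompact_cube d)
      _ ≤ _ := by
          rw [integral_norm_fourierSum_sq (summable_far a h.summable)]
          gcongr
          exact h.tsum_far_sq_le hd ha.le
  have h4 : Real.exp (3 * M + 2 * M ^ 2 / K) ≤ X := Real.exp_le_exp.mpr (by linarith)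
  set G := (1 + t) ^ (-(d : ℝ) / 2)
  have hG : 0 < G := Real.rpow_pos_of_pos (by linarith) _
  calc ‖heat t A z‖ ≤ ‖heat t (near a A) z‖ + ‖heat t A z - heat t (near a A) z‖ :=
        norm_le_insert' _ _
    _ ≤ X * E * (C * G) + P⁻¹ * (X * t * (b * V + b⁻¹ * (P * (b ^ 2 * M ^ 2)))) := by
        refine add_le_add (h1.trans ?_) (h2.trans ?_)
        · exact mul_le_mul (mul_le_mul_of_nonneg_right h4 hE.le) hI
            (mul_nonneg (by positivity) (integral_nonneg fun k => (Real.exp_pos _).le)) (by positivity)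
        · exact mul_le_mul_of_nonneg_left h3 (by positivity)
    _ = X * (C * (G * E) + P⁻¹ * (V + P * M ^ 2) * (t * b)) := by field_simp
    _ ≤ X * (C * (G * E) + P⁻¹ * (V + P * M ^ 2) * (t * b) +
          (C * (t * b) + P⁻¹ * (V + P * M ^ 2) * (G * E))) :=
        mul_le_mul_of_nonneg_left (le_add_of_nonneg_right (by positivity)) hX.le
    _ = _ := by ring

/-! ### Times away from the window -/

lemma integrableOn_abs_rpow_neg {p b : ℝ} (hp : 1 < p) (hb : 0 < b) (T : ℝ) :
    IntegrableOn (fun t => |t - T| ^ (-p)) {t | b < |t - T|} ∧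
      ∫ t in {t | b < |t - T|}, |t - T| ^ (-p) = 2 * (b ^ (1 - p) / (p - 1)) := by
  have hms : MeasurableSet {t : ℝ | b < |t - T|} := measurableSet_lt (by fun_prop) (by fun_prop)
  set f : ℝ → ℝ := (Set.Ioi b).indicator fun s => s ^ (-p)
  have e : {t : ℝ | b < |t - T|}.indicator (fun t => |t - T| ^ (-p)) = fun t => f |t - T| := by
    ext t; by_cases h : b < |t - T| <;> simp [f, h]
  have h1 : ∫ t, f |t - T| = 2 * (b ^ (1 - p) / (p - 1)) := by
    rw [integral_sub_right_eq_self (fun s => f |s|) T, integral_comp_abs,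
      setIntegral_indicator measurableSet_Ioi, Set.inter_eq_right.mpr (Set.Ioi_subset_Ioi hb.le),
      integral_Ioi_rpow_of_lt (by linarith) hb, neg_div, ← div_neg]
    congr 3 <;> ring
  have hne : 2 * (b ^ (1 - p) / (p - 1)) ≠ 0 := by
    have : 0 < p - 1 := by linarith
    have := Real.rpow_pos_of_pos hb (1 - p)
    positivity
  constructor
  · rw [← integrable_indicator_iff hms, e]
    -- A non-integrable function has integral zero by convention, so the nonzero value just computed
    -- forces integrability.
    by_contra hni
    rw [integral_undef hni] at h1
    exact hne h1.symm
  · rw [← integral_indicator hms, e, h1]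

/-- The sixth term of the exponential series at `u ^ (1/4)` is `u ^ (3/2) / 6!`. -/
lemma exp_neg_rpow_le {u : ℝ} (hu : 0 < u) : Real.exp (-(u ^ (1 / 4 : ℝ))) ≤ 720 * u ^ (-(3 / 2) : ℝ) := by
  have h := Real.pow_div_factorial_le_exp (u ^ (1 / 4 : ℝ)) (by positivity) 6
  rw [← Real.rpow_natCast, ← Real.rpow_mul hu.le] at h
  norm_num [Nat.factorial] at h
  rw [Real.exp_neg, Real.rpow_neg hu.le, ← div_eq_mul_inv, inv_eq_one_div, div_le_div_iff₀ (Real.exp_pos _) (by positivity)]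
  linarith

/-- With `u` the distance from the drift in units of `√t`, the semigroup gains a factor `u ^
(-3/2)`. Any power beyond `-1` makes the bound integrable in `t`. For `u ≤ 1` the uniform bound is
enough. -/
lemma exists_norm_heat_le_rpow (d : ℕ) {M K ζ c' : ℝ} (hM : 0 < M) (hK : 0 < K) (hζ : 0 < ζ)
    (hc' : 0 < c') :
    ∃ C : ℝ, 0 < C ∧ ∀ (c : ℝ) (A : Lat d → ℝ), CritKernel M K ζ c A → ∀ (t T : ℝ) (z : Lat d),
      1 ≤ t → 0 < |t - T| → c' * |t - T| ≤ ‖toVec z - t • firstMoment A‖ →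
      ‖heat t A z‖ ≤ C * t ^ (-(d : ℝ) / 2) * (t ^ (3 / 4 : ℝ) * |t - T| ^ (-(3 / 2) : ℝ)) := by
  obtain ⟨C₁, hC₁, h₁⟩ := exists_norm_heat_le d hK
  obtain ⟨C₂, hC₂, h₂⟩ := exists_norm_heat_le_far d hM hK hζ
  refine ⟨(C₁ + 721 * C₂) * c' ^ (-(3 / 2) : ℝ), by positivity, fun c A h t T z ht hs hz => ?_⟩
  have ht0 : 0 < t := by linarith
  have hG : (1 + t) ^ (-(d : ℝ) / 2) ≤ t ^ (-(d : ℝ) / 2) :=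
    Real.rpow_le_rpow_of_nonpos ht0 (by linarith)
      (by have : (0 : ℝ) ≤ d := Nat.cast_nonneg d; linarith)
  set G := t ^ (-(d : ℝ) / 2)
  have hG0 : 0 < G := Real.rpow_pos_of_pos ht0 _
  set u := c' * |t - T| / t ^ (1 / 2 : ℝ) with hu
  have hu0 : 0 < u := by positivity
  have hu32 : u ^ (-(3 / 2) : ℝ) =
      c' ^ (-(3 / 2) : ℝ) * (t ^ (3 / 4 : ℝ) * |t - T| ^ (-(3 / 2) : ℝ)) := by
    rw [hu, Real.div_rpow (by positivity) (by positivity), Real.mul_rpow hc'.le hs.le,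
      ← Real.rpow_mul ht0.le, div_eq_mul_inv, ← Real.rpow_neg ht0.le]
    norm_num; ring
  suffices hmain : ‖heat t A z‖ ≤ (C₁ + 721 * C₂) * G * u ^ (-(3 / 2) : ℝ) by
    rw [hu32] at hmain
    refine hmain.trans_eq (by ring)
  rcases le_total u 1 with hle | hge
  · have h3 : 1 ≤ u ^ (-(3 / 2) : ℝ) := Real.one_le_rpow_of_pos_of_le_one_of_nonpos hu0 hle (by norm_num)
    calc ‖heat t A z‖ ≤ C₁ * (1 + t) ^ (-(d : ℝ) / 2) := h₁ M ζ c A h t z ht0.le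
      _ ≤ (C₁ + 721 * C₂) * G * 1 := by
          rw [mul_one]
          exact mul_le_mul (by linarith) hG (by positivity) (by positivity)
      _ ≤ _ := by gcongr
  -- This choice makes `t * a ^ 2` equal to `u ^ (-3/2)` while the Chernoff exponent is still at
  -- least `u ^ (1/4)`; the surplus exponent `ζ` is not needed here.
  · set a := u ^ (-(3 / 4) : ℝ) * t ^ (-(1 / 2) : ℝ) with ha
    have ha0 : 0 < a := by positivity
    have hta : t * a ^ 2 = u ^ (-(3 / 2) : ℝ) := by
      rw [ha, mul_pow, ← Real.rpow_natCast (u ^ _), ← Real.rpow_natCast (t ^ _), ← Real.rpow_mul hu0.le,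
        ← Real.rpow_mul ht0.le]
      norm_num
      rw [Real.rpow_neg ht0.le, Real.rpow_one]
      field_simp
    have h4 : u ^ (-(3 / 2) : ℝ) ≤ 1 := Real.rpow_le_one_of_one_le_of_nonpos hge (by norm_num)
    have ha1 : a ≤ 1 := by
      have h5 := Real.rpow_le_one_of_one_le_of_nonpos hge (z := -(3 / 4)) (by norm_num)
      have h6 := Real.rpow_le_one_of_one_le_of_nonpos ht (z := -(1 / 2)) (by norm_num)
      exact mul_le_one₀ h5 (by positivity) h6
    have h7 : a ^ (2 + ζ) ≤ a ^ 2 := by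
      rw [← Real.rpow_two]
      exact Real.rpow_le_rpow_of_exponent_ge ha0 ha1 (by linarith)
    have h8 : u ^ (1 / 4 : ℝ) ≤ a * ‖toVec z - t • firstMoment A‖ := by
      calc u ^ (1 / 4 : ℝ) = a * (u * t ^ (1 / 2 : ℝ)) := by
            have e1 : u ^ (1 / 4 : ℝ) = u ^ (-(3 / 4) : ℝ) * u := by
              nth_rw 3 [← Real.rpow_one u]
              rw [← Real.rpow_add hu0]; norm_num
            have e2 : t ^ (-(1 / 2) : ℝ) * t ^ (1 / 2 : ℝ) = 1 := by
              rw [← Real.rpow_add ht0]; norm_num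
            rw [e1, ha]
            linear_combination (-(u ^ (-(3 / 4) : ℝ) * u)) * e2
        _ = a * (c' * |t - T|) := by rw [hu]; field_simp
        _ ≤ _ := by gcongr
    have h9 : Real.exp (-(a * ‖toVec z - t • firstMoment A‖)) ≤ 720 * u ^ (-(3 / 2) : ℝ) :=
      (Real.exp_le_exp.mpr (neg_le_neg h8)).trans (exp_neg_rpow_le hu0)
    have h10 : t * a ^ (2 + ζ) ≤ u ^ (-(3 / 2) : ℝ) := by
      rw [← hta]; gcongr
    have hU : 0 < u ^ (-(3 / 2) : ℝ) := by positivity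
    calc ‖heat t A z‖ ≤ C₂ * (1 + t) ^ (-(d : ℝ) / 2) *
          (Real.exp (-(a * ‖toVec z - t • firstMoment A‖)) + t * a ^ (2 + ζ)) :=
          h₂ c A h a t z ha0 ht0.le (hta.le.trans h4)
      _ ≤ C₂ * G * (720 * u ^ (-(3 / 2) : ℝ) + u ^ (-(3 / 2) : ℝ)) := by gcongr
      _ = 721 * C₂ * G * u ^ (-(3 / 2) : ℝ) := by ring
      _ ≤ _ := by gcongr; linarith

/-- Contribution of the times `t ≥ T / 2` away from `T`. -/
lemma exists_tail_le (d : ℕ) [NeZero d] {M K ζ c' : ℝ} (hM : 0 < M) (hK : 0 < K) (hζ : 0 < ζ)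
    (hc' : 0 < c') :
    ∃ C : ℝ, 0 < C ∧ ∀ (c : ℝ) (A : Lat d → ℝ), CritKernel M K ζ c A → ∀ (T b : ℝ) (z : Lat d)
      (D : Set ℝ), 2 ≤ T → 0 < b → MeasurableSet D → (∀ t ∈ D, T / 2 ≤ t ∧ b < |t - T| ∧
        c' * |t - T| ≤ ‖toVec z - t • firstMoment A‖) →
      IntegrableOn (fun t => heat t A z) D ∧ ∫ t in D, ‖heat t A z‖ ≤
        C * T ^ (-((d : ℝ) - 1) / 2) * (T ^ (1 / 4 : ℝ) * b ^ (-(1 / 2) : ℝ) + b ^ (-(1 / 4) : ℝ)) := by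
  obtain ⟨C, hC, h₁⟩ := exists_norm_heat_le_rpow d hM hK hζ hc'
  have hd1 : (1 : ℝ) ≤ d := by exact_mod_cast Nat.one_le_iff_ne_zero.mpr (NeZero.ne d)
  set B : ℝ := (1 / 2 : ℝ) ^ (-((d : ℝ) - 1) / 2) with hB
  have hB0 : 0 < B := by positivity
  refine ⟨C * B * 8, by positivity, fun c A h T b z D hT hb hD hDt => ?_⟩
  have hT0 : 0 < T := by linarith
  set E := {t : ℝ | b < |t - T|} with hE
  obtain ⟨i1, e1⟩ := integrableOn_abs_rpow_neg (p := 3 / 2) (by norm_num) hb T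
  obtain ⟨i2, e2⟩ := integrableOn_abs_rpow_neg (p := 5 / 4) (by norm_num) hb T
  set P := T ^ (-((d : ℝ) - 1) / 2)
  have hP0 : 0 < P := by positivity
  have hDE : D ⊆ E := fun t ht => (hDt t ht).2.1
  have hpt : ∀ t ∈ D, ‖heat t A z‖ ≤ C * B * P *
      (T ^ (1 / 4 : ℝ) * |t - T| ^ (-(3 / 2) : ℝ) + |t - T| ^ (-(5 / 4) : ℝ)) := by
    intro t ht
    obtain ⟨q1, q2, q3⟩ := hDt t ht
    have hs : 0 < |t - T| := hb.trans q2
    have ht1 : 1 ≤ t := by linarith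
    have ht0 : 0 < t := by linarith
    refine (h₁ c A h t T z ht1 hs q3).trans ?_
    -- The first factor on the right is nonincreasing and is bounded by its value at `T / 2`. The
    -- growing factor `t ^ (1/4)` is split by subadditivity, leaving the integrable powers `-3/2`
    -- and `-5/4` of `|t - T|`.
    have f1 : t ^ (-(d : ℝ) / 2) * t ^ (3 / 4 : ℝ) = t ^ (-((d : ℝ) - 1) / 2) * t ^ (1 / 4 : ℝ) := by
      rw [← Real.rpow_add ht0, ← Real.rpow_add ht0]; congr 1; ring
    have f2 : t ^ (-((d : ℝ) - 1) / 2) ≤ B * P := by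
      rw [hB, ← Real.mul_rpow (by norm_num) hT0.le]
      exact Real.rpow_le_rpow_of_nonpos (by positivity) (by linarith) (by linarith)
    have f3 : t ^ (1 / 4 : ℝ) ≤ T ^ (1 / 4 : ℝ) + |t - T| ^ (1 / 4 : ℝ) := by
      refine le_trans ?_ (Real.rpow_add_le_add_rpow hT0.le hs.le (by norm_num) (by norm_num))
      exact Real.rpow_le_rpow ht0.le (by linarith [le_abs_self (t - T)]) (by norm_num)
    have f4 : |t - T| ^ (1 / 4 : ℝ) * |t - T| ^ (-(3 / 2) : ℝ) = |t - T| ^ (-(5 / 4) : ℝ) := by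
      rw [← Real.rpow_add hs]; norm_num
    calc C * t ^ (-(d : ℝ) / 2) * (t ^ (3 / 4 : ℝ) * |t - T| ^ (-(3 / 2) : ℝ))
        = C * (t ^ (-((d : ℝ) - 1) / 2) * t ^ (1 / 4 : ℝ)) * |t - T| ^ (-(3 / 2) : ℝ) := by
          rw [← f1]; ring
      _ ≤ C * (B * P * (T ^ (1 / 4 : ℝ) + |t - T| ^ (1 / 4 : ℝ))) * |t - T| ^ (-(3 / 2) : ℝ) := by
          gcongr
      _ = _ := by rw [← f4]; ring
  have hmaj : IntegrableOn (fun t => C * B * P *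
      (T ^ (1 / 4 : ℝ) * |t - T| ^ (-(3 / 2) : ℝ) + |t - T| ^ (-(5 / 4) : ℝ))) E :=
    ((i1.const_mul _).add i2).const_mul _
  have hcont := continuous_heat h.summable z
  have hint : IntegrableOn (fun t => heat t A z) D := by
    refine Integrable.mono' (hmaj.mono_set hDE) hcont.aestronglyMeasurable ?_
    exact (ae_restrict_iff' hD).mpr (.of_forall hpt)
  refine ⟨hint, ?_⟩
  calc ∫ t in D, ‖heat t A z‖ ≤ ∫ t in D, C * B * P *
      (T ^ (1 / 4 : ℝ) * |t - T| ^ (-(3 / 2) : ℝ) + |t - T| ^ (-(5 / 4) : ℝ)) :=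
        setIntegral_mono_on hint.norm (hmaj.mono_set hDE) hD hpt
    _ ≤ ∫ t in E, C * B * P *
      (T ^ (1 / 4 : ℝ) * |t - T| ^ (-(3 / 2) : ℝ) + |t - T| ^ (-(5 / 4) : ℝ)) :=
        setIntegral_mono_set hmaj (.of_forall fun t => by simp only [Pi.zero_apply]; positivity)
          (.of_forall hDE)
    _ = C * B * P * (T ^ (1 / 4 : ℝ) * (2 * (b ^ (1 - 3 / 2 : ℝ) / (3 / 2 - 1))) +
          2 * (b ^ (1 - 5 / 4 : ℝ) / (5 / 4 - 1))) := by
        rw [integral_const_mul, integral_add (i1.const_mul _) i2, integral_const_mul, e1, e2]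
    _ = C * B * P * (4 * (T ^ (1 / 4 : ℝ) * b ^ (-(1 / 2) : ℝ)) + 8 * b ^ (-(1 / 4) : ℝ)) := by
        norm_num; left; ring
    _ ≤ C * B * P * (8 * (T ^ (1 / 4 : ℝ) * b ^ (-(1 / 2) : ℝ)) + 8 * b ^ (-(1 / 4) : ℝ)) := by
        gcongr; norm_num
    _ = _ := by ring

lemma tendsto_rpow_mul_exp_neg_rpow {q b : ℝ} (hq : 0 < q) (hb : 0 < b) (p : ℝ) :
    Tendsto (fun T : ℝ => T ^ p * Real.exp (-(b * T ^ q))) atTop (𝓝 0) := by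
  have h := (tendsto_rpow_mul_exp_neg_mul_atTop_nhds_zero (p / q) b hb).comp (tendsto_rpow_atTop hq)
  refine h.congr' ?_
  filter_upwards [eventually_gt_atTop 0] with T hT
  simp only [Function.comp, ← Real.rpow_mul hT.le]
  rw [mul_div_cancel₀ _ hq.ne', neg_mul]

lemma setIntegral_Ioc_le_of_le {F : ℝ → ℝ} (hF : Continuous F) {a b B : ℝ} (hab : a ≤ b)
    (h : ∀ t, a ≤ t → t ≤ b → F t ≤ B) : ∫ t in Set.Ioc a b, F t ≤ B * (b - a) := by
  have hc : IntegrableOn F (Set.Ioc a b) :=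
    (hF.continuousOn.integrableOn_compact isCompact_Icc).mono_set Set.Ioc_subset_Icc_self
  have := setIntegral_mono_on hc (integrableOn_const (μ := volume) (C := B) (by simp))
    measurableSet_Ioc fun t ht => h t ht.1.le ht.2
  rwa [setIntegral_const, smul_eq_mul, Real.volume_real_Ioc_of_le hab, mul_comm] at this

/-- At these times `z` is at distance of order `T` from the drift, so truncation at a radius
slightly below `T` makes the Chernoff factor negligible. What matters is the far part. For `d ≤ 5`
the `ℓ¹` moment of order `2 + ζ` beats `T^(-(d-1)/2)`. In higher dimension small times contribute no
further decay to that bound, and the `ℓ²` moment of order `d - 1` is used instead. -/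
lemma exists_small_time_aux (d : ℕ) [NeZero d] {M K ζ c' : ℝ} (hM : 0 < M) (hK : 0 < K)
    (hζ : 0 < ζ) (hζ1 : ζ ≤ 1) :
    ∃ C β : ℝ, 0 < C ∧ 0 < β ∧ ∀ (c : ℝ) (A : Lat d → ℝ), CritKernel M K ζ c A → ∀ (T : ℝ) (z : Lat d),
      1 ≤ T → (∀ t, 0 ≤ t → t ≤ T / 2 → c' * T ≤ ‖toVec z - t • firstMoment A‖) →
      ∫ t in Set.Ioc 0 (T / 2), ‖heat t A z‖ ≤
        C * (T * Real.exp (-(c' * T ^ (ζ / 20))) + T ^ (-((d : ℝ) - 1) / 2 - β)) := by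
  have hd1 : (1 : ℝ) ≤ d := by exact_mod_cast Nat.one_le_iff_ne_zero.mpr (NeZero.ne d)
  -- Truncation is at radius `T ^ α`. The loss `ζ / 20` leaves a Chernoff exponent of order `T ^ (ζ
  -- / 20)` and is small enough that both values of `β` below stay positive for `ζ ≤ 1`.
  set α : ℝ := 1 - ζ / 20 with hα
  -- facts common to the two cases
  have hscale : ∀ T t : ℝ, 1 ≤ T → t ≤ T / 2 → t * (T ^ (-α)) ^ 2 ≤ 1 := by
    intro T t hT ht
    have hT0 : 0 < T := by linarith
    rw [← Real.rpow_natCast, ← Real.rpow_mul hT0.le]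
    have h1 : T ^ (-α * ((2 : ℕ) : ℝ)) ≤ T ^ (-1 : ℝ) :=
      Real.rpow_le_rpow_of_exponent_le hT (by push_cast; linarith)
    rw [Real.rpow_neg_one] at h1
    have h2 : 0 < T ^ (-α * ((2 : ℕ) : ℝ)) := by positivity
    calc t * T ^ (-α * ((2 : ℕ) : ℝ)) ≤ T * T⁻¹ := by
          refine mul_le_mul (by linarith) h1 h2.le hT0.le
      _ = 1 := mul_inv_cancel₀ hT0.ne'
  have hexp : ∀ (T r : ℝ), 1 ≤ T → c' * T ≤ r →
      Real.exp (-(T ^ (-α) * r)) ≤ Real.exp (-(c' * T ^ (ζ / 20))) := by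
    intro T r hT hr
    have hT0 : 0 < T := by linarith
    apply Real.exp_le_exp.mpr
    have e : T ^ (ζ / 20) = T ^ (-α) * T := by
      nth_rw 3 [← Real.rpow_one T]
      rw [← Real.rpow_add hT0]; congr 1; rw [hα]; ring
    have := mul_le_mul_of_nonneg_left hr (show 0 ≤ T ^ (-α) by positivity)
    rw [e]; linarith
  rcases Nat.lt_or_ge d 6 with hd | hd
  · obtain ⟨C, hC, h₁⟩ := exists_norm_heat_le_far d hM hK hζ
    have hd5 : (d : ℝ) ≤ 5 := by exact_mod_cast Nat.lt_succ_iff.mp hd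
    -- Centring at `-1` turns `|t - (-1)|` into `1 + t` for positive times, so the tail integral
    -- also serves here.
    obtain ⟨i1, e1⟩ := integrableOn_abs_rpow_neg (p := 3 / 2) (b := 1) (by norm_num) one_pos (-1)
    set B : ℝ := (2 : ℝ) ^ ((5 - (d : ℝ)) / 2) with hB
    have hB0 : 0 < B := by positivity
    refine ⟨C * (1 + 4 * B), α * (2 + ζ) - 2, by positivity, by rw [hα]; nlinarith,
      fun c A h T z hT hz => ?_⟩
    have hT0 : 0 < T := by linarith
    have hcont := (continuous_heat h.summable z).norm
    set X := Real.exp (-(c' * T ^ (ζ / 20)))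
    have hX : 0 < X := Real.exp_pos _
    set W := T ^ ((5 - (d : ℝ)) / 2) * T ^ (-α * (2 + ζ)) with hW
    have hW0 : 0 < W := by positivity
    have hpt : ∀ t ∈ Set.Ioc 0 (T / 2), ‖heat t A z‖ ≤
        C * X + C * B * W * |t - (-1)| ^ (-(3 / 2) : ℝ) := by
      intro t ⟨ht0, ht⟩
      have hb := h₁ c A h (T ^ (-α)) t z (by positivity) ht0.le (hscale T t hT ht)
      have hE := hexp T _ hT (hz t ht0.le ht)
      rw [← Real.rpow_mul hT0.le] at hb
      have h2 : (1 + t) ^ (-(d : ℝ) / 2) ≤ 1 :=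
        Real.rpow_le_one_of_one_le_of_nonpos (by linarith) (by linarith)
      have h3 : (1 + t) ^ (-(d : ℝ) / 2) * t ≤ B * T ^ ((5 - (d : ℝ)) / 2) * (1 + t) ^ (-(3 / 2) : ℝ) := by
        calc (1 + t) ^ (-(d : ℝ) / 2) * t ≤ (1 + t) ^ (-(d : ℝ) / 2) * (1 + t) ^ (1 : ℝ) := by
              rw [Real.rpow_one]; gcongr; linarith
          _ = (1 + t) ^ ((5 - (d : ℝ)) / 2) * (1 + t) ^ (-(3 / 2) : ℝ) := by
              rw [← Real.rpow_add (by linarith), ← Real.rpow_add (by linarith)]; congr 1; ring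
          _ ≤ (2 * T) ^ ((5 - (d : ℝ)) / 2) * (1 + t) ^ (-(3 / 2) : ℝ) := by
              gcongr; linarith
          _ = _ := by rw [Real.mul_rpow (by norm_num) hT0.le]
      have h4 : |t - (-1)| = 1 + t := by rw [abs_of_pos (by linarith)]; ring
      rw [h4]
      calc ‖heat t A z‖ ≤ _ := hb
        _ ≤ C * ((1 + t) ^ (-(d : ℝ) / 2) * X) +
            C * ((1 + t) ^ (-(d : ℝ) / 2) * t * T ^ (-α * (2 + ζ))) := by
          rw [mul_assoc C, mul_add, mul_add, mul_assoc _ t]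
          gcongr
        _ ≤ C * (1 * X) + C * (B * T ^ ((5 - (d : ℝ)) / 2) * (1 + t) ^ (-(3 / 2) : ℝ) *
            T ^ (-α * (2 + ζ))) := by gcongr
        _ = _ := by rw [hW]; ring
    have hsub : Set.Ioc 0 (T / 2) ⊆ {t : ℝ | 1 < |t - (-1)|} := by
      intro t ht
      have := ht.1
      change 1 < |t - (-1)|
      rw [abs_of_pos (by linarith)]; linarith
    have i2 : IntegrableOn (fun t : ℝ => |t - (-1)| ^ (-(3 / 2) : ℝ)) (Set.Ioc 0 (T / 2)) :=
      i1.mono_set hsub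
    have hI : ∫ t in Set.Ioc 0 (T / 2), |t - (-1)| ^ (-(3 / 2) : ℝ) ≤ 4 := by
      refine (setIntegral_mono_set i1 (.of_forall fun t => by simp only [Pi.zero_apply]; positivity)
        (.of_forall hsub)).trans ?_
      rw [e1]; norm_num
    have hWexp : W = T ^ (-((d : ℝ) - 1) / 2 - (α * (2 + ζ) - 2)) := by
      rw [hW, ← Real.rpow_add hT0]; congr 1; ring
    rw [← hWexp]
    have hconst : IntegrableOn (fun _ : ℝ => C * X) (Set.Ioc 0 (T / 2)) :=
      integrableOn_const (by simp)
    calc ∫ t in Set.Ioc 0 (T / 2), ‖heat t A z‖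
        ≤ ∫ t in Set.Ioc 0 (T / 2), (C * X + C * B * W * |t - (-1)| ^ (-(3 / 2) : ℝ)) := by
          refine setIntegral_mono_on ?_ (hconst.add (i2.const_mul _)) measurableSet_Ioc hpt
          exact (hcont.continuousOn.integrableOn_compact isCompact_Icc).mono_set Set.Ioc_subset_Icc_self
      _ = C * X * (T / 2) + C * B * W * ∫ t in Set.Ioc 0 (T / 2), |t - (-1)| ^ (-(3 / 2) : ℝ) := by
          rw [integral_add hconst (i2.const_mul _), setIntegral_const, integral_const_mul, smul_eq_mul,
            Real.volume_real_Ioc_of_le (by linarith), mul_comm (T / 2 - 0), sub_zero]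
      _ ≤ C * X * T + C * B * W * 4 := by gcongr; linarith
      _ = C * (T * X + 4 * B * W) := by ring
      _ ≤ C * ((T * X + 4 * B * W) + (4 * B * (T * X) + W)) :=
          mul_le_mul_of_nonneg_left (le_add_of_nonneg_right (by positivity)) hC.le
      _ = _ := by ring
  · obtain ⟨C, hC, h₁⟩ := exists_norm_heat_le_far_sq d hd hM hK hζ
    have hd6 : (6 : ℝ) ≤ d := by exact_mod_cast hd
    refine ⟨C, (α - 1 / 2) * (d - 1) - 2, hC, by rw [hα]; nlinarith, fun c A h T z hT hz => ?_⟩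
    have hT0 : 0 < T := by linarith
    have hcont := (continuous_heat h.summable z).norm
    set X := Real.exp (-(c' * T ^ (ζ / 20)))
    have hX : 0 < X := Real.exp_pos _
    have hpow : (T ^ (-α)) ^ (d - 1) = T ^ (-α * ((d : ℝ) - 1)) := by
      rw [← Real.rpow_natCast, ← Real.rpow_mul hT0.le, Nat.cast_sub (by omega), Nat.cast_one]
    have hW : T ^ (-((d : ℝ) - 1) / 2 - ((α - 1 / 2) * (d - 1) - 2)) = T * T * T ^ (-α * ((d : ℝ) - 1)) := by
      nth_rw 2 3 [← Real.rpow_one T]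
      rw [← Real.rpow_add hT0, ← Real.rpow_add hT0]; congr 1; ring
    have hpt : ∀ t, 0 ≤ t → t ≤ T / 2 → ‖heat t A z‖ ≤ C * (X + T * T ^ (-α * ((d : ℝ) - 1))) := by
      intro t ht0 ht
      have hb := h₁ c A h (T ^ (-α)) t z (by positivity) ht0 (hscale T t hT ht)
      have hE := hexp T _ hT (hz t ht0 ht)
      rw [hpow] at hb
      have h2 : (1 + t) ^ (-(d : ℝ) / 2) ≤ 1 :=
        Real.rpow_le_one_of_one_le_of_nonpos (by linarith) (by linarith)
      calc ‖heat t A z‖ ≤ _ := hb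
        _ ≤ C * (1 * X + T * T ^ (-α * ((d : ℝ) - 1))) := by gcongr; linarith
        _ = _ := by rw [one_mul]
    refine (setIntegral_Ioc_le_of_le hcont (by linarith) hpt).trans ?_
    rw [hW]
    have hV : 0 < T ^ (-α * ((d : ℝ) - 1)) := by positivity
    calc C * (X + T * T ^ (-α * ((d : ℝ) - 1))) * (T / 2 - 0)
        ≤ C * (X + T * T ^ (-α * ((d : ℝ) - 1))) * T := by gcongr; linarith
      _ = _ := by ring

/-- Contribution of the times `t ≤ T / 2`. -/
lemma exists_small_time_le (d : ℕ) [NeZero d] {M K ζ c' : ℝ} (hM : 0 < M) (hK : 0 < K)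
    (hζ : 0 < ζ) (hζ1 : ζ ≤ 1) (hc' : 0 < c') {ε : ℝ} (hε : 0 < ε) :
    ∃ T₀ : ℝ, 1 ≤ T₀ ∧ ∀ (c : ℝ) (A : Lat d → ℝ), CritKernel M K ζ c A → ∀ (T : ℝ) (z : Lat d),
      T₀ ≤ T → (∀ t, 0 ≤ t → t ≤ T / 2 → c' * T ≤ ‖toVec z - t • firstMoment A‖) →
      ∫ t in Set.Ioc 0 (T / 2), ‖heat t A z‖ ≤ ε * T ^ (-((d : ℝ) - 1) / 2) := by
  obtain ⟨C, β, hC, hβ, h₁⟩ := exists_small_time_aux d (c' := c') hM hK hζ hζ1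
  have hlim : Tendsto (fun T : ℝ => C * (T ^ (((d : ℝ) - 1) / 2 + 1) * Real.exp (-(c' * T ^ (ζ / 20))) +
      T ^ (-β))) atTop (𝓝 (C * (0 + 0))) :=
    ((tendsto_rpow_mul_exp_neg_rpow (by positivity) hc' _).add (tendsto_rpow_neg_atTop hβ)).const_mul C
  rw [add_zero, mul_zero] at hlim
  obtain ⟨T₁, hT₁⟩ := eventually_atTop.mp (hlim.eventually (gt_mem_nhds hε))
  refine ⟨max 1 T₁, le_max_left _ _, fun c A h T z hT hz => ?_⟩
  have hT1 : 1 ≤ T := (le_max_left _ _).trans hT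
  have hT0 : 0 < T := by linarith
  refine (h₁ c A h T z hT1 hz).trans ?_
  have h2 := hT₁ T ((le_max_right _ _).trans hT)
  have h3 : 0 < T ^ (-((d : ℝ) - 1) / 2) := by positivity
  have e1 : T = T ^ (-((d : ℝ) - 1) / 2) * T ^ (((d : ℝ) - 1) / 2 + 1) := by
    rw [← Real.rpow_add hT0]
    nth_rw 1 [← Real.rpow_one T]
    congr 1; ring
  have e2 : T ^ (-((d : ℝ) - 1) / 2 - β) = T ^ (-((d : ℝ) - 1) / 2) * T ^ (-β) := by
    rw [← Real.rpow_add hT0]; congr 1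
  calc C * (T * Real.exp (-(c' * T ^ (ζ / 20))) + T ^ (-((d : ℝ) - 1) / 2 - β))
      = T ^ (-((d : ℝ) - 1) / 2) * (C * (T ^ (((d : ℝ) - 1) / 2 + 1) *
          Real.exp (-(c' * T ^ (ζ / 20))) + T ^ (-β))) := by
        rw [e2]; nth_rw 1 [e1]; ring
    _ ≤ T ^ (-((d : ℝ) - 1) / 2) * ε := by gcongr
    _ = _ := mul_comm _ _

/-- Up to a small error, the Green function is the integral of the semigroup over a window of
width `ℓ √T` around `T`. -/
lemma exists_green_sub_window_le (d : ℕ) [NeZero d] {M K ζ c' : ℝ} (hM : 0 < M) (hK : 0 < K)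
    (hζ : 0 < ζ) (hζ1 : ζ ≤ 1) (hc' : 0 < c') {ε : ℝ} (hε : 0 < ε) :
    ∃ ℓ₀ : ℝ, 1 ≤ ℓ₀ ∧ ∀ ℓ : ℝ, ℓ₀ ≤ ℓ → ∃ T₀ : ℝ, 1 ≤ T₀ ∧ ∀ (c : ℝ) (A : Lat d → ℝ),
      CritKernel M K ζ c A → ∀ (T : ℝ) (z : Lat d), T₀ ≤ T →
      (∀ t, 0 ≤ t → ℓ * √T < |t - T| → c' * |t - T| ≤ ‖toVec z - t • firstMoment A‖) →
      ℓ * √T ≤ T / 2 ∧ ‖green A z - ∫ t in Set.Icc (T - ℓ * √T) (T + ℓ * √T), heat t A z‖ ≤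
        ε * T ^ (-((d : ℝ) - 1) / 2) := by
  obtain ⟨C, hC, hCt⟩ := exists_tail_le d hM hK hζ hc'
  obtain ⟨T₁, hT₁, hS⟩ := exists_small_time_le d hM hK hζ hζ1 (half_pos hc') (half_pos hε)
  -- The tail beyond the window is at most `2 * C * ℓ ^ (-1/4)` relative to the main scale, and the
  -- fourth power makes this at most `ε / 2`.
  refine ⟨max 1 ((4 * C / ε) ^ 4), le_max_left _ _, fun ℓ hℓ => ?_⟩
  have hℓ1 : 1 ≤ ℓ := (le_max_left _ _).trans hℓ
  have hℓ0 : 0 < ℓ := by linarith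
  -- The bound `16 * ℓ ^ 2 ≤ T` makes the half-width of the window at most `T / 4`, so it is
  -- disjoint from the times up to `T / 2`.
  refine ⟨max T₁ (max 2 (16 * ℓ ^ 2)), hT₁.trans (le_max_left _ _), fun c A h T z hT hz => ?_⟩
  have hTT₁ : T₁ ≤ T := (le_max_left _ _).trans hT
  have hT2 : 2 ≤ T := ((le_max_left _ _).trans (le_max_right _ _)).trans hT
  have hTℓ : 16 * ℓ ^ 2 ≤ T := ((le_max_right _ _).trans (le_max_right _ _)).trans hT
  have hT0 : 0 < T := by linarith
  set b := ℓ * √T with hb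
  have hsq : 0 < √T := Real.sqrt_pos.mpr hT0
  have hb0 : 0 < b := by positivity
  have hbT : b ≤ T / 4 := by
    have h1 : 4 * ℓ ≤ √T := Real.le_sqrt_of_sq_le (by linarith)
    have h2 : √T * √T = T := Real.mul_self_sqrt hT0.le
    nlinarith
  refine ⟨by linarith, ?_⟩
  set W := Set.Icc (T - b) (T + b)
  set D := Set.Ioi (T / 2) \ W with hD
  have hDm : MeasurableSet D := measurableSet_Ioi.diff measurableSet_Icc
  have hcont := continuous_heat h.summable z
  have hiW : IntegrableOn (fun t => heat t A z) W := hcont.continuousOn.integrableOn_compact isCompact_Icc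
  have hiS : IntegrableOn (fun t => heat t A z) (Set.Ioc 0 (T / 2)) :=
    (hcont.continuousOn.integrableOn_compact isCompact_Icc).mono_set Set.Ioc_subset_Icc_self
  obtain ⟨hiD, hDle⟩ := hCt c A h T b z D hT2 hb0 hDm (by
    intro t ht
    have h1 : T / 2 < t := ht.1
    have h2 : b < |t - T| := by
      by_contra hcon
      have := abs_le.mp (not_lt.mp hcon)
      exact ht.2 ⟨by linarith [this.1], by linarith [this.2]⟩
    exact ⟨h1.le, h2, hz t (by linarith) h2⟩)
  have hSle := hS c A h T z hTT₁ (by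
    intro t ht0 ht
    have h1 : |t - T| = T - t := by rw [abs_sub_comm, abs_of_nonneg (by linarith)]
    refine le_trans ?_ (hz t ht0 (by rw [h1]; linarith))
    rw [h1]; nlinarith)
  have hWD : W ∪ D = Set.Ioi (T / 2) := by
    rw [hD, Set.union_sdiff_self]
    exact Set.union_eq_right.mpr fun t ht => by
      have h1 : T - b ≤ t := ht.1
      change T / 2 < t
      linarith
  have hsplit : green A z = (∫ t in Set.Ioc 0 (T / 2), heat t A z) +
      ((∫ t in W, heat t A z) + ∫ t in D, heat t A z) := by
    rw [← setIntegral_union (Set.disjoint_sdiff_right) hDm hiW hiD, hWD,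
      ← setIntegral_union (Set.Ioc_disjoint_Ioi le_rfl) measurableSet_Ioi hiS
        (by rw [← hWD]; exact hiW.union hiD), Set.Ioc_union_Ioi_eq_Ioi (by linarith), green]
  have htail : T ^ (1 / 4 : ℝ) * b ^ (-(1 / 2) : ℝ) + b ^ (-(1 / 4) : ℝ) ≤ 2 * ℓ ^ (-(1 / 4) : ℝ) := by
    have e1 : T ^ (1 / 4 : ℝ) * b ^ (-(1 / 2) : ℝ) = ℓ ^ (-(1 / 2) : ℝ) := by
      rw [hb, Real.mul_rpow hℓ0.le hsq.le, Real.sqrt_eq_rpow, ← Real.rpow_mul hT0.le, mul_left_comm,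
        ← Real.rpow_add hT0]
      norm_num
    have e2 : ℓ ^ (-(1 / 2) : ℝ) ≤ ℓ ^ (-(1 / 4) : ℝ) :=
      Real.rpow_le_rpow_of_exponent_le hℓ1 (by norm_num)
    have e3 : b ^ (-(1 / 4) : ℝ) ≤ ℓ ^ (-(1 / 4) : ℝ) := by
      refine Real.rpow_le_rpow_of_nonpos hℓ0 ?_ (by norm_num)
      have : 1 ≤ √T := Real.one_le_sqrt.mpr (by linarith)
      rw [hb]; nlinarith
    rw [e1]; linarith
  have hℓe : C * (2 * ℓ ^ (-(1 / 4) : ℝ)) ≤ ε / 2 := by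
    have e1 : (4 * C / ε) ≤ ℓ ^ (1 / 4 : ℝ) := by
      have := Real.rpow_le_rpow (by positivity) ((le_max_right _ _).trans hℓ) (show (0 : ℝ) ≤ 1 / 4 by norm_num)
      rw [← Real.rpow_natCast, ← Real.rpow_mul (by positivity)] at this
      norm_num at this
      exact this
    have e2 : ℓ ^ (-(1 / 4) : ℝ) = (ℓ ^ (1 / 4 : ℝ))⁻¹ := Real.rpow_neg hℓ0.le _
    rw [e2]
    have e3 : 0 < ℓ ^ (1 / 4 : ℝ) := by positivity
    rw [div_le_iff₀ hε] at e1
    rw [← mul_assoc, ← div_eq_mul_inv, div_le_iff₀ e3]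
    linarith
  set P := T ^ (-((d : ℝ) - 1) / 2)
  have hP0 : 0 < P := by positivity
  have hfin : green A z - (∫ t in W, heat t A z) =
      (∫ t in Set.Ioc 0 (T / 2), heat t A z) + ∫ t in D, heat t A z := by rw [hsplit]; ring
  rw [hfin]
  calc ‖(∫ t in Set.Ioc 0 (T / 2), heat t A z) + ∫ t in D, heat t A z‖
      ≤ (∫ t in Set.Ioc 0 (T / 2), ‖heat t A z‖) + ∫ t in D, ‖heat t A z‖ :=
        (norm_add_le _ _).trans
          (add_le_add (norm_integral_le_integral_norm _) (norm_integral_le_integral_norm _))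
    _ ≤ ε / 2 * P + C * P * (2 * ℓ ^ (-(1 / 4) : ℝ)) := by
        refine add_le_add hSle (hDle.trans ?_)
        gcongr
    _ = ε / 2 * P + C * (2 * ℓ ^ (-(1 / 4) : ℝ)) * P := by ring
    _ ≤ ε / 2 * P + ε / 2 * P := by gcongr
    _ = ε * P := by ring

/-- The reverse triangle inequality compares lengths only, so every `z`, on or off the ray of the
drift, is separated from `t η` away from the time `‖z‖ / ‖η‖`. -/
lemma CritKernel.drift_dist {d : ℕ} {M K ζ c : ℝ} {A : Lat d → ℝ} (h : CritKernel M K ζ c A)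
    (hc : 0 < c) {t : ℝ} (ht : 0 ≤ t) (z : Lat d) :
    c * |t - ‖toVec z‖ / ‖firstMoment A‖| ≤ ‖toVec z - t • firstMoment A‖ := by
  have hη : 0 < ‖firstMoment A‖ := hc.trans_le h.drift_le
  have h1 := abs_norm_sub_norm_le (toVec z) (t • firstMoment A)
  rw [norm_smul, Real.norm_of_nonneg ht] at h1
  refine le_trans ?_ h1
  have e : ‖toVec z‖ - t * ‖firstMoment A‖ =
      -(‖firstMoment A‖ * (t - ‖toVec z‖ / ‖firstMoment A‖)) := by field_simp; ring
  rw [e, abs_neg, abs_mul, abs_of_pos hη]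
  exact mul_le_mul_of_nonneg_right h.drift_le (abs_nonneg _)

/-- Uniform upper bound on the Green function. -/
lemma exists_green_le (d : ℕ) [NeZero d] {M K ζ c : ℝ} (hM : 0 < M) (hK : 0 < K)
    (hζ : 0 < ζ) (hζ1 : ζ ≤ 1) (hc : 0 < c) :
    ∃ C : ℝ, 0 < C ∧ ∀ A : Lat d → ℝ, CritKernel M K ζ c A → ∀ z : Lat d,
      ‖green A z‖ ≤ C * (1 + ‖toVec z‖) ^ (-((d : ℝ) - 1) / 2) := by
  obtain ⟨ℓ, hℓ, hw⟩ := exists_green_sub_window_le d hM hK hζ hζ1 hc one_pos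
  obtain ⟨T₀, hT₀, hw⟩ := hw ℓ le_rfl
  obtain ⟨C₁, hC₁, hI⟩ := exists_norm_heat_le d hK
  obtain ⟨C₂, hC₂, hCt⟩ := exists_tail_le d hM hK hζ hc
  have hd1 : (1 : ℝ) ≤ d := by exact_mod_cast Nat.one_le_iff_ne_zero.mpr (NeZero.ne d)
  set T₁ := max T₀ 2 with hT₁
  have hT₁2 : 2 ≤ T₁ := le_max_right _ _
  have hT₁0 : 0 < T₁ := by linarith
  set p := -((d : ℝ) - 1) / 2 with hp
  have hp0 : p ≤ 0 := by rw [hp]; linarith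
  set N := C₁ * (2 * T₁) + C₂ * T₁ ^ p *
    (T₁ ^ (1 / 4 : ℝ) * (T₁ / 2) ^ (-(1 / 2) : ℝ) + (T₁ / 2) ^ (-(1 / 4) : ℝ)) with hN
  have hN0 : 0 < N := by positivity
  refine ⟨N / (1 + T₁ * M) ^ p + (1 + C₁ * (1 / 2 : ℝ) ^ (-(d : ℝ) / 2) * (2 * ℓ)) / (1 + M) ^ p,
    by positivity, fun A h z => ?_⟩
  have hη : 0 < ‖firstMoment A‖ := hc.trans_le h.drift_le
  have hηM := h.norm_drift_le hζ
  have hcont := continuous_heat h.summable z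
  set T := ‖toVec z‖ / ‖firstMoment A‖ with hT
  have hzT : ‖toVec z‖ = T * ‖firstMoment A‖ := by rw [hT]; field_simp
  have hTn : 0 ≤ T := by positivity
  set Z := (1 + ‖toVec z‖) ^ p with hZ
  have hZ0 : 0 < Z := by positivity
  rcases lt_or_ge T T₁ with hlt | hge
  · have hiS : IntegrableOn (fun t => heat t A z) (Set.Ioc 0 (2 * T₁)) :=
      (hcont.continuousOn.integrableOn_compact isCompact_Icc).mono_set Set.Ioc_subset_Icc_self
    -- For `z` near the origin the tail estimate is centred at `T₁` instead of `T`: since `T < T₁`,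
    -- the distance to the drift is also at least `c * (t - T₁)`. Earlier times use the uniform
    -- bound.
    obtain ⟨hiD, hDle⟩ := hCt c A h T₁ (T₁ / 2) z (Set.Ioi (2 * T₁)) hT₁2 (by linarith) measurableSet_Ioi (by
      intro t ht
      have ht' : 2 * T₁ < t := ht
      have e : |t - T₁| = t - T₁ := abs_of_pos (by linarith)
      refine ⟨by linarith, by rw [e]; linarith, le_trans ?_ (h.drift_dist hc (by linarith) z)⟩
      refine mul_le_mul_of_nonneg_left ?_ hc.le
      rw [e]
      exact (by linarith : t - T₁ ≤ t - T).trans (le_abs_self _))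
    have hle : ‖green A z‖ ≤ N := by
      rw [green, ← Set.Ioc_union_Ioi_eq_Ioi (show (0 : ℝ) ≤ 2 * T₁ by linarith),
        setIntegral_union (Set.Ioc_disjoint_Ioi le_rfl) measurableSet_Ioi hiS hiD]
      refine (norm_add_le _ _).trans (add_le_add ?_ ((norm_integral_le_integral_norm _).trans hDle))
      refine (norm_integral_le_integral_norm _).trans ?_
      refine (setIntegral_Ioc_le_of_le hcont.norm (B := C₁) (by linarith) fun t ht _ => ?_).trans_eq
        (by rw [sub_zero])
      refine (hI M ζ c A h t z ht).trans (mul_le_of_le_one_right hC₁.le ?_)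
      exact Real.rpow_le_one_of_one_le_of_nonpos (by linarith) (by linarith)
    have h2 : (1 + T₁ * M) ^ p ≤ Z := by
      refine Real.rpow_le_rpow_of_nonpos (by positivity) ?_ hp0
      rw [hzT]
      have := mul_le_mul hlt.le hηM hη.le hT₁0.le
      linarith
    calc ‖green A z‖ ≤ N / (1 + T₁ * M) ^ p * (1 + T₁ * M) ^ p := by
          rw [div_mul_cancel₀ _ (by positivity)]; exact hle
      _ ≤ N / (1 + T₁ * M) ^ p * Z := by gcongr
      _ ≤ _ := mul_le_mul_of_nonneg_right (le_add_of_nonneg_right (by positivity)) hZ0.le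
  · have hT2 : 2 ≤ T := hT₁2.trans hge
    have hT0 : 0 < T := by linarith
    obtain ⟨hb, hle⟩ := hw c A h T z ((le_max_left _ _).trans hge) (fun t ht _ => h.drift_dist hc ht z)
    set b := ℓ * √T with hbdef
    have hb0 : 0 ≤ b := by positivity
    have hW : ‖∫ t in Set.Icc (T - b) (T + b), heat t A z‖ ≤
        C₁ * (1 / 2 : ℝ) ^ (-(d : ℝ) / 2) * (2 * ℓ) * T ^ p := by
      rw [integral_Icc_eq_integral_Ioc]
      refine (norm_integral_le_integral_norm _).trans ?_
      refine (setIntegral_Ioc_le_of_le hcont.norm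
        (B := C₁ * ((1 / 2 : ℝ) ^ (-(d : ℝ) / 2) * T ^ (-(d : ℝ) / 2))) (by linarith) fun t ht _ => ?_).trans_eq ?_
      · refine (hI M ζ c A h t z (by linarith)).trans ?_
        gcongr
        rw [← Real.mul_rpow (by norm_num) hT0.le]
        exact Real.rpow_le_rpow_of_nonpos (by positivity) (by linarith) (by linarith)
      · have e : T ^ (-(d : ℝ) / 2) * √T = T ^ p := by
          rw [Real.sqrt_eq_rpow, ← Real.rpow_add hT0, hp]; congr 1; ring
        rw [← e, hbdef]; ring
    have h2 : T ^ p ≤ Z / (1 + M) ^ p := by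
      rw [hZ, ← Real.div_rpow (by positivity) (by positivity)]
      refine Real.rpow_le_rpow_of_nonpos (by positivity) ?_ hp0
      rw [div_le_iff₀ (by positivity), hzT]
      have := mul_le_mul_of_nonneg_left hηM hT0.le
      linarith
    calc ‖green A z‖ ≤ ‖∫ t in Set.Icc (T - b) (T + b), heat t A z‖ +
          ‖green A z - ∫ t in Set.Icc (T - b) (T + b), heat t A z‖ := norm_le_insert' _ _
      _ ≤ C₁ * (1 / 2 : ℝ) ^ (-(d : ℝ) / 2) * (2 * ℓ) * T ^ p + 1 * T ^ p := add_le_add hW hle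
      _ = (1 + C₁ * (1 / 2 : ℝ) ^ (-(d : ℝ) / 2) * (2 * ℓ)) * T ^ p := by ring
      _ ≤ (1 + C₁ * (1 / 2 : ℝ) ^ (-(d : ℝ) / 2) * (2 * ℓ)) * (Z / (1 + M) ^ p) := by gcongr
      _ = (1 + C₁ * (1 / 2 : ℝ) ^ (-(d : ℝ) / 2) * (2 * ℓ)) / (1 + M) ^ p * Z := by ring
      _ ≤ _ := mul_le_mul_of_nonneg_right (le_add_of_nonneg_left (by positivity)) hZ0.le

/-! ### Second moments and the local limit theorem -/

/-- The quadratic form of second moments of `f`. -/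
def quadForm {d : ℕ} (f : Lat d → ℝ) (k : Vec d) : ℝ := ∑' y, (inner ℝ k (toVec y) : ℝ) ^ 2 * f y

lemma summable_sq_inner_mul {d : ℕ} {f : Lat d → ℝ} (h : Summable fun y => ‖toVec y‖ ^ 2 * |f y|)
    (k : Vec d) : Summable fun y => (inner ℝ k (toVec y) : ℝ) ^ 2 * f y := by
  refine Summable.of_norm_bounded (h.mul_left (‖k‖ ^ 2)) fun y => ?_
  rw [norm_mul, Real.norm_eq_abs, Real.norm_eq_abs, abs_pow, ← mul_assoc, ← mul_pow]
  gcongr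
  exact abs_inner_toVec_le k y

lemma abs_quadForm_le {d : ℕ} {f : Lat d → ℝ} (h : Summable fun y => ‖toVec y‖ ^ 2 * |f y|)
    (k : Vec d) : |quadForm f k| ≤ ‖k‖ ^ 2 * ∑' y, ‖toVec y‖ ^ 2 * |f y| := by
  rw [quadForm, ← Real.norm_eq_abs, ← tsum_mul_left]
  refine tsum_of_norm_bounded (h.mul_left (‖k‖ ^ 2)).hasSum fun y => ?_
  rw [norm_mul, Real.norm_eq_abs, Real.norm_eq_abs, abs_pow, ← mul_assoc, ← mul_pow]
  gcongr
  exact abs_inner_toVec_le k y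

lemma quadForm_smul {d : ℕ} (f : Lat d → ℝ) (s : ℝ) (k : Vec d) :
    quadForm f (s • k) = s ^ 2 * quadForm f k := by
  simp only [quadForm, real_inner_smul_left, mul_pow, mul_assoc, tsum_mul_left]

lemma quadForm_eq_dotProduct {d : ℕ} {f : Lat d → ℝ} (h : Summable fun y => ‖toVec y‖ ^ 2 * |f y|)
    (k : Vec d) : quadForm f k = k.ofLp ⬝ᵥ (secondMoment f).mulVec k.ofLp := by
  have h1 : ∀ j l : Fin d, Summable fun y : Lat d => (y j : ℝ) * (y l : ℝ) * f y := by
    intro j l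
    refine Summable.of_norm_bounded h fun y => ?_
    rw [norm_mul, norm_mul, Real.norm_eq_abs (f y), sq]
    gcongr
    · exact PiLp.norm_apply_le (toVec y) j
    · exact PiLp.norm_apply_le (toVec y) l
  simp only [quadForm, inner_toVec, sq, Finset.sum_mul, dotProduct, Matrix.mulVec,
    secondMoment, Matrix.of_apply, Finset.mul_sum]
  rw [Summable.tsum_finsetSum (fun j _ => summable_sum fun l _ => by
    simpa [mul_comm, mul_left_comm, mul_assoc] using (h1 j l).mul_left (k j * k l))]
  refine Finset.sum_congr rfl fun j _ => ?_
  rw [Summable.tsum_finsetSum (fun l _ => by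
    simpa [mul_comm, mul_left_comm, mul_assoc] using (h1 j l).mul_left (k j * k l))]
  refine Finset.sum_congr rfl fun l _ => ?_
  rw [mul_comm (∑' y : Lat d, _) (k l), ← mul_assoc, ← tsum_mul_left]
  exact tsum_congr fun y => by ring

lemma continuous_quadForm {d : ℕ} {f : Lat d → ℝ} (h : Summable fun y => ‖toVec y‖ ^ 2 * |f y|) :
    Continuous (quadForm f) := by
  rw [funext (quadForm_eq_dotProduct h)]
  simp only [dotProduct, Matrix.mulVec]
  fun_prop

/-- For `|θ| ≤ 1` the cubic remainder is bounded by the power `2 + ζ` because `ζ ≤ 1`; for `|θ| ≥ 1`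
each term separately is. Hence moments of order `2 + ζ` suffice. -/
lemma norm_exp_neg_I_taylor {ζ : ℝ} (hζ : 0 < ζ) (hζ1 : ζ ≤ 1) (θ : ℝ) :
    ‖1 - Complex.exp (-(Complex.I * (θ : ℂ))) - (Complex.I * θ + (θ ^ 2 / 2 : ℝ))‖ ≤
      4 * |θ| ^ (2 + ζ) := by
  have hn : ‖-(Complex.I * (θ : ℂ))‖ = |θ| := by simp
  rcases le_total |θ| 1 with h | h
  · have h1 := Complex.norm_exp_sub_sum_le_norm_mul_exp (-(Complex.I * (θ : ℂ))) 3
    rw [hn] at h1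
    have e : 1 - Complex.exp (-(Complex.I * (θ : ℂ))) - (Complex.I * θ + (θ ^ 2 / 2 : ℝ)) =
        -(Complex.exp (-(Complex.I * (θ : ℂ))) -
          ∑ m ∈ Finset.range 3, (-(Complex.I * (θ : ℂ))) ^ m / (m.factorial : ℂ)) := by
      simp only [Finset.sum_range_succ, Finset.sum_range_zero, Nat.factorial]
      push_cast
      ring_nf
      rw [Complex.I_sq]; ring
    rw [e, norm_neg]
    have h2 : Real.exp |θ| ≤ 4 := (Real.exp_le_exp.mpr h).trans (by linarith [Real.exp_one_lt_d9])
    have h3 : |θ| ^ 3 ≤ |θ| ^ (2 + ζ) := by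
      rw [← Real.rpow_natCast]
      rcases (abs_nonneg θ).eq_or_lt with h0 | h0
      · rw [← h0, Real.zero_rpow (by norm_num), Real.zero_rpow (by linarith)]
      · exact Real.rpow_le_rpow_of_exponent_ge h0 h (by push_cast; linarith)
    calc _ ≤ _ := h1
      _ ≤ |θ| ^ (2 + ζ) * 4 := by gcongr
      _ = _ := by ring
  · have h1 : ‖Complex.exp (-(Complex.I * (θ : ℂ)))‖ = 1 := by
      rw [Complex.norm_exp]; simp
    have h2 : |θ| ^ 2 ≤ |θ| ^ (2 + ζ) := by
      rw [← Real.rpow_natCast]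
      exact Real.rpow_le_rpow_of_exponent_le h (by push_cast; linarith)
    have h3 : ‖(Complex.I * θ + (θ ^ 2 / 2 : ℝ) : ℂ)‖ ≤ |θ| + |θ| ^ 2 / 2 := by
      refine (norm_add_le _ _).trans (le_of_eq ?_)
      rw [norm_mul, Complex.norm_I, one_mul, Complex.norm_real, Complex.norm_real, Real.norm_eq_abs,
        Real.norm_eq_abs, abs_div, abs_pow]
      norm_num
    have h4 : ‖(1 - Complex.exp (-(Complex.I * (θ : ℂ))) : ℂ)‖ ≤ 2 := by
      refine (norm_sub_le _ _).trans ?_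
      rw [h1, norm_one]; norm_num
    refine (norm_sub_le _ _).trans ?_
    nlinarith

lemma fourierSum_zero {d : ℕ} (f : Lat d → ℝ) : fourierSum f 0 = ((∑' y, f y : ℝ) : ℂ) := by
  rw [fourierSum, Complex.ofReal_tsum]; simp

/-- Second-order Taylor expansion of the Fourier transform at the origin. -/
lemma norm_fourierSum_taylor_le {d : ℕ} {f : Lat d → ℝ} {ζ : ℝ} (hζ : 0 < ζ) (hζ1 : ζ ≤ 1)
    (hf : Summable f) (hm : Summable fun y => ‖toVec y‖ ^ (2 + ζ) * |f y|) (k : Vec d) :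
    ‖fourierSum f 0 - fourierSum f k -
      (Complex.I * (inner ℝ k (firstMoment f) : ℝ) + (quadForm f k / 2 : ℝ))‖ ≤
      4 * ‖k‖ ^ (2 + ζ) * ∑' y, ‖toVec y‖ ^ (2 + ζ) * |f y| := by
  have m1 := summable_norm_mul (p := 1) one_pos (by linarith) hm
  have m2 := summable_norm_mul (p := 2) two_pos (by linarith) hm
  simp only [Real.rpow_one] at m1
  simp only [Real.rpow_two] at m2
  have s0 : HasSum (fun y => (f y : ℂ)) (fourierSum f 0) := by
    rw [fourierSum_zero]; exact Complex.hasSum_ofReal.mpr hf.hasSum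
  have s1 : HasSum (fun y => (f y : ℂ) * Complex.exp (-(Complex.I * ((inner ℝ k (toVec y) : ℝ) : ℂ))))
      (fourierSum f k) := by
    have := (summable_mul_chr hf k).hasSum
    rw [← fourierSum_eq] at this
    simpa only [chr_neg] using this
  have s2 : HasSum (fun y => Complex.I * (((inner ℝ k (toVec y) : ℝ) * f y : ℝ) : ℂ))
      (Complex.I * (inner ℝ k (firstMoment f) : ℝ)) := by
    rw [inner_firstMoment m1]
    exact (Complex.hasSum_ofReal.mpr (summable_inner_mul m1 k).hasSum).mul_left _
  have s3 : HasSum (fun y => ((((inner ℝ k (toVec y) : ℝ) ^ 2 * f y) / 2 : ℝ) : ℂ))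
      ((quadForm f k / 2 : ℝ) : ℂ) :=
    Complex.hasSum_ofReal.mpr ((summable_sq_inner_mul m2 k).hasSum.div_const 2)
  have s4 := (s0.sub s1).sub (s2.add s3)
  rw [← s4.tsum_eq, ← tsum_mul_left]
  refine tsum_of_norm_bounded (hm.mul_left (4 * ‖k‖ ^ (2 + ζ))).hasSum fun y => ?_
  set θ : ℝ := inner ℝ k (toVec y)
  have e : (f y : ℂ) - (f y : ℂ) * Complex.exp (-(Complex.I * (θ : ℂ))) -
      (Complex.I * ((θ * f y : ℝ) : ℂ) + (((θ ^ 2 * f y) / 2 : ℝ) : ℂ)) =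
      (f y : ℂ) * (1 - Complex.exp (-(Complex.I * (θ : ℂ))) - (Complex.I * θ + (θ ^ 2 / 2 : ℝ))) := by
    push_cast; ring
  rw [e, norm_mul, Complex.norm_real, Real.norm_eq_abs]
  have h1 : |θ| ^ (2 + ζ) ≤ ‖k‖ ^ (2 + ζ) * ‖toVec y‖ ^ (2 + ζ) := by
    rw [← Real.mul_rpow (norm_nonneg _) (norm_nonneg _)]
    exact Real.rpow_le_rpow (abs_nonneg _) (abs_inner_toVec_le k y) (by linarith)
  calc _ ≤ |f y| * (4 * (‖k‖ ^ (2 + ζ) * ‖toVec y‖ ^ (2 + ζ))) := by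
        gcongr
        exact (norm_exp_neg_I_taylor hζ hζ1 θ).trans (by gcongr)
    _ = _ := by ring

/-- The infrared bound gives a lower bound on the quadratic form of second moments. -/
lemma le_quadForm {d : ℕ} {f : Lat d → ℝ} {ζ K : ℝ} (hζ : 0 < ζ) (hζ1 : ζ ≤ 1)
    (hf : Summable f) (hm : Summable fun y => ‖toVec y‖ ^ (2 + ζ) * |f y|)
    (hir : ∀ k ∈ cube d, K * ‖k‖ ^ 2 ≤ (fourierSum f 0 - fourierSum f k).re) (k : Vec d) :
    2 * K * ‖k‖ ^ 2 ≤ quadForm f k := by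
  set B := ∑' y, ‖toVec y‖ ^ (2 + ζ) * |f y|
  -- The infrared bound is applied at `s • k`, divided by `s ^ 2`, and `s` tends to zero; the drift
  -- is invisible because it contributes only to the imaginary part.
  have hlim : Tendsto (fun s : ℝ => quadForm f k / 2 + 4 * (s ^ ζ * ‖k‖ ^ (2 + ζ)) * B) (𝓝[>] 0)
      (𝓝 (quadForm f k / 2 + 4 * (0 * ‖k‖ ^ (2 + ζ)) * B)) := by
    have : Tendsto (fun s : ℝ => s ^ ζ) (𝓝[>] 0) (𝓝 0) := by
      have h := (Real.continuousAt_rpow_const 0 ζ (Or.inr hζ.le)).tendsto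
      rw [Real.zero_rpow hζ.ne'] at h
      exact h.mono_left nhdsWithin_le_nhds
    exact (((this.mul_const _).const_mul 4).mul_const B).const_add _
  have hev : ∀ᶠ s : ℝ in 𝓝[>] 0, K * ‖k‖ ^ 2 ≤ quadForm f k / 2 + 4 * (s ^ ζ * ‖k‖ ^ (2 + ζ)) * B := by
    have hpos : 0 < Real.pi / (1 + ‖k‖) := by positivity
    filter_upwards [Ioo_mem_nhdsGT hpos] with s ⟨hs0, hs⟩
    have hmem : s • k ∈ cube d := by
      intro j
      rw [PiLp.smul_apply, smul_eq_mul, abs_mul, abs_of_pos hs0]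
      have h1 : |k j| ≤ ‖k‖ := PiLp.norm_apply_le k j
      rw [lt_div_iff₀ (by positivity)] at hs
      nlinarith
    have h1 := hir _ hmem
    have h2 := (Complex.re_le_norm _).trans (norm_fourierSum_taylor_le hζ hζ1 hf hm (s • k))
    rw [Complex.sub_re, Complex.add_re, Complex.re_mul_ofReal, Complex.I_re, zero_mul, zero_add,
      Complex.ofReal_re, quadForm_smul] at h2
    rw [norm_smul, Real.norm_of_nonneg hs0.le] at h1 h2
    rw [Real.mul_rpow hs0.le (norm_nonneg _), Real.rpow_add hs0, Real.rpow_two] at h2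
    have hs2 : 0 < s ^ 2 := by positivity
    refine le_of_mul_le_mul_left ?_ hs2
    calc s ^ 2 * (K * ‖k‖ ^ 2) = K * (s * ‖k‖) ^ 2 := by ring
      _ ≤ s ^ 2 * quadForm f k / 2 + 4 * (s ^ 2 * s ^ ζ * ‖k‖ ^ (2 + ζ)) * B := by linarith
      _ = _ := by ring
  have := ge_of_tendsto hlim hev
  linarith

lemma norm_exp_sub_exp_le {a b : ℂ} {m : ℝ} (ha : a.re ≤ m) (hb : b.re ≤ m) :
    ‖Complex.exp a - Complex.exp b‖ ≤ Real.exp m * ‖a - b‖ := by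
  refine Convex.norm_image_sub_le_of_norm_deriv_le (s := {z : ℂ | z.re ≤ m}) (f := Complex.exp)
    (fun z _ => Complex.differentiableAt_exp) (fun z hz => ?_) (convex_halfSpace_re_le m) hb ha
  rw [Complex.deriv_exp, Complex.norm_exp]
  exact Real.exp_le_exp.mpr hz

/-- Half of the Gaussian absorbs a power of `r`, each power being worth `β ^ (-1/2)`. The range `p ≤
4` covers the exponents `1`, `2` and `2 + ζ` that occur. -/
lemma rpow_mul_exp_neg_le {β r p : ℝ} (hβ : 0 < β) (hr : 0 ≤ r) (hp : 0 ≤ p) (hp4 : p ≤ 4) :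
    r ^ p * Real.exp (-(β * r ^ 2)) ≤ 9 * β ^ (-p / 2) * Real.exp (-(β / 2) * r ^ 2) := by
  set u := β ^ (1 / 2 : ℝ) * r with hu
  have hu0 : 0 ≤ u := by positivity
  have hu2 : u ^ 2 = β * r ^ 2 := by
    rw [hu, mul_pow, ← Real.rpow_natCast, ← Real.rpow_mul hβ.le]; norm_num
  have e1 : r ^ p = β ^ (-p / 2) * u ^ p := by
    rw [hu, Real.mul_rpow (by positivity) hr, ← Real.rpow_mul hβ.le, ← mul_assoc, ← Real.rpow_add hβ]
    rw [show -p / 2 + 1 / 2 * p = 0 by ring, Real.rpow_zero, one_mul]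
  have h1 : u ^ p ≤ 1 + u ^ 4 := by
    rcases le_total u 1 with h | h
    · have := Real.rpow_le_one hu0 h hp
      have : 0 ≤ u ^ 4 := by positivity
      linarith
    · have := Real.rpow_le_rpow_of_exponent_le h hp4
      rw [show (4 : ℝ) = ((4 : ℕ) : ℝ) by norm_num, Real.rpow_natCast] at this
      linarith
  have h2 : 1 + u ^ 4 ≤ 9 * Real.exp (u ^ 2 / 2) := by
    have h3 := Real.pow_div_factorial_le_exp (u ^ 2 / 2) (by positivity) 2
    have h4 := Real.one_le_exp (show 0 ≤ u ^ 2 / 2 by positivity)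
    norm_num [Nat.factorial] at h3
    nlinarith
  have e2 : Real.exp (u ^ 2 / 2) * Real.exp (-(β * r ^ 2)) = Real.exp (-(β / 2) * r ^ 2) := by
    rw [← Real.exp_add, hu2]; congr 1; ring
  rw [e1, ← e2]
  calc _ ≤ β ^ (-p / 2) * (9 * Real.exp (u ^ 2 / 2)) * Real.exp (-(β * r ^ 2)) := by
        gcongr; exact h1.trans h2
    _ = _ := by ring

namespace CritKernel

variable {d : ℕ} {M K ζ c : ℝ} {A : Lat d → ℝ}

lemma fourierSum_zero_eq (h : CritKernel M K ζ c A) : fourierSum A 0 = 1 := by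
  rw [fourierSum_zero, h.tsum_eq, Complex.ofReal_one]

lemma quadForm_le (h : CritKernel M K ζ c A) (hζ : 0 < ζ) (k : Vec d) :
    |quadForm A k| ≤ M * ‖k‖ ^ 2 := by
  refine (abs_quadForm_le (h.mom_two hζ).1 k).trans ?_
  rw [mul_comm]
  gcongr
  exact (h.mom_two hζ).2

lemma le_quadForm (h : CritKernel M K ζ c A) (hζ : 0 < ζ) (hζ1 : ζ ≤ 1) (k : Vec d) :
    2 * K * ‖k‖ ^ 2 ≤ quadForm A k :=
  OZ.le_quadForm hζ hζ1 h.summable h.mom_summable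
    (fun k hk => by rw [h.fourierSum_zero_eq]; exact h.infrared k hk) k

lemma taylor_le (h : CritKernel M K ζ c A) (hζ : 0 < ζ) (hζ1 : ζ ≤ 1) (k : Vec d) :
    ‖1 - fourierSum A k -
      (Complex.I * (inner ℝ k (firstMoment A) : ℝ) + (quadForm A k / 2 : ℝ))‖ ≤
      4 * M * ‖k‖ ^ (2 + ζ) := by
  rw [← h.fourierSum_zero_eq]
  refine (norm_fourierSum_taylor_le hζ hζ1 h.summable h.mom_summable k).trans ?_
  rw [mul_right_comm]
  gcongr
  exact h.mom_le

end CritKernel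

/-- The exponent of the Gaussian approximation of the semigroup. -/
def gaussExp {d : ℕ} (A : Lat d → ℝ) (T s : ℝ) (k : Vec d) : ℂ :=
  -(Complex.I * ((s * inner ℝ k (firstMoment A) : ℝ) : ℂ)) - ((T * quadForm A k / 2 : ℝ) : ℂ)

/-- The Gaussian approximation of the semigroup at the point `-s η`, with variance of time `T`. -/
def gaussQ {d : ℕ} (A : Lat d → ℝ) (T s : ℝ) : ℂ :=
  (((2 * Real.pi) ^ d : ℝ) : ℂ)⁻¹ * ∫ k : Vec d, Complex.exp (gaussExp A T s k)

lemma re_gaussExp {d : ℕ} (A : Lat d → ℝ) (T s : ℝ) (k : Vec d) :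
    (gaussExp A T s k).re = -(T * quadForm A k / 2) := by
  rw [gaussExp, Complex.sub_re, Complex.neg_re, Complex.re_mul_ofReal, Complex.I_re, Complex.ofReal_re]
  ring

namespace CritKernel

variable {d : ℕ} {M K ζ c : ℝ} {A : Lat d → ℝ}

lemma continuous_gaussExp (h : CritKernel M K ζ c A) (hζ : 0 < ζ) (T s : ℝ) :
    Continuous (gaussExp A T s) := by
  have := continuous_quadForm (h.mom_two hζ).1
  unfold gaussExp
  fun_prop

lemma re_gaussExp_le (h : CritKernel M K ζ c A) (hζ : 0 < ζ) (hζ1 : ζ ≤ 1) {T : ℝ} (hT : 0 ≤ T) (s : ℝ)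
    (k : Vec d) : (gaussExp A T s k).re ≤ -(T * K * ‖k‖ ^ 2) := by
  rw [re_gaussExp]
  have := mul_le_mul_of_nonneg_left (h.le_quadForm hζ hζ1 k) hT
  linarith

lemma integrable_gauss (h : CritKernel M K ζ c A) (hζ : 0 < ζ) (hζ1 : ζ ≤ 1) (hK : 0 < K) {T : ℝ}
    (hT : 0 < T) (s : ℝ) : Integrable fun k => Complex.exp (gaussExp A T s k) := by
  refine Integrable.mono' (integrable_exp_neg_mul_norm_sq d (mul_pos hT hK))
    (Complex.continuous_exp.comp (h.continuous_gaussExp hζ T s)).aestronglyMeasurable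
    (.of_forall fun k => ?_)
  rw [Complex.norm_exp]
  apply Real.exp_le_exp.mpr
  have := h.re_gaussExp_le hζ hζ1 hT.le s k
  linarith

lemma norm_gaussQ_le (h : CritKernel M K ζ c A) (hζ : 0 < ζ) (hζ1 : ζ ≤ 1) (hK : 0 < K) {T : ℝ}
    (hT : 0 < T) (s : ℝ) : ‖gaussQ A T s‖ ≤ (Real.pi / K) ^ ((d : ℝ) / 2) * T ^ (-(d : ℝ) / 2) := by
  have hP : (1 : ℝ) ≤ (2 * Real.pi) ^ d := one_le_pow₀ (by linarith [Real.pi_gt_three])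
  rw [gaussQ, norm_mul, norm_inv, Complex.norm_real, Real.norm_of_nonneg (by positivity)]
  have h1 : ‖∫ k : Vec d, Complex.exp (gaussExp A T s k)‖ ≤
      (Real.pi / K) ^ ((d : ℝ) / 2) * T ^ (-(d : ℝ) / 2) := by
    refine (norm_integral_le_of_norm_le (integrable_exp_neg_mul_norm_sq d (mul_pos hT hK))
      (.of_forall fun k => ?_)).trans_eq ?_
    · rw [Complex.norm_exp]
      apply Real.exp_le_exp.mpr
      have := h.re_gaussExp_le hζ hζ1 hT.le s k
      linarith
    · rw [integral_exp_neg_mul_norm_sq d (mul_pos hT hK), mul_comm T, ← div_div,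
        Real.div_rpow (by positivity) hT.le, neg_div, Real.rpow_neg hT.le, div_eq_mul_inv]
  calc _ ≤ 1 * ((Real.pi / K) ^ ((d : ℝ) / 2) * T ^ (-(d : ℝ) / 2)) :=
        mul_le_mul (inv_le_one_of_one_le₀ hP) h1 (norm_nonneg _) zero_le_one
    _ = _ := one_mul _

end CritKernel

lemma one_le_norm_of_notMem_cube {d : ℕ} {k : Vec d} (hk : k ∉ cube d) : 1 ≤ ‖k‖ := by
  simp only [cube, Set.mem_ofPred_eq, not_forall, not_le] at hk
  obtain ⟨j, hj⟩ := hk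
  have h1 : |k j| ≤ ‖k‖ := PiLp.norm_apply_le k j
  linarith [Real.pi_gt_three]

/-- Gaussian approximation of the semigroup, at times comparable with `T`. -/
lemma exists_heat_sub_gaussQ_le (d : ℕ) {M K ζ : ℝ} (hM : 0 < M) (hK : 0 < K) (hζ : 0 < ζ)
    (hζ1 : ζ ≤ 1) :
    ∃ C : ℝ, 0 < C ∧ ∀ (c : ℝ) (A : Lat d → ℝ), CritKernel M K ζ c A → ∀ (T t : ℝ) (z : Lat d),
      1 ≤ T → T / 2 ≤ t → t ≤ 2 * T → ‖heat t A z - gaussQ A T (t - T)‖ ≤ C * T ^ (-(d : ℝ) / 2) *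
        (‖toVec z - T • firstMoment A‖ * T ^ (-(1 / 2) : ℝ) + T ^ (-ζ / 2) + |t - T| * T ^ (-1 : ℝ) +
          T ^ (-(1 / 2) : ℝ)) := by
  have hK2 : 0 < K / 2 := half_pos hK
  -- The three summands belong to the error powers `1`, `2 + ζ` and `2` of `‖k‖`.
  set B : ℝ := 9 * ((K / 2) ^ (-(1 / 2) : ℝ) + 8 * M * (K / 2) ^ (-(2 + ζ) / 2) + M * (K / 2) ^ (-1 : ℝ)) with hB
  have hB0 : 0 < B := by positivity
  have hP := two_pi_pow_pos d
  refine ⟨((2 * Real.pi) ^ d)⁻¹ * (B * (Real.pi / (K / 4)) ^ ((d : ℝ) / 2)), by positivity,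
    fun c A h T t z hT ht1 ht2 => ?_⟩
  have hT0 : 0 < T := by linarith
  have hA := continuous_fourierSum h.summable
  set X := ‖toVec z - T • firstMoment A‖ with hX
  set Y := X * T ^ (-(1 / 2) : ℝ) + T ^ (-ζ / 2) + |t - T| * T ^ (-1 : ℝ) + T ^ (-(1 / 2) : ℝ) with hY
  have hY0 : 0 ≤ Y := by positivity
  set β := T * (K / 2) with hβ
  have hβ0 : 0 < β := by positivity
  have hβp : ∀ p : ℝ, β ^ p = T ^ p * (K / 2) ^ p := fun p => Real.mul_rpow hT0.le hK2.le
  set E := fun k : Vec d => Complex.I * ((inner ℝ k (toVec z) : ℝ) : ℂ) - t * (1 - fourierSum A k) with hE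
  have hEc : Continuous E := by simp only [hE]; fun_prop
  have hheat : heat t A z = (((2 * Real.pi) ^ d : ℝ) : ℂ)⁻¹ *
      ∫ k, (cube d).indicator (fun k => Complex.exp (E k)) k := by
    rw [heat, fcoef, integral_indicator (measurableSet_cube d)]
    congr 2; ext k
    rw [chr, ← Complex.exp_add]
    congr 1
  have hi1 : Integrable ((cube d).indicator fun k => Complex.exp (E k)) :=
    (integrable_indicator_iff (measurableSet_cube d)).mpr
      ((Complex.continuous_exp.comp hEc).continuousOn.integrableOn_compact (isCompact_cube d))
  have hi2 := h.integrable_gauss hζ hζ1 hK hT0 (t - T)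
  have hpt : ∀ k : Vec d, ‖(cube d).indicator (fun k => Complex.exp (E k)) k -
      Complex.exp (gaussExp A T (t - T) k)‖ ≤ B * Y * Real.exp (-(β / 2) * ‖k‖ ^ 2) := by
    intro k
    set r := ‖k‖ with hr
    have hr0 : 0 ≤ r := norm_nonneg k
    have q1 := rpow_mul_exp_neg_le hβ0 hr0 (p := 1) (by norm_num) (by norm_num)
    have q2 := rpow_mul_exp_neg_le hβ0 hr0 (p := 2) (by norm_num) (by norm_num)
    have q3 := rpow_mul_exp_neg_le hβ0 hr0 (p := 2 + ζ) (by linarith) (by linarith)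
    set G := Real.exp (-(β / 2) * r ^ 2)
    have hG0 : 0 < G := Real.exp_pos _
    set G' := Real.exp (-(β * r ^ 2))
    have hG'0 : 0 < G' := Real.exp_pos _
    rw [hβp, Real.rpow_one, neg_div] at q1
    rw [hβp, Real.rpow_two, neg_div, div_self two_ne_zero] at q2
    rw [hβp] at q3
    have hre2 : (gaussExp A T (t - T) k).re ≤ -(β * r ^ 2) := by
      refine (h.re_gaussExp_le hζ hζ1 hT0.le (t - T) k).trans ?_
      have : 0 ≤ T * K * r ^ 2 := by positivity
      rw [hβ]; linarith
    by_cases hk : k ∈ cube d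
    · rw [Set.indicator_of_mem hk]
      have hre1 : (E k).re ≤ -(β * r ^ 2) := by
        have e : (E k).re = -(t * (1 - fourierSum A k).re) := by
          simp only [hE, Complex.sub_re, Complex.re_mul_ofReal, Complex.I_re, Complex.re_ofReal_mul]
          ring
        rw [e, hβ]
        have h1 := h.infrared k hk
        have h2 : T / 2 * (K * r ^ 2) ≤ t * (1 - fourierSum A k).re :=
          mul_le_mul ht1 h1 (by positivity) (by linarith)
        linarith
      -- The errors are the offset of `z` from `T η`, the Taylor remainder, and the variance frozen
      -- at time `T`. Freezing it makes the approximation an exact Gaussian in `t`.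
      have hdiff : ‖E k - gaussExp A T (t - T) k‖ ≤ r * X + 8 * M * T * r ^ (2 + ζ) + |t - T| * M * r ^ 2 := by
        have e : E k - gaussExp A T (t - T) k =
            Complex.I * ((inner ℝ k (toVec z - T • firstMoment A) : ℝ) : ℂ) -
            t * (1 - fourierSum A k - (Complex.I * (inner ℝ k (firstMoment A) : ℝ) +
              (quadForm A k / 2 : ℝ))) - (((t - T) * quadForm A k / 2 : ℝ) : ℂ) := by
          simp only [hE, gaussExp, inner_sub_right, real_inner_smul_right]
          push_cast; ring
        rw [e]
        have b1 : ‖Complex.I * ((inner ℝ k (toVec z - T • firstMoment A) : ℝ) : ℂ)‖ ≤ r * X := by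
          rw [norm_mul, Complex.norm_I, one_mul, Complex.norm_real]
          exact abs_real_inner_le_norm _ _
        have b2 : ‖(t : ℂ) * (1 - fourierSum A k - (Complex.I * (inner ℝ k (firstMoment A) : ℝ) +
              (quadForm A k / 2 : ℝ)))‖ ≤ 8 * M * T * r ^ (2 + ζ) := by
          rw [norm_mul, Complex.norm_real, Real.norm_of_nonneg (by linarith)]
          calc _ ≤ 2 * T * (4 * M * r ^ (2 + ζ)) := by
                gcongr
                exact h.taylor_le hζ hζ1 k
            _ = _ := by ring
        have b3 : ‖(((t - T) * quadForm A k / 2 : ℝ) : ℂ)‖ ≤ |t - T| * M * r ^ 2 := by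
          rw [Complex.norm_real, Real.norm_eq_abs, abs_div, abs_mul, abs_of_pos (two_pos : (0:ℝ) < 2)]
          have := mul_le_mul_of_nonneg_left (h.quadForm_le hζ k) (abs_nonneg (t - T))
          have h0 : 0 ≤ |t - T| * (M * ‖k‖ ^ 2) := by positivity
          calc _ ≤ |t - T| * (M * ‖k‖ ^ 2) := by linarith
            _ = _ := by ring
        calc _ ≤ _ := norm_sub_le _ _
          _ ≤ _ := add_le_add (norm_sub_le _ _) le_rfl
          _ ≤ _ := by linarith
      have hTT : T * T ^ (-(2 + ζ) / 2) = T ^ (-ζ / 2) := by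
        nth_rw 1 [← Real.rpow_one T]
        rw [← Real.rpow_add hT0]; congr 1; ring
      calc _ ≤ G' * ‖E k - gaussExp A T (t - T) k‖ := norm_exp_sub_exp_le hre1 hre2
        _ ≤ G' * (r * X + 8 * M * T * r ^ (2 + ζ) + |t - T| * M * r ^ 2) := by gcongr
        _ = X * (r * G') + 8 * M * T * (r ^ (2 + ζ) * G') + |t - T| * M * (r ^ 2 * G') := by ring
        _ ≤ X * (9 * (T ^ (-(1 / 2) : ℝ) * (K / 2) ^ (-(1 / 2) : ℝ)) * G) +
            8 * M * T * (9 * (T ^ (-(2 + ζ) / 2) * (K / 2) ^ (-(2 + ζ) / 2)) * G) +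
            |t - T| * M * (9 * (T ^ (-1 : ℝ) * (K / 2) ^ (-1 : ℝ)) * G) := by gcongr
        _ = (9 * (K / 2) ^ (-(1 / 2) : ℝ)) * (X * T ^ (-(1 / 2) : ℝ)) * G +
            (9 * (8 * M * (K / 2) ^ (-(2 + ζ) / 2))) * (T * T ^ (-(2 + ζ) / 2)) * G +
            (9 * (M * (K / 2) ^ (-1 : ℝ))) * (|t - T| * T ^ (-1 : ℝ)) * G := by ring
        _ ≤ B * (X * T ^ (-(1 / 2) : ℝ)) * G + B * T ^ (-ζ / 2) * G + B * (|t - T| * T ^ (-1 : ℝ)) * G := by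
            rw [hTT]
            have p1 : 0 < (K / 2) ^ (-(1 / 2) : ℝ) := by positivity
            have p2 : 0 < 8 * M * (K / 2) ^ (-(2 + ζ) / 2) := by positivity
            have p3 : 0 < M * (K / 2) ^ (-1 : ℝ) := by positivity
            gcongr <;> linarith
        _ ≤ B * (X * T ^ (-(1 / 2) : ℝ)) * G + B * T ^ (-ζ / 2) * G + B * (|t - T| * T ^ (-1 : ℝ)) * G +
            B * T ^ (-(1 / 2) : ℝ) * G := le_add_of_nonneg_right (by positivity)
        _ = _ := by rw [hY]; ring
    -- Off the cube only the Gaussian is present, and there `‖k‖ ≥ 1`, so an extra factor `‖k‖` may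
    -- be inserted and gains `T ^ (-1/2)`.
    · rw [Set.indicator_of_notMem hk, zero_sub, norm_neg, Complex.norm_exp]
      have hr1 := one_le_norm_of_notMem_cube hk
      calc _ ≤ G' := Real.exp_le_exp.mpr hre2
        _ ≤ r * G' := le_mul_of_one_le_left hG'0.le hr1
        _ ≤ 9 * (T ^ (-(1 / 2) : ℝ) * (K / 2) ^ (-(1 / 2) : ℝ)) * G := q1
        _ = (9 * (K / 2) ^ (-(1 / 2) : ℝ)) * T ^ (-(1 / 2) : ℝ) * G := by ring
        _ ≤ B * Y * G := by
            have p1 : 0 ≤ 8 * M * (K / 2) ^ (-(2 + ζ) / 2) + M * (K / 2) ^ (-1 : ℝ) := by positivity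
            have p2 : 0 ≤ X * T ^ (-(1 / 2) : ℝ) + T ^ (-ζ / 2) + |t - T| * T ^ (-1 : ℝ) := by positivity
            gcongr
            · linarith
            · linarith
  have hi3 := (integrable_exp_neg_mul_norm_sq d (half_pos hβ0)).const_mul (B * Y)
  rw [hheat, gaussQ, ← mul_sub, ← integral_sub hi1 hi2, norm_mul, norm_inv, Complex.norm_real,
    Real.norm_of_nonneg hP.le]
  have h5 := norm_integral_le_of_norm_le hi3 (.of_forall hpt)
  rw [integral_const_mul, integral_exp_neg_mul_norm_sq d (half_pos hβ0)] at h5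
  have e5 : (Real.pi / (β / 2)) ^ ((d : ℝ) / 2) = (Real.pi / (K / 4)) ^ ((d : ℝ) / 2) * T ^ (-(d : ℝ) / 2) := by
    rw [neg_div, Real.rpow_neg hT0.le, ← div_eq_mul_inv, ← Real.div_rpow (by positivity) hT0.le]
    congr 1; rw [hβ]; field_simp; norm_num
  rw [e5] at h5
  calc _ ≤ ((2 * Real.pi) ^ d)⁻¹ * (B * Y * ((Real.pi / (K / 4)) ^ ((d : ℝ) / 2) * T ^ (-(d : ℝ) / 2))) := by
        gcongr
    _ = _ := by ring

/-! ### Gaussian integrals with a general covariance, and the leading constant -/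

open scoped MatrixOrder in
lemma exists_eq_transpose_mul_self {d : ℕ} {S : Matrix (Fin d) (Fin d) ℝ} (hS : S.PosDef) :
    ∃ B : Matrix (Fin d) (Fin d) ℝ, S = B.transpose * B ∧ IsUnit B.det := by
  obtain ⟨B, hB⟩ := CStarAlgebra.nonneg_iff_eq_star_mul_self.mp hS.posSemidef.nonneg
  rw [Matrix.star_eq_conjTranspose, Matrix.conjTranspose_eq_transpose_of_trivial] at hB
  refine ⟨B, hB, isUnit_iff_ne_zero.mpr fun h0 => ?_⟩
  have := hS.det_pos
  rw [hB, Matrix.det_mul, h0, mul_zero] at this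
  exact lt_irrefl _ this

lemma inner_eq_dotProduct {d : ℕ} (v w : Vec d) : (inner ℝ v w : ℝ) = v.ofLp ⬝ᵥ w.ofLp := by
  simp [PiLp.inner_apply, dotProduct, mul_comm]

lemma norm_sq_eq_dotProduct {d : ℕ} (v : Vec d) : ‖v‖ ^ 2 = v.ofLp ⬝ᵥ v.ofLp := by
  rw [← real_inner_self_eq_norm_sq, inner_eq_dotProduct]

/-- A linear change of variables turning a positive definite form into the Euclidean one. -/
lemma exists_linear_square_root {d : ℕ} {S : Matrix (Fin d) (Fin d) ℝ} (hS : S.PosDef) (η : Vec d) :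
    ∃ (L : Vec d →ₗ[ℝ] Vec d) (w : Vec d), |LinearMap.det L| = √S.det ∧
      (∀ k, ‖L k‖ ^ 2 = k.ofLp ⬝ᵥ S.mulVec k.ofLp) ∧ (∀ k, (inner ℝ k η : ℝ) = inner ℝ w (L k)) ∧
      ‖w‖ ^ 2 = invForm S η := by
  obtain ⟨B, hB, hu⟩ := exists_eq_transpose_mul_self hS
  have hut : IsUnit B.transpose.det := by rwa [Matrix.det_transpose]
  -- With `S = Bᵀ B`, the change of variables is `B` itself and a linear functional `η` is
  -- transported by the inverse transpose.
  refine ⟨B.toLpLin 2 2, WithLp.toLp 2 (B.transpose⁻¹.mulVec η.ofLp), ?_, fun k => ?_, fun k => ?_, ?_⟩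
  · rw [LinearMap.det_toLpLin, hB, Matrix.det_mul, Matrix.det_transpose, Real.sqrt_mul_self_eq_abs]
  · rw [norm_sq_eq_dotProduct, hB, Matrix.toLpLin_apply, ← Matrix.mulVec_mulVec,
      Matrix.dotProduct_mulVec k.ofLp, Matrix.vecMul_transpose]
  · rw [inner_eq_dotProduct, inner_eq_dotProduct, Matrix.toLpLin_apply]
    simp only
    rw [Matrix.dotProduct_mulVec, ← Matrix.mulVec_transpose, Matrix.mulVec_mulVec,
      Matrix.mul_nonsing_inv _ hut, Matrix.one_mulVec, dotProduct_comm]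
  · rw [norm_sq_eq_dotProduct, invForm, hB, Matrix.mul_inv_rev, ← Matrix.mulVec_mulVec,
      Matrix.dotProduct_mulVec η.ofLp, ← Matrix.mulVec_transpose, Matrix.transpose_nonsing_inv]

lemma integral_comp_linearMap {d : ℕ} {L : Vec d →ₗ[ℝ] Vec d} (hL : LinearMap.det L ≠ 0)
    (F : Vec d → ℂ) : ∫ k, F (L k) = ((|LinearMap.det L|⁻¹ : ℝ) : ℂ) * ∫ k, F k := by
  have h := Measure.map_linearMap_addHaar_eq_smul_addHaar (volume : Measure (Vec d)) hL
  have he : MeasurableEmbedding L :=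
    (L.equivOfDetNeZero hL).toContinuousLinearEquiv.toHomeomorph.measurableEmbedding
  rw [← he.integral_map, h, integral_smul_measure, ENNReal.toReal_ofReal (abs_nonneg _), abs_inv,
    Complex.real_smul]

/-- The Fourier transform of a Gaussian with a general covariance matrix. -/
lemma integral_cexp_quadratic {d : ℕ} {S : Matrix (Fin d) (Fin d) ℝ} (hS : S.PosDef) (η : Vec d)
    {T : ℝ} (hT : 0 < T) (s : ℝ) :
    ∫ k : Vec d, Complex.exp (-(Complex.I * ((s * inner ℝ k η : ℝ) : ℂ)) -
        ((T * (k.ofLp ⬝ᵥ S.mulVec k.ofLp) / 2 : ℝ) : ℂ)) =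
      (((√S.det)⁻¹ * (2 * Real.pi / T) ^ ((d : ℝ) / 2) *
        Real.exp (-(invForm S η / (2 * T)) * s ^ 2) : ℝ) : ℂ) := by
  obtain ⟨L, w, hdet, hq, hin, hw⟩ := exists_linear_square_root hS η
  have hL : LinearMap.det L ≠ 0 := by
    rw [← abs_ne_zero, hdet]
    exact (Real.sqrt_pos.mpr hS.det_pos).ne'
  have hb : 0 < ((T / 2 : ℝ) : ℂ).re := by rw [Complex.ofReal_re]; positivity
  have hg := GaussianFourier.integral_cexp_neg_mul_sq_norm_add hb (-(Complex.I * s)) w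
  have e : ∀ k : Vec d, Complex.exp (-(Complex.I * ((s * inner ℝ k η : ℝ) : ℂ)) -
        ((T * (k.ofLp ⬝ᵥ S.mulVec k.ofLp) / 2 : ℝ) : ℂ)) =
      (fun v : Vec d => Complex.exp (-((T / 2 : ℝ) : ℂ) * ‖v‖ ^ 2 + -(Complex.I * s) * (inner ℝ w v : ℝ))) (L k) := by
    intro k
    simp only
    rw [hin, ← hq]
    congr 1
    push_cast; ring
  have e0 := integral_comp_linearMap hL (fun v : Vec d =>
    Complex.exp (-((T / 2 : ℝ) : ℂ) * ‖v‖ ^ 2 + -(Complex.I * s) * (inner ℝ w v : ℝ)))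
  refine (integral_congr_ae (.of_forall e)).trans (Eq.trans ?_ (e0.trans ?_))
  · congr 1
  rw [hg, hdet]
  have e1 : ((Real.pi : ℂ) / ((T / 2 : ℝ) : ℂ)) ^ ((Module.finrank ℝ (Vec d) : ℂ) / 2) =
      (((2 * Real.pi / T) ^ ((d : ℝ) / 2) : ℝ) : ℂ) := by
    rw [Complex.ofReal_cpow (by positivity), finrank_euclideanSpace_fin]
    congr 1
    · push_cast; field_simp
    · push_cast; ring
  have e2 : (-(Complex.I * (s : ℂ))) ^ 2 * (‖w‖ : ℂ) ^ 2 / (4 * ((T / 2 : ℝ) : ℂ)) =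
      ((-(invForm S η / (2 * T)) * s ^ 2 : ℝ) : ℂ) := by
    rw [← hw]
    have hT' : (T : ℂ) ≠ 0 := by exact_mod_cast hT.ne'
    push_cast
    rw [neg_sq, mul_pow, Complex.I_sq]
    field_simp
    ring
  rw [e1, e2]
  push_cast; ring

/-- Cauchy–Schwarz in the coordinates where the form is Euclidean. It turns an upper bound on the
form into a lower bound on the inverse form. -/
lemma norm_pow_four_le_mul_invForm {d : ℕ} {S : Matrix (Fin d) (Fin d) ℝ} (hS : S.PosDef) (η : Vec d) :
    ‖η‖ ^ 4 ≤ (η.ofLp ⬝ᵥ S.mulVec η.ofLp) * invForm S η := by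
  obtain ⟨L, w, -, hq, hin, hw⟩ := exists_linear_square_root hS η
  rw [← hq, ← hw]
  have h1 := hin η
  rw [real_inner_self_eq_norm_sq] at h1
  have h2 := real_inner_le_norm w (L η)
  rw [← h1] at h2
  calc ‖η‖ ^ 4 = (‖η‖ ^ 2) ^ 2 := by ring
    _ ≤ (‖w‖ * ‖L η‖) ^ 2 := by gcongr
    _ = _ := by ring

lemma secondMoment_posDef {d : ℕ} {f : Lat d → ℝ} (h : Summable fun y => ‖toVec y‖ ^ 2 * |f y|)
    {κ : ℝ} (hκ : 0 < κ) (hq : ∀ k, κ * ‖k‖ ^ 2 ≤ quadForm f k) : (secondMoment f).PosDef := by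
  refine Matrix.PosDef.of_dotProduct_mulVec_pos ?_ fun v hv => ?_
  · ext i j
    simp only [Matrix.conjTranspose_apply, secondMoment, Matrix.of_apply, star_trivial]
    exact tsum_congr fun y => by ring
  · have h1 := hq (WithLp.toLp 2 v)
    rw [quadForm_eq_dotProduct h] at h1
    rw [star_trivial]
    refine lt_of_lt_of_le ?_ h1
    have : 0 < ‖(WithLp.toLp 2 v : Vec d)‖ := norm_pos_iff.mpr fun h0 => hv (by
      have := congrArg WithLp.ofLp h0
      simpa using this)
    positivity

/-- The leading constant of the Green function along the drift. -/
def greenConst {d : ℕ} (A : Lat d → ℝ) : ℝ :=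
  ((2 * Real.pi) ^ (((d : ℝ) - 1) / 2) * √(secondMoment A).det)⁻¹ *
    (invForm (secondMoment A) (firstMoment A) ^ (1 / 2 : ℝ))⁻¹

namespace CritKernel

variable {d : ℕ} {M K ζ c : ℝ} {A : Lat d → ℝ}

lemma posDef (h : CritKernel M K ζ c A) (hK : 0 < K) (hζ : 0 < ζ) (hζ1 : ζ ≤ 1) :
    (secondMoment A).PosDef :=
  secondMoment_posDef (h.mom_two hζ).1 (by linarith : 0 < 2 * K) (h.le_quadForm hζ hζ1)

lemma le_invForm (h : CritKernel M K ζ c A) (hM : 0 < M) (hK : 0 < K) (hζ : 0 < ζ) (hζ1 : ζ ≤ 1)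
    (hc : 0 < c) : c ^ 2 / M ≤ invForm (secondMoment A) (firstMoment A) := by
  have h1 := norm_pow_four_le_mul_invForm (h.posDef hK hζ hζ1) (firstMoment A)
  set η := firstMoment A
  have hη : 0 < ‖η‖ := hc.trans_le h.drift_le
  rw [← quadForm_eq_dotProduct (h.mom_two hζ).1] at h1
  have h2 := (le_abs_self _).trans (h.quadForm_le hζ η)
  set V := invForm (secondMoment A) η
  have hq : 0 < quadForm A η := lt_of_lt_of_le (by positivity) (h.le_quadForm hζ hζ1 η)
  have hV : 0 < V := by
    by_contra hcon
    have : quadForm A η * V ≤ 0 := mul_nonpos_of_nonneg_of_nonpos hq.le (not_lt.mp hcon)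
    have : 0 < ‖η‖ ^ 4 := by positivity
    linarith
  have h3 : ‖η‖ ^ 2 * ‖η‖ ^ 2 ≤ ‖η‖ ^ 2 * (M * V) := by
    calc ‖η‖ ^ 2 * ‖η‖ ^ 2 = ‖η‖ ^ 4 := by ring
      _ ≤ quadForm A η * V := h1
      _ ≤ M * ‖η‖ ^ 2 * V := by gcongr
      _ = _ := by ring
  have h4 := le_of_mul_le_mul_left h3 (by positivity)
  have h5 : c ^ 2 ≤ ‖η‖ ^ 2 := pow_le_pow_left₀ hc.le h.drift_le 2
  rw [div_le_iff₀ hM]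
  linarith

lemma gaussQ_eq (h : CritKernel M K ζ c A) (hK : 0 < K) (hζ : 0 < ζ) (hζ1 : ζ ≤ 1) {T : ℝ}
    (hT : 0 < T) (s : ℝ) :
    gaussQ A T s = (((((2 * Real.pi) ^ d)⁻¹ * ((√(secondMoment A).det)⁻¹ *
      (2 * Real.pi / T) ^ ((d : ℝ) / 2))) *
        Real.exp (-(invForm (secondMoment A) (firstMoment A) / (2 * T)) * s ^ 2) : ℝ) : ℂ) := by
  have := integral_cexp_quadratic (h.posDef hK hζ hζ1) (firstMoment A) hT s
  simp only [← quadForm_eq_dotProduct (h.mom_two hζ).1] at this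
  rw [gaussQ]
  simp only [gaussExp]
  rw [this]
  push_cast; ring

end CritKernel

lemma exp_neg_mul_sq_le {a r : ℝ} (ha : 0 < a) (hr : 0 < r) :
    Real.exp (-a * r ^ 2) ≤ a⁻¹ * r ^ (-2 : ℝ) := by
  have h1 := Real.add_one_le_exp (a * r ^ 2)
  have h2 : 0 < a * r ^ 2 := by positivity
  rw [neg_mul, Real.exp_neg, Real.rpow_neg hr.le, Real.rpow_two, ← mul_inv]
  exact inv_anti₀ h2 (by linarith)

namespace CritKernel

variable {d : ℕ} {M K ζ c : ℝ} {A : Lat d → ℝ}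

/-- Integral of the Gaussian approximation over all times. -/
lemma gauss_total {T : ℝ} (hT : 0 < T) (hV : 0 < invForm (secondMoment A) (firstMoment A)) :
    ((2 * Real.pi) ^ d)⁻¹ * ((√(secondMoment A).det)⁻¹ * (2 * Real.pi / T) ^ ((d : ℝ) / 2)) *
      √(Real.pi / (invForm (secondMoment A) (firstMoment A) / (2 * T))) =
      greenConst A * T ^ (-((d : ℝ) - 1) / 2) := by
  set V := invForm (secondMoment A) (firstMoment A) with hVdef
  have hp : 0 < 2 * Real.pi := by positivity
  rw [greenConst, ← hVdef, Real.sqrt_eq_rpow (Real.pi / (V / (2 * T))),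
    show Real.pi / (V / (2 * T)) = (2 * Real.pi) * T * V⁻¹ by field_simp,
    Real.mul_rpow (by positivity) (by positivity), Real.mul_rpow hp.le hT.le, Real.inv_rpow hV.le,
    Real.div_rpow hp.le hT.le, mul_inv, ← Real.rpow_natCast, ← Real.rpow_neg hp.le, ← Real.rpow_neg hp.le,
    div_eq_mul_inv, ← Real.rpow_neg hT.le]
  have e1 : (2 * Real.pi) ^ (-(d : ℝ)) * (2 * Real.pi) ^ ((d : ℝ) / 2) * (2 * Real.pi) ^ (1 / 2 : ℝ) =
      (2 * Real.pi) ^ (-(((d : ℝ) - 1) / 2)) := by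
    rw [← Real.rpow_add hp, ← Real.rpow_add hp]; congr 1; ring
  have e2 : T ^ (-((d : ℝ) / 2)) * T ^ (1 / 2 : ℝ) = T ^ (-((d : ℝ) - 1) / 2) := by
    rw [← Real.rpow_add hT]; congr 1; ring
  rw [← e1, ← e2]; ring

/-- Over all times the Gaussian integrates exactly to the leading term, so the difference is its
mass off the window. An inverse-square bound there gives the factor `1 / ℓ`, uniformly since
`le_invForm` bounds the width in time. -/
lemma norm_gauss_window_le (h : CritKernel M K ζ c A) (hM : 0 < M) (hK : 0 < K) (hζ : 0 < ζ)
    (hζ1 : ζ ≤ 1) (hc : 0 < c) {T ℓ : ℝ} (hT : 0 < T) (hℓ : 0 < ℓ) :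
    ‖(∫ t in Set.Icc (T - ℓ * √T) (T + ℓ * √T), gaussQ A T (t - T)) -
      ((greenConst A * T ^ (-((d : ℝ) - 1) / 2) : ℝ) : ℂ)‖ ≤
      (Real.pi / K) ^ ((d : ℝ) / 2) * (4 * (M / c ^ 2) / ℓ) * T ^ (-((d : ℝ) - 1) / 2) := by
  set V := invForm (secondMoment A) (firstMoment A) with hVdef
  have hVge := h.le_invForm hM hK hζ hζ1 hc
  have hV : 0 < V := lt_of_lt_of_le (by positivity) hVge
  set b := ℓ * √T with hb
  have hsq : 0 < √T := Real.sqrt_pos.mpr hT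
  have hb0 : 0 < b := by positivity
  set G := ((2 * Real.pi) ^ d)⁻¹ * ((√(secondMoment A).det)⁻¹ * (2 * Real.pi / T) ^ ((d : ℝ) / 2)) with hG
  have hG0 : 0 ≤ G := by positivity
  have hgq : ∀ s, gaussQ A T s = ((G * Real.exp (-(V / (2 * T)) * s ^ 2) : ℝ) : ℂ) :=
    fun s => h.gaussQ_eq hK hζ hζ1 hT s
  have hGle : G ≤ (Real.pi / K) ^ ((d : ℝ) / 2) * T ^ (-(d : ℝ) / 2) := by
    have := h.norm_gaussQ_le hζ hζ1 hK hT 0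
    rw [hgq, Complex.norm_real, Real.norm_eq_abs] at this
    simpa [abs_of_nonneg hG0] using this
  have hVT : 0 < V / (2 * T) := by positivity
  have hint : Integrable fun t : ℝ => G * Real.exp (-(V / (2 * T)) * (t - T) ^ 2) :=
    ((integrable_exp_neg_mul_sq hVT).comp_sub_right T).const_mul G
  have htot : ∫ t : ℝ, G * Real.exp (-(V / (2 * T)) * (t - T) ^ 2) =
      greenConst A * T ^ (-((d : ℝ) - 1) / 2) := by
    rw [integral_const_mul, integral_sub_right_eq_self (fun s => Real.exp (-(V / (2 * T)) * s ^ 2)) T,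
      integral_gaussian, ← gauss_total hT hV]
  have hcompl : (Set.Icc (T - b) (T + b))ᶜ = {t | b < |t - T|} := by
    ext t
    change ¬ (T - b ≤ t ∧ t ≤ T + b) ↔ b < |t - T|
    rw [← not_le, _root_.abs_le]
    constructor <;> intro h1 h2 <;> exact h1 ⟨by linarith [h2.1], by linarith [h2.2]⟩
  have hsplit := integral_add_compl (measurableSet_Icc (a := T - b) (b := T + b)) hint
  rw [htot, hcompl] at hsplit
  obtain ⟨i1, e1⟩ := integrableOn_abs_rpow_neg (p := 2) (by norm_num) hb0 T
  have hms : MeasurableSet {t : ℝ | b < |t - T|} := measurableSet_lt (by fun_prop) (by fun_prop)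
  have htail : ∫ t in {t | b < |t - T|}, G * Real.exp (-(V / (2 * T)) * (t - T) ^ 2) ≤
      G * (V / (2 * T))⁻¹ * (2 * b⁻¹) := by
    calc _ ≤ ∫ t in {t | b < |t - T|}, G * (V / (2 * T))⁻¹ * |t - T| ^ (-2 : ℝ) := by
          refine setIntegral_mono_on hint.integrableOn (i1.const_mul _) hms fun t ht => ?_
          rw [mul_assoc G (V / (2 * T))⁻¹]
          refine mul_le_mul_of_nonneg_left ?_ hG0
          rw [← sq_abs]
          exact exp_neg_mul_sq_le hVT (hb0.trans ht)
      _ = _ := by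
          rw [integral_const_mul, e1]
          norm_num
          left
          rw [Real.rpow_neg hb0.le, Real.rpow_one]
  have htail0 : 0 ≤ ∫ t in {t | b < |t - T|}, G * Real.exp (-(V / (2 * T)) * (t - T) ^ 2) :=
    integral_nonneg fun t => by positivity
  simp only [hgq]
  rw [integral_complex_ofReal, ← Complex.ofReal_sub, Complex.norm_real, ← hsplit, Real.norm_eq_abs,
    abs_sub_comm, add_sub_cancel_left, abs_of_nonneg htail0]
  have e2 : T ^ (-(d : ℝ) / 2) * √T = T ^ (-((d : ℝ) - 1) / 2) := by
    rw [Real.sqrt_eq_rpow, ← Real.rpow_add hT]; congr 1; ring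
  have hVinv : V⁻¹ ≤ M / c ^ 2 := by
    rw [← inv_div]; exact inv_anti₀ (by positivity) hVge
  have e3 : √T * √T = T := Real.mul_self_sqrt hT.le
  calc _ ≤ _ := htail
    _ = G * (4 * V⁻¹ / ℓ * √T) := by
        rw [hb]; field_simp; rw [Real.sq_sqrt hT.le]; ring
    _ ≤ ((Real.pi / K) ^ ((d : ℝ) / 2) * T ^ (-(d : ℝ) / 2)) * (4 * (M / c ^ 2) / ℓ * √T) := by gcongr
    _ = _ := by rw [← e2]; ring

lemma greenConst_nonneg (h : CritKernel M K ζ c A) (hM : 0 < M) (hK : 0 < K) (hζ : 0 < ζ)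
    (hζ1 : ζ ≤ 1) (hc : 0 < c) : 0 ≤ greenConst A := by
  have hV : 0 < invForm (secondMoment A) (firstMoment A) :=
    lt_of_lt_of_le (by positivity) (h.le_invForm hM hK hζ hζ1 hc)
  unfold greenConst; positivity

end CritKernel

/-- Asymptotics of the Green function along the drift, uniformly in the kernel. -/
lemma exists_green_sub_const_le (d : ℕ) [NeZero d] {M K ζ c : ℝ} (hM : 0 < M) (hK : 0 < K)
    (hζ : 0 < ζ) (hζ1 : ζ ≤ 1) (hc : 0 < c) {ε : ℝ} (hε : 0 < ε) :
    ∃ δ T₀ : ℝ, 0 < δ ∧ 1 ≤ T₀ ∧ ∀ A : Lat d → ℝ, CritKernel M K ζ c A → ∀ (T : ℝ) (z : Lat d),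
      T₀ ≤ T → ‖toVec z - T • firstMoment A‖ ≤ δ * √T →
      ‖green A z - ((greenConst A * T ^ (-((d : ℝ) - 1) / 2) : ℝ) : ℂ)‖ ≤
        ε * T ^ (-((d : ℝ) - 1) / 2) := by
  -- Half of `c` is given away because `z` may be `δ * √T` off the point `T η`.
  obtain ⟨ℓ₀, hℓ₀, hw⟩ := exists_green_sub_window_le d hM hK hζ hζ1 (half_pos hc)
    (show 0 < ε / 4 by positivity)
  obtain ⟨C₂, hC₂, hL⟩ := exists_heat_sub_gaussQ_le d hM hK hζ hζ1
  set C₃ : ℝ := (Real.pi / K) ^ ((d : ℝ) / 2) * (4 * (M / c ^ 2)) with hC₃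
  have hC₃0 : 0 < C₃ := by positivity
  set ℓ := max ℓ₀ (C₃ * 4 / ε) with hℓdef
  have hℓ1 : 1 ≤ ℓ := hℓ₀.trans (le_max_left _ _)
  have hℓ0 : 0 < ℓ := by linarith
  obtain ⟨T₁, hT₁, hw⟩ := hw ℓ (le_max_left _ _)
  -- The first bound preserves the separation from the drift off the window; the second keeps the
  -- offset error, multiplied by the window length `2 * ℓ * √T`, below a quarter of `ε`.
  set δ := min (c / 2) (ε / (8 * ℓ * C₂)) with hδ
  have hδ0 : 0 < δ := by positivity
  have hlim : Tendsto (fun T : ℝ => 2 * ℓ * C₂ * (T ^ (-(ζ / 2)) + (ℓ + 1) * T ^ (-(1 / 2) : ℝ))) atTop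
      (𝓝 (2 * ℓ * C₂ * (0 + (ℓ + 1) * 0))) :=
    (((tendsto_rpow_neg_atTop (half_pos hζ)).add
      ((tendsto_rpow_neg_atTop (by norm_num : (0 : ℝ) < 1 / 2)).const_mul _))).const_mul _
  rw [mul_zero, add_zero, mul_zero] at hlim
  obtain ⟨T₂, hT₂⟩ := eventually_atTop.mp (hlim.eventually (gt_mem_nhds (show 0 < ε / 4 by positivity)))
  refine ⟨δ, max T₁ T₂, hδ0, hT₁.trans (le_max_left _ _), fun A h T z hT hz => ?_⟩
  have hTT₁ : T₁ ≤ T := (le_max_left _ _).trans hT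
  have hT1 : 1 ≤ T := hT₁.trans hTT₁
  have hT0 : 0 < T := by linarith
  have hsq : 0 < √T := Real.sqrt_pos.mpr hT0
  have hη : 0 < ‖firstMoment A‖ := hc.trans_le h.drift_le
  obtain ⟨hbT, h1⟩ := hw c A h T z hTT₁ (by
    intro t ht hlt
    have e : toVec z - t • firstMoment A =
        (toVec z - T • firstMoment A) - (t - T) • firstMoment A := by
      rw [sub_smul]; abel
    have h2 : ‖(t - T) • firstMoment A‖ - ‖toVec z - T • firstMoment A‖ ≤
        ‖toVec z - t • firstMoment A‖ := by
      rw [e, norm_sub_rev (toVec z - T • firstMoment A)]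
      exact norm_sub_norm_le _ _
    rw [norm_smul, Real.norm_eq_abs] at h2
    have h3 : |t - T| * c ≤ |t - T| * ‖firstMoment A‖ :=
      mul_le_mul_of_nonneg_left h.drift_le (abs_nonneg _)
    have h4 : δ * √T ≤ c / 2 * |t - T| := by
      have : √T ≤ ℓ * √T := le_mul_of_one_le_left hsq.le hℓ1
      exact mul_le_mul (min_le_left _ _) (this.trans hlt.le) hsq.le (by positivity)
    linarith)
  set b := ℓ * √T with hb
  have hb0 : 0 < b := by positivity
  set P := T ^ (-((d : ℝ) - 1) / 2) with hP
  have hP0 : 0 < P := by positivity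
  set W := Set.Icc (T - b) (T + b)
  have h3 := h.norm_gauss_window_le hM hK hζ hζ1 hc hT0 hℓ0
  have h3' : (Real.pi / K) ^ ((d : ℝ) / 2) * (4 * (M / c ^ 2) / ℓ) * P ≤ ε / 4 * P := by
    refine mul_le_mul_of_nonneg_right ?_ hP0.le
    rw [← mul_div_assoc, div_le_iff₀ hℓ0]
    have : C₃ * 4 / ε ≤ ℓ := le_max_right _ _
    rw [div_le_iff₀ hε] at this
    linarith
  have hcq : Continuous fun t => gaussQ A T (t - T) := by
    have : (fun t => gaussQ A T (t - T)) = fun t => _ := funext fun t => h.gaussQ_eq hK hζ hζ1 hT0 (t - T)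
    rw [this]; fun_prop
  have h2 : ‖(∫ t in W, heat t A z) - ∫ t in W, gaussQ A T (t - T)‖ ≤ ε / 2 * P := by
    rw [← integral_sub ((continuous_heat h.summable z).continuousOn.integrableOn_compact isCompact_Icc)
      (hcq.continuousOn.integrableOn_compact isCompact_Icc)]
    have hpt : ∀ t ∈ W, ‖heat t A z - gaussQ A T (t - T)‖ ≤ C₂ * T ^ (-(d : ℝ) / 2) *
        (δ + T ^ (-(ζ / 2)) + (ℓ + 1) * T ^ (-(1 / 2) : ℝ)) := by
      intro t ⟨ht1, ht2⟩
      refine (hL c A h T t z hT1 (by linarith) (by linarith)).trans ?_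
      have habs : |t - T| ≤ b := abs_le.mpr ⟨by linarith, by linarith⟩
      have f1 : √T * T ^ (-(1 / 2) : ℝ) = 1 := by
        rw [Real.sqrt_eq_rpow, ← Real.rpow_add hT0]; norm_num
      have f2 : √T * T ^ (-1 : ℝ) = T ^ (-(1 / 2) : ℝ) := by
        rw [Real.sqrt_eq_rpow, ← Real.rpow_add hT0]; norm_num
      have g1 : ‖toVec z - T • firstMoment A‖ * T ^ (-(1 / 2) : ℝ) ≤ δ := by
        calc _ ≤ δ * √T * T ^ (-(1 / 2) : ℝ) := by gcongr
          _ = δ := by rw [mul_assoc, f1, mul_one]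
      have g2 : |t - T| * T ^ (-1 : ℝ) ≤ ℓ * T ^ (-(1 / 2) : ℝ) := by
        calc _ ≤ ℓ * √T * T ^ (-1 : ℝ) := by gcongr
          _ = _ := by rw [mul_assoc, f2]
      refine mul_le_mul_of_nonneg_left ?_ (by positivity)
      rw [neg_div]
      linarith
    have := norm_setIntegral_le_of_norm_le_const (μ := volume) (s := W) (by simp [W]) hpt
    refine this.trans ?_
    rw [Real.volume_real_Icc_of_le (by linarith)]
    have f3 : T ^ (-(d : ℝ) / 2) * √T = P := by
      rw [Real.sqrt_eq_rpow, ← Real.rpow_add hT0, hP]; congr 1; ring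
    have f4 : 2 * ℓ * C₂ * δ ≤ ε / 4 := by
      calc 2 * ℓ * C₂ * δ ≤ 2 * ℓ * C₂ * (ε / (8 * ℓ * C₂)) := by
            gcongr; exact min_le_right _ _
        _ = ε / 4 := by field_simp; norm_num
    have f5 := hT₂ T ((le_max_right _ _).trans hT)
    calc _ = (2 * ℓ * C₂ * δ + 2 * ℓ * C₂ * (T ^ (-(ζ / 2)) + (ℓ + 1) * T ^ (-(1 / 2) : ℝ))) *
          (T ^ (-(d : ℝ) / 2) * √T) := by rw [hb]; ring
      _ ≤ (ε / 4 + ε / 4) * P := by rw [f3]; gcongr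
      _ = _ := by ring
  calc _ = ‖(green A z - ∫ t in W, heat t A z) + ((∫ t in W, heat t A z) - ∫ t in W, gaussQ A T (t - T)) +
        ((∫ t in W, gaussQ A T (t - T)) - ((greenConst A * P : ℝ) : ℂ))‖ := by congr 1; ring
    _ ≤ ε / 4 * P + ε / 2 * P + ε / 4 * P :=
        (norm_add_le _ _).trans (add_le_add ((norm_add_le _ _).trans (add_le_add h1 h2)) (h3.trans h3'))
    _ = _ := by ring

namespace CritKernel

variable {d : ℕ} {M K ζ c : ℝ} {A : Lat d → ℝ}

/-- Read off from the Gaussian at `T = 1`: its amplitude is bounded by `norm_gaussQ_le`, so the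
determinant need not be estimated from below separately. -/
lemma greenConst_le (h : CritKernel M K ζ c A) (hM : 0 < M) (hK : 0 < K) (hζ : 0 < ζ)
    (hζ1 : ζ ≤ 1) (hc : 0 < c) :
    greenConst A ≤ (Real.pi / K) ^ ((d : ℝ) / 2) * √(2 * Real.pi * M / c ^ 2) := by
  have hVge := h.le_invForm hM hK hζ hζ1 hc
  have hV : 0 < invForm (secondMoment A) (firstMoment A) := lt_of_lt_of_le (by positivity) hVge
  have ht := gauss_total (A := A) one_pos hV
  rw [Real.one_rpow, mul_one] at ht
  have hG := h.norm_gaussQ_le hζ hζ1 hK one_pos 0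
  rw [h.gaussQ_eq hK hζ hζ1 one_pos, Complex.norm_real, Real.norm_eq_abs, Real.one_rpow, mul_one,
    zero_pow two_ne_zero, mul_zero, Real.exp_zero, mul_one] at hG
  rw [mul_one] at ht hG
  rw [← ht]
  refine mul_le_mul ((le_abs_self _).trans hG) (Real.sqrt_le_sqrt ?_) (Real.sqrt_nonneg _)
    (by positivity)
  have hVinv : (invForm (secondMoment A) (firstMoment A))⁻¹ ≤ M / c ^ 2 := by
    rw [← inv_div]; exact inv_anti₀ (by positivity) hVge
  calc _ = 2 * Real.pi * (invForm (secondMoment A) (firstMoment A))⁻¹ := by field_simp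
    _ ≤ 2 * Real.pi * (M / c ^ 2) := by gcongr
    _ = _ := by ring

end CritKernel

/-! ### Convolution of the source with the Green function -/

/-- The lattice points of the cube of radius `R`. -/
def box (d : ℕ) (R : ℝ) : Finset (Lat d) := Fintype.piFinset fun _ => Finset.Icc (-⌊R⌋) ⌊R⌋

lemma mem_box_of_norm_le {d : ℕ} {R : ℝ} {z : Lat d} (h : ‖toVec z‖ ≤ R) : z ∈ box d R := by
  refine Fintype.mem_piFinset.mpr fun j => ?_
  have h1 : |(z j : ℝ)| ≤ R := (PiLp.norm_apply_le (toVec z) j).trans h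
  rw [Finset.mem_Icc, ← abs_le, Int.le_floor]
  exact_mod_cast h1

lemma card_box_le (d : ℕ) {R : ℝ} (hR : 1 ≤ R) : ((box d R).card : ℝ) ≤ (3 * R) ^ d := by
  rw [box, Fintype.card_piFinset_const, Int.card_Icc]
  push_cast
  refine pow_le_pow_left₀ (by positivity) ?_ d
  have h0 : 0 ≤ ⌊R⌋ := Int.floor_nonneg.mpr (by linarith)
  have h1 : ((⌊R⌋ + 1 - -⌊R⌋).toNat : ℝ) = 2 * (⌊R⌋ : ℝ) + 1 := by
    have : (((⌊R⌋ + 1 - -⌊R⌋).toNat : ℤ) : ℝ) = ((2 * ⌊R⌋ + 1 : ℤ) : ℝ) := by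
      rw [Int.toNat_of_nonneg (by omega)]; congr 1; ring
    push_cast at this; exact this
  have := Int.floor_le R
  rw [h1]; linarith

/-- The box is split at radius `R ^ (3/5)`: inside, points are counted with weight at most one;
outside, the weight is bounded by its value on the small scale. The crude split suffices, and `3/5`
and `1/5` are matched so that both estimates are sharp in exponent for `d = 3`. -/
lemma sum_box_rpow_le (d : ℕ) [NeZero d] {R : ℝ} (hR : 1 ≤ R) :
    ∑ z ∈ box d R, (1 + ‖toVec z‖) ^ (-((d : ℝ) - 1)) ≤
      2 * 3 ^ d * R ^ (2 * ((max 2 (d - 1) : ℕ) : ℝ) - ((d : ℝ) - 1) - 1 / 5) := by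
  have hd : 1 ≤ d := NeZero.one_le
  have hd' : (1 : ℝ) ≤ d := by exact_mod_cast hd
  have hR0 : 0 < R := by linarith
  set r := R ^ (3 / 5 : ℝ) with hr
  have hr1 : 1 ≤ r := Real.one_le_rpow hR (by norm_num)
  have hr0 : 0 < r := by linarith
  set E := 2 * ((max 2 (d - 1) : ℕ) : ℝ) - ((d : ℝ) - 1) - 1 / 5 with hE
  have hN1 : (2 : ℝ) ≤ ((max 2 (d - 1) : ℕ) : ℝ) := by exact_mod_cast le_max_left _ _
  have hN2 : (d : ℝ) - 1 ≤ ((max 2 (d - 1) : ℕ) : ℝ) := by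
    have : d - 1 ≤ max 2 (d - 1) := le_max_right _ _
    have h2 : ((d - 1 : ℕ) : ℝ) = (d : ℝ) - 1 := by rw [Nat.cast_sub hd]; simp
    rw [← h2]; exact_mod_cast this
  have hcase : (d : ℝ) ≤ 3 ∨ (3 : ℝ) ≤ d := le_total _ _
  have hE1 : 3 / 5 * (d : ℝ) ≤ E := by rcases hcase with h | h <;> linarith
  have hE2 : (d : ℝ) - 3 / 5 * ((d : ℝ) - 1) ≤ E := by rcases hcase with h | h <;> linarith
  have hpt : ∀ z ∈ box d R, (1 + ‖toVec z‖) ^ (-((d : ℝ) - 1)) ≤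
      (if z ∈ box d r then 1 else 0) + r ^ (-((d : ℝ) - 1)) := by
    intro z _
    have hz := norm_nonneg (toVec z)
    by_cases hzr : ‖toVec z‖ ≤ r
    · rw [if_pos (mem_box_of_norm_le hzr)]
      have : (1 + ‖toVec z‖) ^ (-((d : ℝ) - 1)) ≤ 1 :=
        Real.rpow_le_one_of_one_le_of_nonpos (by linarith) (by linarith)
      have : 0 ≤ r ^ (-((d : ℝ) - 1)) := by positivity
      linarith
    · have h1 : (1 + ‖toVec z‖) ^ (-((d : ℝ) - 1)) ≤ r ^ (-((d : ℝ) - 1)) :=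
        Real.rpow_le_rpow_of_nonpos hr0 (by linarith [not_le.mp hzr]) (by linarith)
      split_ifs <;> linarith
  refine (Finset.sum_le_sum hpt).trans ?_
  rw [Finset.sum_add_distrib, Finset.sum_const, nsmul_eq_mul, Finset.sum_ite_mem, Finset.sum_const,
    nsmul_eq_mul, mul_one]
  have c1 : (((box d R ∩ box d r).card : ℕ) : ℝ) ≤ 3 ^ d * R ^ E := by
    calc (((box d R ∩ box d r).card : ℕ) : ℝ) ≤ ((box d r).card : ℝ) := by
          exact_mod_cast Finset.card_le_card Finset.inter_subset_right
      _ ≤ (3 * r) ^ d := card_box_le d hr1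
      _ = 3 ^ d * R ^ (3 / 5 * (d : ℝ)) := by
          rw [mul_pow, ← Real.rpow_natCast r, hr, ← Real.rpow_mul hR0.le]
      _ ≤ _ := by gcongr
  have c2 : ((box d R).card : ℝ) * r ^ (-((d : ℝ) - 1)) ≤ 3 ^ d * R ^ E := by
    calc _ ≤ (3 * R) ^ d * r ^ (-((d : ℝ) - 1)) := by gcongr; exact card_box_le d hR
      _ = 3 ^ d * R ^ ((d : ℝ) - 3 / 5 * ((d : ℝ) - 1)) := by
          rw [mul_pow, mul_assoc, ← Real.rpow_natCast R, hr, ← Real.rpow_mul hR0.le, ← Real.rpow_add hR0]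
          congr 2; ring
      _ ≤ _ := by gcongr
  linarith

/-- Moment bounds for the source term: an `ℓ¹` moment of order `ζ`, and an `ℓ²` moment. -/
structure SourceKernel {d : ℕ} (M ζ : ℝ) (g : Lat d → ℝ) : Prop where
  summable : Summable g
  abs_le : ∑' y, |g y| ≤ M
  mom_summable : Summable fun y => ‖toVec y‖ ^ ζ * |g y|
  mom_le : ∑' y, ‖toVec y‖ ^ ζ * |g y| ≤ M
  sq_summable : Summable fun y => (‖toVec y‖ ^ (max 2 (d - 1)) * g y) ^ 2
  sq_le : ∑' y, (‖toVec y‖ ^ (max 2 (d - 1)) * g y) ^ 2 ≤ M ^ 2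

/-- When `z` is within half the distance to `x`, the jump `x - z` is at least `R` long. Pulling out
its weight and applying Cauchy–Schwarz with the `ℓ²` moment beats the target scale by `R ^ (-1/10)`.
-/
lemma SourceKernel.sum_near_le {d : ℕ} [NeZero d] {M ζ : ℝ} {g : Lat d → ℝ} (hg : SourceKernel M ζ g)
    (hM : 0 < M) (x : Lat d) {R : ℝ} (hR : 1 ≤ R) (hx : ‖toVec x‖ = 2 * R) :
    ∑ z ∈ (box d R).filter (fun z => ‖toVec z‖ < R),
      |g (x - z)| * (1 + ‖toVec z‖) ^ (-((d : ℝ) - 1) / 2) ≤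
      √(2 * 3 ^ d) * M * R ^ (-((d : ℝ) - 1) / 2 - 1 / 10) := by
  have hR0 : 0 < R := by linarith
  set N := max 2 (d - 1) with hN
  set F := (box d R).filter (fun z => ‖toVec z‖ < R) with hF
  set G : Lat d → ℝ := fun z => ‖toVec (x - z)‖ ^ N * |g (x - z)| with hGdef
  set w : Lat d → ℝ := fun z => (1 + ‖toVec z‖) ^ (-((d : ℝ) - 1) / 2) with hw
  have hw0 : ∀ z, 0 ≤ w z := fun z => by positivity
  have h1 : ∀ z ∈ F, |g (x - z)| * w z ≤ R ^ (-(N : ℝ)) * (G z * w z) := by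
    intro z hz
    have hzR : ‖toVec z‖ < R := (Finset.mem_filter.mp hz).2
    have h2 : R ≤ ‖toVec (x - z)‖ := by
      rw [toVec_sub]
      linarith [norm_sub_norm_le (toVec x) (toVec z)]
    rw [← mul_assoc]
    refine mul_le_mul_of_nonneg_right ?_ (hw0 z)
    have h3 : R ^ N ≤ ‖toVec (x - z)‖ ^ N := pow_le_pow_left₀ hR0.le h2 N
    rw [Real.rpow_neg hR0.le, Real.rpow_natCast, inv_mul_eq_div, le_div_iff₀ (by positivity), mul_comm]
    exact mul_le_mul_of_nonneg_right h3 (abs_nonneg _)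
  have h2 : ∑ z ∈ F, G z ^ 2 ≤ M ^ 2 := by
    refine le_trans ?_ hg.sq_le
    have hs : Summable fun z => (‖toVec (x - z)‖ ^ N * g (x - z)) ^ 2 :=
      (Equiv.subLeft x).summable_iff.mpr hg.sq_summable
    have he : ∑' z, (‖toVec (x - z)‖ ^ N * g (x - z)) ^ 2 = ∑' y, (‖toVec y‖ ^ N * g y) ^ 2 :=
      (Equiv.subLeft x).tsum_eq (fun y => (‖toVec y‖ ^ N * g y) ^ 2)
    rw [← he]
    calc ∑ z ∈ F, G z ^ 2 = ∑ z ∈ F, (‖toVec (x - z)‖ ^ N * g (x - z)) ^ 2 :=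
          Finset.sum_congr rfl fun z _ => by rw [hGdef]; simp only [mul_pow, sq_abs]
      _ ≤ _ := hs.sum_le_tsum F fun z _ => sq_nonneg _
  have h3 : ∑ z ∈ F, w z ^ 2 ≤ 2 * 3 ^ d * R ^ (2 * (N : ℝ) - ((d : ℝ) - 1) - 1 / 5) := by
    refine le_trans ?_ (sum_box_rpow_le d hR)
    calc ∑ z ∈ F, w z ^ 2 ≤ ∑ z ∈ box d R, w z ^ 2 :=
          Finset.sum_le_sum_of_subset_of_nonneg (Finset.filter_subset _ _) fun z _ _ => sq_nonneg _
      _ = _ := Finset.sum_congr rfl fun z _ => by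
          rw [hw]
          simp only
          rw [← Real.rpow_natCast, ← Real.rpow_mul (by positivity)]
          congr 1; push_cast; ring
  calc ∑ z ∈ F, |g (x - z)| * w z ≤ ∑ z ∈ F, R ^ (-(N : ℝ)) * (G z * w z) := Finset.sum_le_sum h1
    _ = R ^ (-(N : ℝ)) * ∑ z ∈ F, G z * w z := by rw [Finset.mul_sum]
    _ ≤ R ^ (-(N : ℝ)) * (√(∑ z ∈ F, G z ^ 2) * √(∑ z ∈ F, w z ^ 2)) := by
        exact mul_le_mul_of_nonneg_left (Real.sum_mul_le_sqrt_mul_sqrt F G w)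
          (Real.rpow_nonneg hR0.le _)
    _ ≤ R ^ (-(N : ℝ)) * (√(M ^ 2) * √(2 * 3 ^ d * R ^ (2 * (N : ℝ) - ((d : ℝ) - 1) - 1 / 5))) := by
        refine mul_le_mul_of_nonneg_left ?_ (Real.rpow_nonneg hR0.le _)
        exact mul_le_mul (Real.sqrt_le_sqrt h2) (Real.sqrt_le_sqrt h3) (Real.sqrt_nonneg _)
          (Real.sqrt_nonneg _)
    _ = √(2 * 3 ^ d) * M * (R ^ (-(N : ℝ)) * √(R ^ (2 * (N : ℝ) - ((d : ℝ) - 1) - 1 / 5))) := by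
        rw [Real.sqrt_sq hM.le, Real.sqrt_mul (by positivity)]; ring
    _ = _ := by
        rw [Real.sqrt_eq_rpow (R ^ _), ← Real.rpow_mul hR0.le, ← Real.rpow_add hR0]
        congr 2; ring

set_option maxHeartbeats 1000000 in
/-- Asymptotics of the convolution of a source with the Green function, along the drift. -/
lemma exists_tsum_mul_green_sub_le (d : ℕ) [NeZero d] {M K ζ c : ℝ} (hM : 0 < M) (hK : 0 < K)
    (hζ : 0 < ζ) (hζ1 : ζ ≤ 1) (hc : 0 < c) {ε : ℝ} (hε : 0 < ε) :
    ∃ T₀ : ℝ, 1 ≤ T₀ ∧ ∀ A g : Lat d → ℝ, CritKernel M K ζ c A → SourceKernel M ζ g →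
      ∀ (T : ℝ) (x : Lat d), T₀ ≤ T → toVec x = T • firstMoment A →
      ‖∑' y, (g y : ℂ) * green A (x - y) -
          ((greenConst A * T ^ (-((d : ℝ) - 1) / 2) * ∑' y, g y : ℝ) : ℂ)‖ ≤
        ε * T ^ (-((d : ℝ) - 1) / 2) := by
  obtain ⟨δ, T₁, hδ, hT₁, hb⟩ := exists_green_sub_const_le d hM hK hζ hζ1 hc
    (show 0 < ε / (2 * M) by positivity)
  obtain ⟨C, hC, ha⟩ := exists_green_le d hM hK hζ hζ1 hc
  set Γ : ℝ := (Real.pi / K) ^ ((d : ℝ) / 2) * √(2 * Real.pi * M / c ^ 2) with hΓ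
  have hΓ0 : 0 < Γ := by positivity
  set C₁ : ℝ := C * (c / 2) ^ (-((d : ℝ) - 1) / 2) + Γ with hC₁
  have hC₁0 : 0 < C₁ := by positivity
  set C₂ : ℝ := C * (√(2 * 3 ^ d) * M * (c / 2) ^ (-((d : ℝ) - 1) / 2 - 1 / 10)) with hC₂
  have hlim : Tendsto (fun T : ℝ => C₁ * δ ^ (-ζ) * M * T ^ (-(ζ / 2)) + C₂ * T ^ (-(1 / 10) : ℝ)) atTop
      (𝓝 (C₁ * δ ^ (-ζ) * M * 0 + C₂ * 0)) :=
    ((tendsto_rpow_neg_atTop (half_pos hζ)).const_mul _).add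
      ((tendsto_rpow_neg_atTop (by norm_num : (0 : ℝ) < 1 / 10)).const_mul _)
  rw [mul_zero, mul_zero, add_zero] at hlim
  obtain ⟨T₂, hT₂⟩ := eventually_atTop.mp (hlim.eventually (gt_mem_nhds (half_pos hε)))
  refine ⟨max T₁ (max T₂ (2 / c)), hT₁.trans (le_max_left _ _), fun A g h hg T x hT hx => ?_⟩
  have hTT₁ : T₁ ≤ T := (le_max_left _ _).trans hT
  have hT1 : 1 ≤ T := hT₁.trans hTT₁
  have hT0 : 0 < T := by linarith
  have hsq : 0 < √T := Real.sqrt_pos.mpr hT0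
  have hTc : 2 / c ≤ T := (le_max_right _ _).trans ((le_max_right _ _).trans hT)
  set R := ‖toVec x‖ / 2 with hRdef
  have hRge : c / 2 * T ≤ R := by
    rw [hRdef, hx, norm_smul, Real.norm_of_nonneg hT0.le]
    have := mul_le_mul_of_nonneg_left h.drift_le hT0.le
    linarith
  have hR1 : 1 ≤ R := by
    rw [div_le_iff₀ hc] at hTc
    linarith
  have hR0 : 0 < R := by linarith
  have hd' : (1 : ℝ) ≤ d := by exact_mod_cast (NeZero.one_le : 1 ≤ d)
  set P := T ^ (-((d : ℝ) - 1) / 2) with hP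
  have hP0 : 0 < P := by positivity
  have hg0 := h.greenConst_nonneg hM hK hζ hζ1 hc
  have hgΓ : greenConst A ≤ Γ := h.greenConst_le hM hK hζ hζ1 hc
  set D : Lat d → ℂ := fun z => green A z - ((greenConst A * P : ℝ) : ℂ) with hD
  set F := (box d R).filter (fun z => ‖toVec z‖ < R) with hF
  set w : Lat d → ℝ := fun z => (1 + ‖toVec z‖) ^ (-((d : ℝ) - 1) / 2) with hw
  have hw0 : ∀ z, 0 ≤ w z := fun z => by positivity
  have hDle : ∀ z, ‖D z‖ ≤ C * w z + Γ * P := by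
    intro z
    refine (norm_sub_le _ _).trans (add_le_add (ha A h z) ?_)
    rw [Complex.norm_real, Real.norm_of_nonneg (by positivity)]
    gcongr
  have hRP : ∀ z, z ∉ F → C * w z + Γ * P ≤ C₁ * P := by
    intro z hz
    have hzR : R ≤ ‖toVec z‖ := by
      by_contra hlt
      exact hz (Finset.mem_filter.mpr ⟨mem_box_of_norm_le (not_le.mp hlt).le, not_le.mp hlt⟩)
    have : w z ≤ (c / 2) ^ (-((d : ℝ) - 1) / 2) * P := by
      rw [hP, ← Real.mul_rpow (by positivity) hT0.le]
      exact Real.rpow_le_rpow_of_nonpos (by positivity) (by linarith) (by linarith)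
    calc _ ≤ C * ((c / 2) ^ (-((d : ℝ) - 1) / 2) * P) + Γ * P := by gcongr
      _ = _ := by rw [hC₁]; ring
  -- The summands cover jumps shorter than `δ * √T`, where the asymptotics hold; longer jumps, by
  -- the moment of order `ζ`; and long jumps landing near the origin, where the Green function
  -- exceeds the scale `P`.
  set B : Lat d → ℝ := fun z => ε / (2 * M) * P * |g (x - z)| +
    C₁ * P * (δ * √T) ^ (-ζ) * (‖toVec (x - z)‖ ^ ζ * |g (x - z)|) +
    (if z ∈ F then C * (|g (x - z)| * w z) else 0) with hB
  have hbound : ∀ z, ‖(g (x - z) : ℂ) * D z‖ ≤ B z := by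
    intro z
    rw [norm_mul, Complex.norm_real, Real.norm_eq_abs]
    simp only [hB]
    have n1 : 0 ≤ ε / (2 * M) * P * |g (x - z)| := by positivity
    have n2 : 0 ≤ C₁ * P * (δ * √T) ^ (-ζ) * (‖toVec (x - z)‖ ^ ζ * |g (x - z)|) := by positivity
    have n3 : 0 ≤ (if z ∈ F then C * (|g (x - z)| * w z) else 0) := by
      split_ifs
      · exact mul_nonneg hC.le (mul_nonneg (abs_nonneg _) (hw0 z))
      · exact le_rfl
    by_cases hy : ‖toVec (x - z)‖ ≤ δ * √T
    · have : ‖D z‖ ≤ ε / (2 * M) * P := by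
        refine hb A h T z hTT₁ ?_
        rw [← hx, norm_sub_rev, ← toVec_sub]; exact hy
      have := mul_le_mul_of_nonneg_left this (abs_nonneg (g (x - z)))
      linarith
    · have hy := not_le.mp hy
      have hmom : |g (x - z)| ≤ (δ * √T) ^ (-ζ) * (‖toVec (x - z)‖ ^ ζ * |g (x - z)|) := by
        rw [← mul_assoc]
        refine le_mul_of_one_le_left (abs_nonneg _) ?_
        rw [Real.rpow_neg (by positivity), inv_mul_eq_div, one_le_div (by positivity)]
        exact Real.rpow_le_rpow (by positivity) hy.le hζ.le
      by_cases hz : z ∈ F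
      · rw [if_pos hz]
        have h1 := mul_le_mul_of_nonneg_left (hDle z) (abs_nonneg (g (x - z)))
        have h2 : |g (x - z)| * (Γ * P) ≤ C₁ * P * (δ * √T) ^ (-ζ) * (‖toVec (x - z)‖ ^ ζ * |g (x - z)|) := by
          rw [mul_assoc (C₁ * P), mul_comm]
          have : Γ ≤ C₁ := le_add_of_nonneg_left (by positivity)
          gcongr
        linarith
      · have h1 := mul_le_mul_of_nonneg_left ((hDle z).trans (hRP z hz)) (abs_nonneg (g (x - z)))
        have h2 : |g (x - z)| * (C₁ * P) ≤ C₁ * P * (δ * √T) ^ (-ζ) * (‖toVec (x - z)‖ ^ ζ * |g (x - z)|) := by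
          rw [mul_assoc (C₁ * P), mul_comm]
          gcongr
        linarith
  have s1 : HasSum (fun z => |g (x - z)|) (∑' y, |g y|) :=
    (Equiv.subLeft x).hasSum_iff.mpr hg.summable.abs.hasSum
  have s2 : HasSum (fun z => ‖toVec (x - z)‖ ^ ζ * |g (x - z)|) (∑' y, ‖toVec y‖ ^ ζ * |g y|) :=
    (Equiv.subLeft x).hasSum_iff.mpr hg.mom_summable.hasSum
  have s3 : HasSum (fun z => if z ∈ F then C * (|g (x - z)| * w z) else 0)
      (∑ z ∈ F, C * (|g (x - z)| * w z)) := by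
    have := hasSum_sum_of_ne_finset_zero (L := SummationFilter.unconditional _) (s := F)
      (f := fun z => if z ∈ F then C * (|g (x - z)| * w z) else 0) (fun z hz => if_neg hz)
    rwa [Finset.sum_congr rfl fun z hz => if_pos hz] at this
  have hBsum := ((s1.mul_left (ε / (2 * M) * P)).add (s2.mul_left (C₁ * P * (δ * √T) ^ (-ζ)))).add s3
  have s4 : HasSum (fun z => g (x - z)) (∑' y, g y) :=
    (Equiv.subLeft x).hasSum_iff.mpr hg.summable.hasSum
  have s5 : Summable fun z => (g (x - z) : ℂ) * D z :=
    Summable.of_norm_bounded hBsum.summable hbound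
  have s6 : HasSum (fun z => (g (x - z) : ℂ) * ((greenConst A * P : ℝ) : ℂ))
      ((greenConst A * P * ∑' y, g y : ℝ) : ℂ) := by
    have := Complex.hasSum_ofReal.mpr (s4.mul_right (greenConst A * P))
    simp only [Complex.ofReal_mul] at this ⊢
    rwa [mul_comm _ ((∑' y, g y : ℝ) : ℂ)]
  have heq : ∑' y, (g y : ℂ) * green A (x - y) =
      ∑' z, (g (x - z) : ℂ) * D z + ((greenConst A * P * ∑' y, g y : ℝ) : ℂ) := by
    rw [← (Equiv.subLeft x).tsum_eq, ← s6.tsum_eq,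
      ← Summable.tsum_add (L := SummationFilter.unconditional _) s5 s6.summable]
    refine tsum_congr fun z => ?_
    simp only [Equiv.subLeft_apply, sub_sub_cancel, hD]
    ring
  rw [heq, add_sub_cancel_right]
  refine (tsum_of_norm_bounded hBsum hbound).trans ?_
  have hRpow : R ^ (-((d : ℝ) - 1) / 2 - 1 / 10) ≤
      (c / 2) ^ (-((d : ℝ) - 1) / 2 - 1 / 10) * (P * T ^ (-(1 / 10) : ℝ)) := by
    rw [hP, ← Real.rpow_add hT0, ← sub_eq_add_neg, ← Real.mul_rpow (by positivity) hT0.le]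
    exact Real.rpow_le_rpow_of_nonpos (by positivity) hRge (by linarith)
  have b3 : ∑ z ∈ F, C * (|g (x - z)| * w z) ≤ C₂ * T ^ (-(1 / 10) : ℝ) * P := by
    rw [← Finset.mul_sum]
    calc _ ≤ C * (√(2 * 3 ^ d) * M * R ^ (-((d : ℝ) - 1) / 2 - 1 / 10)) := by
          exact mul_le_mul_of_nonneg_left (hg.sum_near_le hM x hR1 (by rw [hRdef]; ring)) hC.le
      _ ≤ C * (√(2 * 3 ^ d) * M * ((c / 2) ^ (-((d : ℝ) - 1) / 2 - 1 / 10) * (P * T ^ (-(1 / 10) : ℝ)))) :=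
          mul_le_mul_of_nonneg_left (mul_le_mul_of_nonneg_left hRpow (by positivity)) hC.le
      _ = _ := by rw [hC₂]; ring
  have b2 : C₁ * P * (δ * √T) ^ (-ζ) * ∑' y, ‖toVec y‖ ^ ζ * |g y| ≤
      C₁ * δ ^ (-ζ) * M * T ^ (-(ζ / 2)) * P := by
    have e : (δ * √T) ^ (-ζ) = δ ^ (-ζ) * T ^ (-(ζ / 2)) := by
      rw [Real.mul_rpow hδ.le hsq.le, Real.sqrt_eq_rpow, ← Real.rpow_mul hT0.le]
      congr 2; ring
    calc _ ≤ C₁ * P * (δ * √T) ^ (-ζ) * M := by exact mul_le_mul_of_nonneg_left hg.mom_le (by positivity)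
      _ = _ := by rw [e]; ring
  have b1 : ε / (2 * M) * P * ∑' y, |g y| ≤ ε / 2 * P := by
    calc _ ≤ ε / (2 * M) * P * M := by exact mul_le_mul_of_nonneg_left hg.abs_le (by positivity)
      _ = _ := by field_simp
  have hfin := hT₂ T ((le_max_left _ _).trans ((le_max_right _ _).trans hT))
  have := mul_le_mul_of_nonneg_right hfin.le hP0.le
  linarith

/-! ### Taylor expansion of the mass along a segment of tilts -/

lemma exp_convex_le {a b s : ℝ} (hs : s ∈ Set.Icc (0 : ℝ) 1) :
    Real.exp (a + s * (b - a)) ≤ (1 - s) * Real.exp a + s * Real.exp b := by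
  have := convexOn_exp.2 (Set.mem_univ a) (Set.mem_univ b) (sub_nonneg.mpr hs.2) hs.1 (by ring)
  simp only [smul_eq_mul] at this
  refine le_trans (le_of_eq ?_) this
  congr 1; ring

/-- Convexity of the exponential: tilts along a segment are dominated by those at its ends. This
gives dominated convergence and convexity of the domain. -/
lemma abs_tilt_segment_le {d : ℕ} (f : Lat d → ℝ) (μ ν : Vec d) {s : ℝ} (hs : s ∈ Set.Icc (0 : ℝ) 1)
    (y : Lat d) :
    |tilt f (μ + s • (ν - μ)) y| ≤ (1 - s) * |tilt f μ y| + s * |tilt f ν y| := by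
  simp only [tilt, abs_mul, Real.abs_exp]
  have := mul_le_mul_of_nonneg_left (exp_convex_le (a := inner ℝ μ (toVec y))
    (b := inner ℝ ν (toVec y)) hs) (abs_nonneg (f y))
  rw [inner_add_left, real_inner_smul_left, inner_sub_left]
  linarith

lemma abs_tilt_segment_le_add {d : ℕ} (f : Lat d → ℝ) (μ ν : Vec d) {s : ℝ}
    (hs : s ∈ Set.Icc (0 : ℝ) 1) (y : Lat d) :
    |tilt f (μ + s • (ν - μ)) y| ≤ |tilt f μ y| + |tilt f ν y| := by
  refine (abs_tilt_segment_le f μ ν hs y).trans (add_le_add ?_ ?_)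
  · exact mul_le_of_le_one_left (abs_nonneg _) (by linarith [hs.1])
  · exact mul_le_of_le_one_left (abs_nonneg _) hs.2

lemma integral_exp_taylor (b : ℝ) :
    ∫ s in (0 : ℝ)..1, (1 - s) * (b ^ 2 * Real.exp (s * b)) = Real.exp b - b - 1 := by
  have hd : ∀ s ∈ Set.uIcc (0 : ℝ) 1, HasDerivAt (fun s : ℝ => ((1 - s) * b + 1) * Real.exp (s * b))
      ((1 - s) * (b ^ 2 * Real.exp (s * b))) s := by
    intro s _
    have h1 : HasDerivAt (fun s : ℝ => (1 - s) * b + 1) (-1 * b) s :=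
      (((hasDerivAt_id s).const_sub 1).mul_const b).add_const 1
    have h2 : HasDerivAt (fun s : ℝ => Real.exp (s * b)) (Real.exp (s * b) * (1 * b)) s :=
      ((hasDerivAt_id s).mul_const b).exp
    refine (h1.mul h2).congr_deriv ?_
    ring
  rw [intervalIntegral.integral_eq_sub_of_hasDerivAt hd (Continuous.intervalIntegrable (by fun_prop) _ _)]
  simp
  ring

section Taylor

variable {d : ℕ} {J : Lat d → ℝ} {μ ν : Vec d}

lemma term_segment_le {s : ℝ} (hs : s ∈ Set.Icc (0 : ℝ) 1) (v : Vec d) (y : Lat d) :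
    ‖(1 - s) * ((inner ℝ v (toVec y) : ℝ) ^ 2 * tilt J (μ + s • (ν - μ)) y)‖ ≤
      ‖v‖ ^ 2 * (‖toVec y‖ ^ 2 * |tilt J μ y| + ‖toVec y‖ ^ 2 * |tilt J ν y|) := by
  rw [norm_mul, norm_mul, Real.norm_eq_abs, Real.norm_eq_abs, Real.norm_eq_abs, abs_pow,
    abs_of_nonneg (sub_nonneg.mpr hs.2), ← mul_add, ← mul_assoc (‖v‖ ^ 2), ← mul_pow]
  have h1 : |(inner ℝ v (toVec y) : ℝ)| ^ 2 ≤ (‖v‖ * ‖toVec y‖) ^ 2 :=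
    pow_le_pow_left₀ (abs_nonneg _) (abs_inner_toVec_le v y) 2
  refine (mul_le_of_le_one_left (by positivity) (by linarith [hs.1])).trans ?_
  exact mul_le_mul h1 (abs_tilt_segment_le_add J μ ν hs y) (abs_nonneg _) (by positivity)

lemma continuous_tilt_segment (v : Vec d) (y : Lat d) : Continuous fun s : ℝ =>
    (1 - s) * ((inner ℝ v (toVec y) : ℝ) ^ 2 * tilt J (μ + s • (ν - μ)) y) := by
  simp only [tilt]
  fun_prop

/-- Second-order Taylor formula for the total mass of the tilts of a kernel. -/
lemma tsum_tilt_taylor (hμ : Summable (tilt J μ)) (hν : Summable (tilt J ν))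
    (hμ2 : Summable fun y => ‖toVec y‖ ^ 2 * |tilt J μ y|)
    (hν2 : Summable fun y => ‖toVec y‖ ^ 2 * |tilt J ν y|) :
    ∑' y, tilt J ν y = ∑' y, tilt J μ y + inner ℝ (firstMoment (tilt J μ)) (ν - μ) +
      ∫ s in (0 : ℝ)..1, (1 - s) * quadForm (tilt J (μ + s • (ν - μ))) (ν - μ) := by
  set v := ν - μ with hv
  have hsum := (hμ2.add hν2).mul_left (‖v‖ ^ 2)
  have hIoc : Set.uIoc (0 : ℝ) 1 ⊆ Set.Icc 0 1 := by
    rw [Set.uIoc_of_le zero_le_one]; exact Set.Ioc_subset_Icc_self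
  -- The exponential is expanded term by term with integral remainder and then summed, so the mass
  -- is never differentiated and both ends may lie on the boundary.
  have H := intervalIntegral.hasSum_integral_of_dominated_convergence (a := (0 : ℝ)) (b := 1)
    (μ := volume)
    (F := fun y s => (1 - s) * ((inner ℝ v (toVec y) : ℝ) ^ 2 * tilt J (μ + s • v) y))
    (f := fun s => (1 - s) * quadForm (tilt J (μ + s • v)) v)
    (fun y _ => ‖v‖ ^ 2 * (‖toVec y‖ ^ 2 * |tilt J μ y| + ‖toVec y‖ ^ 2 * |tilt J ν y|))
    (fun y => (continuous_tilt_segment v y).aestronglyMeasurable)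
    (fun y => .of_forall fun s hs => term_segment_le (hIoc hs) v y)
    (.of_forall fun s _ => hsum) intervalIntegrable_const
    (.of_forall fun s hs => by
      have hs' := hIoc hs
      refine HasSum.mul_left _ ?_
      refine (summable_sq_inner_mul ?_ v).hasSum
      refine Summable.of_nonneg_of_le (fun y => by positivity) (fun y => ?_) (hμ2.add hν2)
      rw [← mul_add]
      exact mul_le_mul_of_nonneg_left (abs_tilt_segment_le_add J μ ν hs' y) (by positivity))
  have hterm : ∀ y, ∫ s in (0 : ℝ)..1, (1 - s) * ((inner ℝ v (toVec y) : ℝ) ^ 2 * tilt J (μ + s • v) y) =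
      tilt J ν y - tilt J μ y - inner ℝ v (toVec y) * tilt J μ y := by
    intro y
    set b : ℝ := inner ℝ v (toVec y) with hb
    have e : ∀ s : ℝ, (1 - s) * (b ^ 2 * tilt J (μ + s • v) y) =
        tilt J μ y * ((1 - s) * (b ^ 2 * Real.exp (s * b))) := by
      intro s
      rw [tilt, tilt, inner_add_left, real_inner_smul_left, Real.exp_add]; ring
    have e2 : tilt J ν y = tilt J μ y * Real.exp b := by
      rw [tilt, tilt, mul_assoc, ← Real.exp_add, hb, hv, inner_sub_left, add_sub_cancel]
    simp only [e]
    rw [intervalIntegral.integral_const_mul, integral_exp_taylor, e2]; ring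
  simp only [hterm] at H
  have h1 : Summable fun y => ‖toVec y‖ * |tilt J μ y| := by
    have := summable_norm_mul (f := tilt J μ) (p := 1) (q := 2) one_pos (by norm_num)
      (by simpa only [Real.rpow_two] using hμ2)
    simpa only [Real.rpow_one] using this
  have H2 := (hν.hasSum.sub hμ.hasSum).sub (summable_inner_mul h1 v).hasSum
  have := H.unique H2
  rw [← inner_firstMoment h1, real_inner_comm] at this
  linarith

lemma integral_segment_bounds (hμ2 : Summable fun y => ‖toVec y‖ ^ 2 * |tilt J μ y|)
    (hν2 : Summable fun y => ‖toVec y‖ ^ 2 * |tilt J ν y|) {a b : ℝ}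
    (ha : ∀ s ∈ Set.Icc (0 : ℝ) 1, a ≤ quadForm (tilt J (μ + s • (ν - μ))) (ν - μ))
    (hb : ∀ s ∈ Set.Icc (0 : ℝ) 1, quadForm (tilt J (μ + s • (ν - μ))) (ν - μ) ≤ b) :
    a / 2 ≤ ∫ s in (0 : ℝ)..1, (1 - s) * quadForm (tilt J (μ + s • (ν - μ))) (ν - μ) ∧
      ∫ s in (0 : ℝ)..1, (1 - s) * quadForm (tilt J (μ + s • (ν - μ))) (ν - μ) ≤ b / 2 := by
  have hc : ContinuousOn (fun s : ℝ => (1 - s) * quadForm (tilt J (μ + s • (ν - μ))) (ν - μ))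
      (Set.Icc 0 1) := by
    simp only [quadForm, ← tsum_mul_left]
    exact continuousOn_tsum (fun y => (continuous_tilt_segment (ν - μ) y).continuousOn)
      ((hμ2.add hν2).mul_left (‖ν - μ‖ ^ 2)) fun y s hs => term_segment_le hs _ y
  have hi := hc.intervalIntegrable_of_Icc (μ := volume) zero_le_one
  have hlin : ∀ a : ℝ, ∫ s in (0 : ℝ)..1, (1 - s) * a = a / 2 := by
    intro a
    rw [intervalIntegral.integral_mul_const, intervalIntegral.integral_sub (by simp) (by simp)]
    simp; ring
  have hil : ∀ a : ℝ, IntervalIntegrable (fun s : ℝ => (1 - s) * a) volume 0 1 :=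
    fun a => Continuous.intervalIntegrable (by fun_prop) _ _
  rw [← hlin a, ← hlin b]
  exact ⟨intervalIntegral.integral_mono_on zero_le_one (hil a) hi fun s hs =>
      mul_le_mul_of_nonneg_left (ha s hs) (sub_nonneg.mpr hs.2),
    intervalIntegral.integral_mono_on zero_le_one hi (hil b) fun s hs =>
      mul_le_mul_of_nonneg_left (hb s hs) (sub_nonneg.mpr hs.2)⟩

end Taylor

/-! Membership in the spaces `ℓ^p` of the lattice. -/

lemma ellNorm_rpow_eq {d : ℕ} {p : ℝ} (hp : 0 < p) (f : Lat d → ℝ) :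
    ellNorm p f = (∑' y, ENNReal.ofReal (|f y| ^ p)) ^ (1 / p) := by
  rw [ellNorm, eLpNorm_eq_lintegral_rpow_enorm_toReal (by simpa using hp) ENNReal.ofReal_ne_top,
    lintegral_count, ENNReal.toReal_ofReal hp.le]
  congr 1
  refine tsum_congr fun y => ?_
  rw [← ofReal_norm, Real.norm_eq_abs, ENNReal.ofReal_rpow_of_nonneg (abs_nonneg _) hp.le]

lemma summable_rpow_of_ellNorm_le {d : ℕ} {p M : ℝ} (hp : 0 < p) (hM : 0 ≤ M) {f : Lat d → ℝ}
    (h : ellNorm p f ≤ ENNReal.ofReal M) :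
    Summable (fun y => |f y| ^ p) ∧ ∑' y, |f y| ^ p ≤ M ^ p := by
  rw [ellNorm_rpow_eq hp, one_div, ENNReal.rpow_inv_le_iff hp,
    ENNReal.ofReal_rpow_of_nonneg hM hp.le] at h
  have h0 : ∀ y, 0 ≤ |f y| ^ p := fun y => by positivity
  have hs : Summable fun y => |f y| ^ p := by
    have := ENNReal.summable_toReal (ne_top_of_le_ne_top ENNReal.ofReal_ne_top h)
    simpa only [ENNReal.toReal_ofReal (h0 _)] using this
  refine ⟨hs, ?_⟩
  rw [← ENNReal.ofReal_tsum_of_nonneg h0 hs] at h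
  exact (ENNReal.ofReal_le_ofReal_iff (by positivity)).mp h

lemma summable_abs_of_ellNorm_one_le {d : ℕ} {M : ℝ} (hM : 0 ≤ M) {f : Lat d → ℝ}
    (h : ellNorm 1 f ≤ ENNReal.ofReal M) : Summable (fun y => |f y|) ∧ ∑' y, |f y| ≤ M := by
  simpa only [Real.rpow_one] using summable_rpow_of_ellNorm_le one_pos hM h

/-- The norm of `ℓ²` is bounded by the norm of `ℓ^p` for `p ≤ 2`. -/
lemma summable_sq_of_ellNorm_le {d : ℕ} {p M : ℝ} (hp : 0 < p) (hp2 : p ≤ 2) (hM : 0 < M)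
    {f : Lat d → ℝ} (h : ellNorm p f ≤ ENNReal.ofReal M) :
    Summable (fun y => f y ^ 2) ∧ ∑' y, f y ^ 2 ≤ M ^ 2 := by
  obtain ⟨hs, hle⟩ := summable_rpow_of_ellNorm_le hp hM.le h
  have hpt : ∀ y, f y ^ 2 ≤ M ^ (2 - p) * |f y| ^ p := by
    intro y
    have h1 : |f y| ≤ M := by
      have := (hs.le_tsum y fun z _ => by positivity).trans hle
      exact (Real.rpow_le_rpow_iff (abs_nonneg _) hM.le hp).mp this
    rcases eq_or_ne (f y) 0 with h0 | h0
    · rw [h0]; simp [hp.ne']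
    · have hf : 0 < |f y| := abs_pos.mpr h0
      calc f y ^ 2 = |f y| ^ (2 - p) * |f y| ^ p := by
            rw [← Real.rpow_add hf, sub_add_cancel, Real.rpow_two, sq_abs]
        _ ≤ _ := by
            have := Real.rpow_le_rpow (abs_nonneg _) h1 (show 0 ≤ 2 - p by linarith)
            gcongr
  have hs2 : Summable fun y => f y ^ 2 :=
    Summable.of_nonneg_of_le (fun y => sq_nonneg _) hpt (hs.mul_left _)
  refine ⟨hs2, (hs2.tsum_le_tsum hpt (hs.mul_left _)).trans ?_⟩
  rw [tsum_mul_left]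
  calc _ ≤ M ^ (2 - p) * M ^ p := by gcongr
    _ = M ^ 2 := by rw [← Real.rpow_add hM, sub_add_cancel, Real.rpow_two]

lemma abs_weight {d : ℕ} (a : ℝ) (f : Lat d → ℝ) (y : Lat d) :
    |weight a f y| = ‖toVec y‖ ^ a * |f y| := by
  rw [weight, abs_mul, abs_of_nonneg (by positivity)]

lemma summable_norm_mul_of_ellNorm_le {d : ℕ} {M a b : ℝ} (hM : 0 ≤ M) (ha : 0 < a) (hab : a ≤ b)
    {f : Lat d → ℝ} (h : ellNorm 1 (weight b f) ≤ ENNReal.ofReal M) :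
    Summable (fun y => ‖toVec y‖ ^ a * |f y|) ∧ ∑' y, ‖toVec y‖ ^ a * |f y| ≤ M := by
  obtain ⟨h1, h2⟩ := summable_abs_of_ellNorm_one_le hM h
  simp only [abs_weight] at h1 h2
  exact ⟨summable_norm_mul ha hab h1, (tsum_norm_mul_le ha hab h1).trans h2⟩

lemma pExp_pos (d : ℕ) [NeZero d] {ζ : ℝ} (hζ : 0 < ζ) : 0 < pExp d ζ := by
  have hd : 1 ≤ d := NeZero.one_le
  unfold pExp
  split_ifs with h
  · norm_num
  · have : (2 : ℝ) ≤ d := by exact_mod_cast (show 2 ≤ d by omega)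
    have : 0 < min ζ 2 := lt_min hζ two_pos
    apply div_pos <;> linarith

/-! ### From the kernel class to critical kernels and sources -/

namespace KernelClass

variable {d : ℕ} {M K ζ : ℝ} {Q g : Lat d → ℝ}

lemma summable (h : KernelClass M K ζ Q g) (hM : 0 < M) : Summable Q :=
  (summable_abs_of_ellNorm_one_le hM.le h.Q_one).1.of_abs

lemma moment (h : KernelClass M K ζ Q g) (hM : 0 < M) {a : ℝ} (ha : 0 < a) (ha2 : a ≤ 2 + ζ) :
    Summable (fun y => ‖toVec y‖ ^ a * |Q y|) ∧ ∑' y, ‖toVec y‖ ^ a * |Q y| ≤ M :=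
  summable_norm_mul_of_ellNorm_le hM.le ha ha2 h.Q_moment

lemma moment_two (h : KernelClass M K ζ Q g) (hM : 0 < M) (hζ : 0 < ζ) :
    Summable (fun y => ‖toVec y‖ ^ 2 * |Q y|) ∧ ∑' y, ‖toVec y‖ ^ 2 * |Q y| ≤ M := by
  simpa only [Real.rpow_two] using h.moment hM (a := 2) two_pos (by linarith)

lemma quadForm_le (h : KernelClass M K ζ Q g) (hM : 0 < M) (hζ : 0 < ζ) (k : Vec d) :
    quadForm Q k ≤ M * ‖k‖ ^ 2 := by
  obtain ⟨h1, h2⟩ := h.moment_two hM hζ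
  refine ((le_abs_self _).trans (abs_quadForm_le h1 k)).trans ?_
  rw [mul_comm]
  gcongr

lemma le_quadForm (h : KernelClass M K ζ Q g) (hM : 0 < M) (hζ : 0 < ζ) (k : Vec d) :
    2 * K * ‖k‖ ^ 2 ≤ quadForm Q k :=
  OZ.le_quadForm (ζ := min ζ 1) (lt_min hζ one_pos) (min_le_right _ _) (h.summable hM)
    (h.moment hM (by have := lt_min hζ one_pos; linarith) (by linarith [min_le_left ζ 1])).1
    (fun k hk => h.infrared k (by simpa [cube] using hk)) k

/-- For `d ≥ 4` the `ℓ²` moment of order `d - 1` is assumed; for `d ≤ 3` the order is `2`, and the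
assumed exponent embeds in `ℓ²`. Lowering `ζ` to at most one loses nothing, by monotonicity of
lattice moments. -/
lemma sourceKernel [NeZero d] (h : KernelClass M K ζ Q g) (hM : 0 < M) (hζ : 0 < ζ) :
    SourceKernel M (min ζ 1) g := by
  have hd : 1 ≤ d := NeZero.one_le
  obtain ⟨g1, g2⟩ := summable_abs_of_ellNorm_one_le hM.le h.g_one
  obtain ⟨m1, m2⟩ := summable_norm_mul_of_ellNorm_le hM.le (lt_min hζ one_pos) (min_le_left ζ 1) h.g_moment
  have hsq : Summable (fun y => (‖toVec y‖ ^ (max 2 (d - 1)) * g y) ^ 2) ∧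
      ∑' y, (‖toVec y‖ ^ (max 2 (d - 1)) * g y) ^ 2 ≤ M ^ 2 := by
    rcases le_or_gt 4 d with h4 | h4
    · have := summable_sq_of_ellNorm_le two_pos le_rfl hM (h.g_high h4)
      rw [max_eq_right (by omega)]
      have e : ((d : ℝ) - 1) = ((d - 1 : ℕ) : ℝ) := by rw [Nat.cast_sub hd]; simp
      simpa only [weight, e, Real.rpow_natCast] using this
    · have := summable_sq_of_ellNorm_le (lt_min (pExp_pos d hζ) two_pos) (min_le_right _ _) hM h.g_second
      rw [max_eq_left (by omega)]
      simpa only [weight, Real.rpow_two] using this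
  exact ⟨g1.of_abs, g2, m1, m2, hsq.1, hsq.2⟩

lemma critKernel [NeZero d] (h : KernelClass M K ζ Q g) (hM : 0 < M) (hζ : 0 < ζ) {c : ℝ}
    (h1 : ∑' y, Q y = 1) (hc : c ≤ ‖firstMoment Q‖) : CritKernel M K (min ζ 1) c Q := by
  have hd : 1 ≤ d := NeZero.one_le
  have hmin : 0 < min ζ 1 := lt_min hζ one_pos
  obtain ⟨m1, m2⟩ := h.moment hM (a := 2 + min ζ 1) (by linarith) (by linarith [min_le_left ζ 1])
  have hsq : 6 ≤ d → Summable (fun y => (‖toVec y‖ ^ (d - 1) * Q y) ^ 2) ∧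
      ∑' y, (‖toVec y‖ ^ (d - 1) * Q y) ^ 2 ≤ M ^ 2 := by
    intro h6
    have h6' : (6 : ℝ) ≤ d := by exact_mod_cast h6
    have := summable_sq_of_ellNorm_le (lt_min (by linarith) two_pos) (min_le_right _ _) hM
      (h.Q_high (by omega))
    have e : ((d : ℝ) - 1) = ((d - 1 : ℕ) : ℝ) := by rw [Nat.cast_sub hd]; simp
    simpa only [weight, e, Real.rpow_natCast] using this
  refine ⟨h.summable hM, (summable_abs_of_ellNorm_one_le hM.le h.Q_one).2, m1, m2, fun k hk => ?_, h1, hc,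
    fun h6 => (hsq h6).1, fun h6 => (hsq h6).2⟩
  have := h.infrared k (by simpa [cube] using hk)
  rwa [fourierSum_zero, h1, Complex.ofReal_one] at this

end KernelClass

/-! ### Geometry of the Wulff shape -/

lemma mem_Omega_iff {d : ℕ} {S : Lat d → ℝ} (h0 : ∀ x, 0 ≤ S x) {μ : Vec d} :
    μ ∈ Omega S ↔ Summable (tilt S μ) := by
  have h1 : ∀ x, 0 ≤ tilt S μ x := fun x => mul_nonneg (h0 x) (Real.exp_pos _).le
  constructor
  · intro h
    have := ENNReal.summable_toReal (ne_of_lt (show ∑' x, ENNReal.ofReal (tilt S μ x) < ⊤ from h))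
    simpa only [ENNReal.toReal_ofReal (h1 _)] using this
  · exact fun h => h.tsum_ofReal_lt_top

lemma tilt_zero {d : ℕ} (f : Lat d → ℝ) : tilt f 0 = f := by
  ext x; simp [tilt]

lemma convex_Omega {d : ℕ} {S : Lat d → ℝ} (h0 : ∀ x, 0 ≤ S x) : Convex ℝ (Omega S) := by
  refine convex_iff_segment_subset.mpr fun μ hμ ν hν => ?_
  rw [segment_eq_image']
  rintro _ ⟨s, hs, rfl⟩
  rw [mem_Omega_iff h0] at *
  exact Summable.of_norm_bounded (hμ.abs.add hν.abs) fun y => abs_tilt_segment_le_add S μ ν hs y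

/-- Change of sign of a component, as a permutation of the lattice. -/
def flip {d : ℕ} (j : Fin d) : Lat d ≃ Lat d :=
  Function.Involutive.toPerm (fun x => Function.update x j (-x j)) fun x => by simp

lemma flip_apply {d : ℕ} (j : Fin d) (x : Lat d) : flip j x = Function.update x j (-x j) := rfl

lemma inner_toVec_flip {d : ℕ} (μ : Vec d) (j : Fin d) (x : Lat d) :
    (inner ℝ μ (toVec (flip j x)) : ℝ) = inner ℝ (μ - (2 * μ j) • EuclideanSpace.single j (1 : ℝ)) (toVec x) := by
  simp only [inner_toVec]
  refine Finset.sum_congr rfl fun i _ => ?_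
  by_cases h : i = j
  · subst h; simp [flip_apply]; ring
  · simp [flip_apply, h]

lemma tsum_coord_eq_zero {d : ℕ} {J : Lat d → ℝ} (hJ : LatticeSymmetric J) (j : Fin d) :
    ∑' y : Lat d, (y j : ℝ) * J y = 0 := by
  have h1 := (flip j).tsum_eq (fun y : Lat d => (y j : ℝ) * J y)
  have h2 : ∀ y : Lat d, ((flip j y) j : ℝ) * J (flip j y) = -((y j : ℝ) * J y) := by
    intro y
    rw [flip_apply, hJ.1]; simp
  rw [tsum_congr h2, tsum_neg] at h1
  linarith

lemma firstMoment_eq_zero {d : ℕ} {J : Lat d → ℝ} (hJ : LatticeSymmetric J) : firstMoment J = 0 := by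
  ext j
  exact tsum_coord_eq_zero hJ j

namespace AveragedDecay

variable {d : ℕ} [NeZero d] {S : Lat d → ℝ}

lemma flip_mem (hS : AveragedDecay S) {μ : Vec d} (hμ : μ ∈ Omega S) (j : Fin d) :
    μ - (2 * μ j) • EuclideanSpace.single j (1 : ℝ) ∈ Omega S := by
  rw [mem_Omega_iff hS.nonneg] at *
  refine ((flip j).summable_iff.mpr hμ).congr fun x => ?_
  rw [Function.comp_apply, tilt, tilt, inner_toVec_flip, flip_apply, hS.symm.1]

lemma smul_mem (hS : AveragedDecay S) {μ : Vec d} (hμ : μ ∈ Omega S) {s : ℝ}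
    (hs : s ∈ Set.Icc (0 : ℝ) 1) : s • μ ∈ Omega S := by
  have := (convex_Omega hS.nonneg) hμ hS.zero_mem hs.1 (sub_nonneg.mpr hs.2) (by ring)
  simpa using this

/-- The tilts stay in the domain when some components are replaced by zero. -/
lemma erase_mem (hS : AveragedDecay S) {μ : Vec d} (hμ : μ ∈ Omega S) (s : Finset (Fin d)) :
    WithLp.toLp 2 (fun i => if i ∈ s then 0 else μ i) ∈ Omega S := by
  classical
  induction s using Finset.induction_on with
  | empty => simpa using hμ
  | insert j s hj ih =>
    -- The midpoint of a tilt and its reflection has vanishing `j`-th component.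
    have := (convex_Omega hS.nonneg) ih (hS.flip_mem ih j) (a := 1 / 2) (b := 1 / 2) (by norm_num)
      (by norm_num) (by norm_num)
    convert this using 1
    ext i
    by_cases h : i = j
    · subst h; simp [hj]; ring
    · simp only [PiLp.add_apply, PiLp.sub_apply, PiLp.smul_apply, PiLp.single_apply, if_false,
        Finset.mem_insert, h, false_or, smul_eq_mul]
      split_ifs <;> ring

lemma single_mem (hS : AveragedDecay S) {j : Fin d} {a : ℝ}
    (h : EuclideanSpace.single j a ∈ Omega S) (i : Fin d) : EuclideanSpace.single i a ∈ Omega S := by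
  rw [mem_Omega_iff hS.nonneg] at *
  refine (((Equiv.swap i j).arrowCongr (Equiv.refl ℤ)).summable_iff.mpr h).congr fun x => ?_
  have e : (((Equiv.swap i j).arrowCongr (Equiv.refl ℤ)) x) = fun l => x (Equiv.swap i j l) := by
    ext l; simp [Equiv.arrowCongr]
  rw [Function.comp_apply, e, tilt, tilt, hS.symm.2]
  congr 2
  simp [toVec, EuclideanSpace.inner_single_left]

lemma single_neg_mem (hS : AveragedDecay S) {j : Fin d} {a : ℝ}
    (h : EuclideanSpace.single j a ∈ Omega S) : EuclideanSpace.single j (-a) ∈ Omega S := by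
  convert hS.flip_mem h j using 1
  ext i
  by_cases h : i = j
  · subst h; simp; ring
  · simp [h]

lemma single_apply_mem (hS : AveragedDecay S) {μ : Vec d} (hμ : μ ∈ Omega S) (j : Fin d) :
    EuclideanSpace.single j (μ j) ∈ Omega S := by
  convert hS.erase_mem hμ (Finset.univ.erase j) using 1
  ext i
  by_cases h : i = j
  · subst h; simp
  · simp [h]

lemma smul_e1_eq (t : ℝ) : t • e1 d = EuclideanSpace.single 0 t := by
  ext i
  by_cases h : i = 0 <;> simp [e1, h]

/-- A tilt with a large component could be projected to that axis, moved to the first axis by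
symmetry and shrunk to the excluded point. -/
lemma exists_abs_apply_le (hS : AveragedDecay S) : ∃ B : ℝ, 0 < B ∧
    ∀ μ ∈ Omega S, ∀ j, |μ j| ≤ B := by
  obtain ⟨t, ht, hn⟩ := hS.exists_notMem
  refine ⟨t, ht, fun μ hμ j => ?_⟩
  by_contra! hlt
  have h1 : EuclideanSpace.single j |μ j| ∈ Omega S := by
    rcases abs_choice (μ j) with h | h <;> rw [h]
    · exact hS.single_apply_mem hμ j
    · exact hS.single_neg_mem (hS.single_apply_mem hμ j)
  have h2 := hS.smul_mem (hS.single_mem h1 0) (s := t / |μ j|)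
    ⟨by positivity, (div_le_one (by linarith)).mpr hlt.le⟩
  have h0 : |μ j| ≠ 0 := by linarith
  rw [← smul_e1_eq, smul_smul, div_mul_cancel₀ _ h0] at h2
  exact hn h2

lemma isCompact_closure (hS : AveragedDecay S) : IsCompact (closure (Omega S)) := by
  obtain ⟨B, hB, h⟩ := hS.exists_abs_apply_le
  refine Bornology.IsBounded.isCompact_closure ?_
  refine (Metric.isBounded_iff_subset_closedBall 0).mpr ⟨√(∑ _j : Fin d, B ^ 2), fun μ hμ => ?_⟩
  rw [mem_closedBall_zero_iff, EuclideanSpace.norm_eq]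
  refine Real.sqrt_le_sqrt (Finset.sum_le_sum fun j _ => ?_)
  exact pow_le_pow_left₀ (norm_nonneg _) (h μ hμ j) 2

lemma bddAbove_mass (hS : AveragedDecay S) :
    BddAbove {t : ℝ | 0 ≤ t ∧ susceptibility S (t • e1 d) < ∞} := by
  obtain ⟨B, hB, h⟩ := hS.exists_abs_apply_le
  refine ⟨B, fun t ht => ?_⟩
  have := h _ (show t • e1 d ∈ Omega S from ht.2) 0
  rw [smul_e1_eq] at this
  simpa using (le_abs_self t).trans (by simpa using this)

lemma mass_pos (hS : AveragedDecay S) : 0 < mass S := by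
  have hc : Continuous fun t : ℝ => t • e1 d := by fun_prop
  have h0 : (fun t : ℝ => t • e1 d) ⁻¹' Omega S ∈ 𝓝 (0 : ℝ) :=
    hc.continuousAt.preimage_mem_nhds (by simpa using hS.isOpen.mem_nhds hS.zero_mem)
  obtain ⟨r, hr, hb⟩ := Metric.mem_nhds_iff.mp h0
  have : r / 2 ∈ (fun t : ℝ => t • e1 d) ⁻¹' Omega S :=
    hb (by rw [Metric.mem_ball, Real.dist_0_eq_abs, abs_of_pos (half_pos hr)]; linarith)
  exact (half_pos hr).trans_le (le_csSup hS.bddAbove_mass ⟨(half_pos hr).le, this⟩)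

lemma single_mem_of_lt_mass (hS : AveragedDecay S) {t : ℝ} (ht0 : 0 ≤ t) (ht : t < mass S)
    (j : Fin d) : EuclideanSpace.single j t ∈ Omega S := by
  have hne : {t : ℝ | 0 ≤ t ∧ susceptibility S (t • e1 d) < ∞}.Nonempty :=
    ⟨0, le_rfl, by simpa using show susceptibility S 0 < ∞ from hS.zero_mem⟩
  obtain ⟨r, ⟨hr0, hr⟩, hlt⟩ := exists_lt_of_lt_csSup hne ht
  have h2 := hS.smul_mem (show r • e1 d ∈ Omega S from hr) (s := t / r)
    ⟨by positivity, (div_le_one (by linarith)).mpr hlt.le⟩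
  have h0 : r ≠ 0 := by linarith
  rw [smul_smul, div_mul_cancel₀ _ h0, smul_e1_eq] at h2
  exact hS.single_mem h2 j

/-- The support function of the Wulff shape is bounded below in terms of the mass. -/
lemma mass_le_mul_of_forall_le (hS : AveragedDecay S) {u : Vec d} (hu : ‖u‖ = 1) {a : ℝ}
    (h : ∀ ν ∈ Omega S, (inner ℝ ν u : ℝ) ≤ a) : mass S ≤ a * √d := by
  have hd : (0 : ℝ) < d := by exact_mod_cast NeZero.pos d
  -- A unit vector has a component of size at least `1 / √d`; the support function is then tested on
  -- that axis, with the matching sign.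
  obtain ⟨j, hj⟩ : ∃ j, 1 / √d ≤ |u j| := by
    by_contra! hlt
    have h1 : ‖u‖ ^ 2 < ∑ _j : Fin d, (1 / (d : ℝ)) := by
      rw [EuclideanSpace.norm_sq_eq]
      refine Finset.sum_lt_sum_of_nonempty ⟨0, Finset.mem_univ _⟩ fun j _ => ?_
      have := pow_lt_pow_left₀ (hlt j) (abs_nonneg _) two_ne_zero
      rwa [div_pow, one_pow, Real.sq_sqrt hd.le, ← Real.norm_eq_abs] at this
    rw [hu] at h1
    simp [hd.ne'] at h1
  refine le_of_forall_lt_imp_le_of_dense fun t ht => ?_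
  rcases le_or_gt t 0 with h0 | h0
  · have := h 0 hS.zero_mem
    rw [inner_zero_left] at this
    exact h0.trans (by positivity)
  have hm := hS.single_mem_of_lt_mass h0.le ht j
  have h1 : t * |u j| ≤ a := by
    rcases abs_choice (u j) with h' | h' <;> rw [h']
    · have := h _ hm
      simpa [EuclideanSpace.inner_single_left] using this
    · have := h _ (hS.single_neg_mem hm)
      simpa [EuclideanSpace.inner_single_left] using this
  have h2 : t * (1 / √d) ≤ a := (mul_le_mul_of_nonneg_left hj h0.le).trans h1
  have hsd : 0 < √(d : ℝ) := Real.sqrt_pos.mpr hd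
  rw [mul_one_div, div_le_iff₀ hsd] at h2
  exact h2

end AveragedDecay

/-! ### Criticality on the boundary, and the drift -/

lemma tilt_add {d : ℕ} (f g : Lat d → ℝ) (μ : Vec d) (x : Lat d) :
    tilt (fun y => f y + g y) μ x = tilt f μ x + tilt g μ x := add_mul _ _ _

lemma tilt_conv {d : ℕ} (f g : Lat d → ℝ) (μ : Vec d) :
    tilt (conv f g) μ = conv (tilt f μ) (tilt g μ) := by
  ext x
  rw [tilt, conv, conv, ← tsum_mul_right]
  refine tsum_congr fun y => ?_
  have : (inner ℝ μ (toVec x) : ℝ) = inner ℝ μ (toVec (x - y)) + inner ℝ μ (toVec y) := by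
    rw [toVec_sub, inner_sub_right, sub_add_cancel]
  rw [tilt, tilt, this, Real.exp_add]; ring

lemma tsum_conv {d : ℕ} {f g : Lat d → ℝ} (hf : Summable f) (hg : Summable g) :
    ∑' x, conv f g x = (∑' x, f x) * ∑' x, g x := by
  have := fourierSum_conv hf hg 0
  rw [fourierSum_zero, fourierSum_zero, fourierSum_zero] at this
  exact_mod_cast this

namespace OZEquation

variable {d : ℕ} {M K ζ : ℝ} {S g J : Lat d → ℝ} {μ ν : Vec d}

lemma summable_tilt_g (hE : OZEquation M K ζ S g J) (hM : 0 < M) (hμ : μ ∈ closure (Omega S)) :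
    Summable (tilt g μ) :=
  (summable_abs_of_ellNorm_one_le hM.le (hE.mem_class μ hμ).g_one).1.of_abs

lemma tsum_tilt_g_pos (hE : OZEquation M K ζ S g J) (hμ : μ ∈ closure (Omega S)) :
    0 < ∑' x, tilt g μ x := by
  simpa [fourierSum_zero] using hE.g_pos μ hμ

lemma tsum_tilt_g_le (hE : OZEquation M K ζ S g J) (hM : 0 < M) (hμ : μ ∈ closure (Omega S)) :
    ∑' x, tilt g μ x ≤ M := by
  obtain ⟨h1, h2⟩ := summable_abs_of_ellNorm_one_le hM.le (hE.mem_class μ hμ).g_one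
  exact (h1.of_abs.tsum_le_tsum (fun x => le_abs_self _) h1).trans h2

variable [NeZero d]

lemma tsum_mul_one_sub (hE : OZEquation M K ζ S g J) (hS : AveragedDecay S) (hM : 0 < M)
    (hμ : μ ∈ Omega S) :
    (∑' x, tilt S μ x) * (1 - ∑' x, tilt J μ x) = ∑' x, tilt g μ x := by
  have hs := (mem_Omega_iff hS.nonneg).mp hμ
  have hg := hE.summable_tilt_g hM (subset_closure hμ)
  have hJ := (hE.mem_class μ (subset_closure hμ)).summable hM
  have e : ∀ x, tilt S μ x = tilt g μ x + conv (tilt J μ) (tilt S μ) x := by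
    intro x
    rw [← tilt_conv, ← tilt_add]
    exact congrArg (· * _) (hE.equation x)
  have hc : Summable (conv (tilt J μ) (tilt S μ)) :=
    (hs.sub hg).congr fun x => by rw [e x, add_sub_cancel_left]
  have h1 : ∑' x, tilt S μ x = ∑' x, (tilt g μ x + conv (tilt J μ) (tilt S μ) x) := tsum_congr e
  rw [hg.tsum_add hc, tsum_conv hJ hs] at h1
  linarith

/-- The kernel is subcritical in the interior of the Wulff shape. -/
lemma tsum_tilt_lt_one (hE : OZEquation M K ζ S g J) (hS : AveragedDecay S) (hM : 0 < M)
    (hμ : μ ∈ Omega S) : ∑' x, tilt J μ x < 1 := by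
  have h1 := hE.tsum_mul_one_sub hS hM hμ
  have h2 := hE.tsum_tilt_g_pos (subset_closure hμ)
  have h3 : 0 ≤ ∑' x, tilt S μ x := tsum_nonneg fun x => mul_nonneg (hS.nonneg x) (Real.exp_pos _).le
  rw [← h1] at h2
  linarith [pos_of_mul_pos_right h2 h3]

lemma smul_mem_of_lt_one (hS : AveragedDecay S) (hμ : μ ∈ closure (Omega S)) {s : ℝ}
    (hs : s ∈ Set.Ico (0 : ℝ) 1) : s • μ ∈ Omega S := by
  have := (convex_Omega hS.nonneg).combo_interior_closure_mem_interior
    (by rw [hS.isOpen.interior_eq]; exact hS.zero_mem) hμ (a := 1 - s) (b := s)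
    (by linarith [hs.2]) hs.1 (by ring)
  rw [hS.isOpen.interior_eq] at this
  simpa using this

/-- The kernel is critical on the boundary of the Wulff shape. -/
lemma tsum_tilt_eq_one (hE : OZEquation M K ζ S g J) (hS : AveragedDecay S) (hM : 0 < M)
    (hμ : μ ∈ frontier (Omega S)) : ∑' x, tilt J μ x = 1 := by
  have hμC : μ ∈ closure (Omega S) := frontier_subset_closure hμ
  have hJ0 : Summable (tilt J 0) := by rw [tilt_zero]; exact hE.J_summable
  have hJμ := (hE.mem_class μ hμC).summable hM
  set F : ℝ → ℝ := fun s => ∑' x, tilt J (0 + s • (μ - 0)) x with hF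
  have hFc : ContinuousOn F (Set.Icc 0 1) := by
    refine continuousOn_tsum (fun x => ?_) (hJ0.abs.add hJμ.abs) fun x s hs =>
      abs_tilt_segment_le_add J 0 μ hs x
    simp only [tilt]; fun_prop
  have hF1 : F 1 = ∑' x, tilt J μ x := by simp [hF]
  have hlim : Tendsto F (𝓝[<] 1) (𝓝 (∑' x, tilt J μ x)) := by
    rw [← hF1]
    refine (hFc 1 (by simp)).mono_left ?_
    rw [← nhdsWithin_Ico_eq_nhdsLT (zero_lt_one' ℝ)]
    exact nhdsWithin_mono _ Set.Ico_subset_Icc_self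
  have hev : ∀ᶠ s : ℝ in 𝓝[<] 1, s ∈ Set.Ico (0 : ℝ) 1 := Ico_mem_nhdsLT zero_lt_one
  have hFs : ∀ s, F s = ∑' x, tilt J (s • μ) x := fun s => by simp [hF]
  have hle : ∑' x, tilt J μ x ≤ 1 := by
    refine le_of_tendsto hlim (hev.mono fun s hs => ?_)
    rw [hFs]
    exact (hE.tsum_tilt_lt_one hS hM (smul_mem_of_lt_one hS hμC hs)).le
  -- Were the mass below one, partial sums of the tilted `S` would stay bounded by `M` over the gap
  -- when the boundary is approached along the ray. Then the boundary point would belong to the open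
  -- domain.
  by_contra hne
  have hlt := lt_of_le_of_ne hle hne
  have hfin : ∀ T : Finset (Lat d), ∑ x ∈ T, tilt S μ x ≤ M / (1 - ∑' x, tilt J μ x) := by
    intro T
    rw [le_div_iff₀ (by linarith)]
    have hc : Continuous fun s : ℝ => ∑ x ∈ T, tilt S (s • μ) x := by
      simp only [tilt]; fun_prop
    have h1 : Tendsto (fun s : ℝ => ∑ x ∈ T, tilt S (s • μ) x) (𝓝[<] 1) (𝓝 (∑ x ∈ T, tilt S μ x)) := by
      have := (hc.tendsto 1).mono_left (nhdsWithin_le_nhds (s := Set.Iio 1))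
      simpa using this
    refine le_of_tendsto (h1.mul (hlim.const_sub 1)) (hev.mono fun s hs => ?_)
    have hm := smul_mem_of_lt_one hS hμC hs
    have hs1 := (mem_Omega_iff hS.nonneg).mp hm
    rw [hFs]
    have h2 := hE.tsum_tilt_lt_one hS hM hm
    have h3 : ∑ x ∈ T, tilt S (s • μ) x ≤ ∑' x, tilt S (s • μ) x := hs1.sum_le_tsum T fun x _ => mul_nonneg (hS.nonneg x) (Real.exp_pos _).le
    refine (mul_le_mul_of_nonneg_right h3 (by linarith)).trans ?_
    rw [hE.tsum_mul_one_sub hS hM hm]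
    exact hE.tsum_tilt_g_le hM (subset_closure hm)
  have hsum : Summable (tilt S μ) :=
    summable_of_sum_le (fun x => mul_nonneg (hS.nonneg x) (Real.exp_pos _).le) hfin
  rw [hS.isOpen.frontier_eq] at hμ
  exact hμ.2 ((mem_Omega_iff hS.nonneg).mpr hsum)

/-- Quantitative convexity and smoothness of the mass of the tilts of the kernel. -/
lemma tsum_tilt_bounds (hE : OZEquation M K ζ S g J) (hS : AveragedDecay S) (hM : 0 < M) (hζ : 0 < ζ)
    (hμ : μ ∈ closure (Omega S)) (hν : ν ∈ closure (Omega S)) :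
    ∑' x, tilt J μ x + inner ℝ (firstMoment (tilt J μ)) (ν - μ) + K * ‖ν - μ‖ ^ 2 ≤ ∑' x, tilt J ν x ∧
      ∑' x, tilt J ν x ≤
        ∑' x, tilt J μ x + inner ℝ (firstMoment (tilt J μ)) (ν - μ) + M / 2 * ‖ν - μ‖ ^ 2 := by
  have cμ := hE.mem_class μ hμ
  have cν := hE.mem_class ν hν
  have hseg : ∀ s ∈ Set.Icc (0 : ℝ) 1, μ + s • (ν - μ) ∈ closure (Omega S) := fun s hs =>
    (convex_Omega hS.nonneg).closure.add_smul_sub_mem hμ hν hs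
  obtain ⟨b1, b2⟩ := integral_segment_bounds (cμ.moment_two hM hζ).1 (cν.moment_two hM hζ).1
    (fun s hs => (hE.mem_class _ (hseg s hs)).le_quadForm hM hζ (ν - μ))
    (fun s hs => (hE.mem_class _ (hseg s hs)).quadForm_le hM hζ (ν - μ))
  have := tsum_tilt_taylor (cμ.summable hM) (cν.summable hM) (cμ.moment_two hM hζ).1
    (cν.moment_two hM hζ).1
  constructor <;> linarith

/-- Strong monotonicity of the gradient of the mass: the convexity inequalities between `0` and `μ`
are added, and the gradient at `0` vanishes by symmetry. -/
lemma le_inner_drift (hE : OZEquation M K ζ S g J) (hS : AveragedDecay S) (hM : 0 < M) (hζ : 0 < ζ)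
    (hμ : μ ∈ closure (Omega S)) :
    2 * K * ‖μ‖ ^ 2 ≤ inner ℝ (firstMoment (tilt J μ)) μ := by
  have h0 := subset_closure (s := Omega S) hS.zero_mem
  have h1 := (hE.tsum_tilt_bounds hS hM hζ hμ h0).1
  have h2 := (hE.tsum_tilt_bounds hS hM hζ h0 hμ).1
  rw [tilt_zero, firstMoment_eq_zero hE.J_symm, inner_zero_left, sub_zero] at h2
  rw [tilt_zero, zero_sub, norm_neg, inner_neg_right] at h1
  linarith

lemma le_norm_drift (hE : OZEquation M K ζ S g J) (hS : AveragedDecay S) (hM : 0 < M) (hζ : 0 < ζ)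
    (hμ : μ ∈ closure (Omega S)) : 2 * K * ‖μ‖ ≤ ‖firstMoment (tilt J μ)‖ := by
  have h1 := hE.le_inner_drift hS hM hζ hμ
  have h2 := real_inner_le_norm (firstMoment (tilt J μ)) μ
  rcases eq_or_ne μ 0 with h | h
  · subst h; simp
  · have : 0 < ‖μ‖ := norm_pos_iff.mpr h
    refine le_of_mul_le_mul_right ?_ this
    linarith

end OZEquation

lemma mem_frontier_of_forall_le {d : ℕ} [NeZero d] {S : Lat d → ℝ} (hS : AveragedDecay S) {u μ : Vec d}
    (hu : u ≠ 0) (hμ : μ ∈ closure (Omega S))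
    (hmax : ∀ ν ∈ closure (Omega S), (inner ℝ ν u : ℝ) ≤ inner ℝ μ u) : μ ∈ frontier (Omega S) := by
  rw [hS.isOpen.frontier_eq]
  refine ⟨hμ, fun hin => ?_⟩
  have hcu : Continuous fun s : ℝ => μ + s • u := by fun_prop
  have h0 : (fun s : ℝ => μ + s • u) ⁻¹' Omega S ∈ 𝓝 (0 : ℝ) :=
    hcu.continuousAt.preimage_mem_nhds (by simpa using hS.isOpen.mem_nhds hin)
  obtain ⟨s, hs, hs0⟩ := ((eventually_nhdsWithin_of_eventually_nhds (s := Set.Ioi 0) h0).and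
    self_mem_nhdsWithin).exists
  have h1 := hmax _ (subset_closure hs)
  rw [inner_add_left, real_inner_smul_left] at h1
  have h2 : 0 < s * inner ℝ u u := mul_pos hs0 (real_inner_self_pos.mpr hu)
  linarith

lemma exists_isOptimalTilt {d : ℕ} [NeZero d] {S : Lat d → ℝ} (hS : AveragedDecay S) {u : Vec d}
    (hu : u ≠ 0) : ∃ μ, IsOptimalTilt S u μ := by
  have hc : Continuous fun ν : Vec d => (inner ℝ ν u : ℝ) := by fun_prop
  obtain ⟨μ, hμ, hmax⟩ := hS.isCompact_closure.exists_isMaxOn ⟨0, subset_closure hS.zero_mem⟩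
    hc.continuousOn
  exact ⟨μ, mem_frontier_of_forall_le hS hu hμ hmax, hmax⟩

namespace OZEquation

variable {d : ℕ} [NeZero d] {M K ζ : ℝ} {S g J : Lat d → ℝ} {μ ν u : Vec d}

/-- The midpoint of two maximisers is again a maximiser, hence on the boundary with mass one. Adding
the strong convexity inequalities from the midpoint to both ends cancels the linear terms and forces
the ends to coincide. -/
lemma isOptimalTilt_unique (hE : OZEquation M K ζ S g J) (hS : AveragedDecay S) (hM : 0 < M)
    (hK : 0 < K) (hζ : 0 < ζ) (hu : u ≠ 0) (hμ : IsOptimalTilt S u μ) (hν : IsOptimalTilt S u ν) :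
    μ = ν := by
  have hμC := frontier_subset_closure hμ.1
  have hνC := frontier_subset_closure hν.1
  set p := μ + (1 / 2 : ℝ) • (ν - μ) with hp
  have hpC : p ∈ closure (Omega S) :=
    (convex_Omega hS.nonneg).closure.add_smul_sub_mem hμC hνC (by norm_num)
  have heq : (inner ℝ μ u : ℝ) = inner ℝ ν u := le_antisymm (hν.2 _ hμC) (hμ.2 _ hνC)
  have hpmax : ∀ w ∈ closure (Omega S), (inner ℝ w u : ℝ) ≤ inner ℝ p u := by
    intro w hw
    rw [hp, inner_add_left, real_inner_smul_left, inner_sub_left, ← heq, sub_self, mul_zero, add_zero]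
    exact hμ.2 w hw
  have hpF := mem_frontier_of_forall_le hS hu hpC hpmax
  have h1 := (hE.tsum_tilt_bounds hS hM hζ hpC hμC).1
  have h2 := (hE.tsum_tilt_bounds hS hM hζ hpC hνC).1
  rw [hE.tsum_tilt_eq_one hS hM hpF, hE.tsum_tilt_eq_one hS hM hμ.1] at h1
  rw [hE.tsum_tilt_eq_one hS hM hpF, hE.tsum_tilt_eq_one hS hM hν.1] at h2
  have e : μ - p = -(ν - p) := by rw [hp]; module
  rw [e, inner_neg_right, norm_neg] at h1
  have h3 : K * ‖ν - p‖ ^ 2 ≤ 0 := by linarith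
  have h4 : ‖ν - p‖ = 0 := by
    by_contra h
    have : 0 < K * ‖ν - p‖ ^ 2 := by positivity
    linarith
  have h5 : (1 / 2 : ℝ) • (ν - μ) = 0 := by
    rw [← norm_eq_zero.mp h4, hp]; module
  rw [smul_eq_zero] at h5
  exact (sub_eq_zero.mp (h5.resolve_left (by norm_num))).symm

/-- A point close to an optimal tilt, displaced against its drift, lies in the Wulff shape. -/
lemma exists_mem_closure_of_inner_neg (hE : OZEquation M K ζ S g J) (hS : AveragedDecay S)
    (hM : 0 < M) (hK : 0 < K) (hζ : 0 < ζ) (hμ : μ ∈ frontier (Omega S)) {v : Vec d}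
    (hv : (inner ℝ (firstMoment (tilt J μ)) v : ℝ) < 0) :
    ∃ ε : ℝ, 0 < ε ∧ μ + ε • v ∈ closure (Omega S) := by
  have hμC := frontier_subset_closure hμ
  set η := firstMoment (tilt J μ) with hη
  -- The bound `M * κ ≤ K` lets the inward gain `2 * K * ‖μ‖ ^ 2` of the drift absorb the quadratic
  -- remainder along `μ`.
  set κ := min (1 / 2) (K / M) with hκ
  have hκ0 : 0 < κ := by positivity
  have hκ1 : κ ≤ 1 / 2 := min_le_left _ _
  have hκM : M * κ ≤ K := by
    have : κ ≤ K / M := min_le_right _ _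
    rw [le_div_iff₀ hM] at this; linarith
  have hin : (1 - κ) • μ ∈ Omega S := smul_mem_of_lt_one hS hμC ⟨by linarith, by linarith⟩
  have hc1 : Continuous fun ε : ℝ => (1 - κ) • (μ + ε • v) := by fun_prop
  have hc2 : Continuous fun ε : ℝ => inner ℝ η v + M * ε * ‖v‖ ^ 2 := by fun_prop
  have ev1 : ∀ᶠ ε : ℝ in 𝓝 0, (1 - κ) • (μ + ε • v) ∈ Omega S :=
    hc1.continuousAt.preimage_mem_nhds (by simpa using hS.isOpen.mem_nhds hin)
  have ev2 : ∀ᶠ ε : ℝ in 𝓝 0, inner ℝ η v + M * ε * ‖v‖ ^ 2 < 0 :=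
    (hc2.tendsto 0).eventually (gt_mem_nhds (by simpa using hv))
  obtain ⟨ε, ⟨h1, h2⟩, hε⟩ := ((eventually_nhdsWithin_of_eventually_nhds (s := Set.Ioi 0)
    (ev1.and ev2)).and self_mem_nhdsWithin).exists
  have hε : 0 < ε := hε
  refine ⟨ε, hε, ?_⟩
  set p := μ + ε • v with hp
  -- If `p` lay outside the closed shape, scaling it back by its gauge would give a boundary point
  -- `s • p` with `1 - s ≤ κ`, because `(1 - κ) • p` is inside. The upper Taylor bound from `μ` then
  -- puts its mass strictly below one.
  by_contra hpC
  have hconv := convex_Omega hS.nonneg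
  have hnhds := hS.isOpen.mem_nhds hS.zero_mem
  have hγ : 1 < gauge (Omega S) p := by
    rw [← not_le, gauge_le_one_iff_mem_closure hconv hnhds]; exact hpC
  set γ := gauge (Omega S) p with hγdef
  have hγ0 : 0 < γ := by linarith
  set s := γ⁻¹ with hs
  have hs0 : 0 < s := by positivity
  have hs1 : s < 1 := inv_lt_one_of_one_lt₀ hγ
  have hsκ : 1 - s ≤ κ := by
    have : gauge (Omega S) ((1 - κ) • p) < 1 := by
      rw [gauge_lt_one_iff_mem_interior hconv hnhds, hS.isOpen.interior_eq]; exact h1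
    rw [gauge_smul_of_nonneg (by linarith), smul_eq_mul, ← hγdef, ← lt_div_iff₀ hγ0, one_div] at this
    linarith
  have hb : s • p ∈ frontier (Omega S) := by
    rw [← gauge_eq_one_iff_mem_frontier hconv hnhds, gauge_smul_of_nonneg hs0.le, smul_eq_mul,
      ← hγdef, hs, inv_mul_cancel₀ hγ0.ne']
  have hT := (hE.tsum_tilt_bounds hS hM hζ hμC (frontier_subset_closure hb)).2
  rw [hE.tsum_tilt_eq_one hS hM hμ, hE.tsum_tilt_eq_one hS hM hb, ← hη] at hT
  have e : s • p - μ = (s * ε) • v - (1 - s) • μ := by rw [hp]; module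
  have hL := hE.le_inner_drift hS hM hζ hμC
  rw [← hη] at hL
  have hn : ‖s • p - μ‖ ^ 2 ≤ 2 * ((s * ε) ^ 2 * ‖v‖ ^ 2 + (1 - s) ^ 2 * ‖μ‖ ^ 2) := by
    rw [e]
    have n1 : ‖(s * ε) • v - (1 - s) • μ‖ ≤ s * ε * ‖v‖ + (1 - s) * ‖μ‖ := by
      refine (norm_sub_le _ _).trans_eq ?_
      rw [norm_smul, norm_smul, Real.norm_of_nonneg (by positivity),
        Real.norm_of_nonneg (by linarith : 0 ≤ 1 - s)]
    have n2 := pow_le_pow_left₀ (norm_nonneg _) n1 2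
    nlinarith [sq_nonneg (s * ε * ‖v‖ - (1 - s) * ‖μ‖)]
  rw [e, inner_sub_right, real_inner_smul_right, real_inner_smul_right, ← e] at hT
  have k1 : (1 - s) * (2 * K * ‖μ‖ ^ 2) ≤ (1 - s) * inner ℝ η μ :=
    mul_le_mul_of_nonneg_left hL (by linarith)
  have k2 : M * (1 - s) ^ 2 * ‖μ‖ ^ 2 ≤ (1 - s) * (K * ‖μ‖ ^ 2) := by
    have : M * (1 - s) ≤ K := (mul_le_mul_of_nonneg_left hsκ hM.le).trans hκM
    have := mul_le_mul_of_nonneg_left this (show 0 ≤ (1 - s) * ‖μ‖ ^ 2 from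
      mul_nonneg (by linarith) (sq_nonneg _))
    linarith
  have k3 : M * (s * ε) ^ 2 * ‖v‖ ^ 2 ≤ s * ε * (M * ε * ‖v‖ ^ 2) := by
    have : s * (s * (M * ε ^ 2 * ‖v‖ ^ 2)) ≤ 1 * (s * (M * ε ^ 2 * ‖v‖ ^ 2)) :=
      mul_le_mul_of_nonneg_right hs1.le (by positivity)
    linarith
  have k4 : s * ε * (inner ℝ η v + M * ε * ‖v‖ ^ 2) < 0 :=
    mul_neg_of_pos_of_neg (by positivity) h2
  have k5 : 0 ≤ (1 - s) * (K * ‖μ‖ ^ 2) := mul_nonneg (by linarith) (by positivity)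
  have k6 := mul_le_mul_of_nonneg_left hn (half_pos hM).le
  linarith

/-- The drift at the optimal tilt in a direction is a positive multiple of that direction. -/
lemma drift_eq (hE : OZEquation M K ζ S g J) (hS : AveragedDecay S) (hM : 0 < M) (hK : 0 < K)
    (hζ : 0 < ζ) (hu : ‖u‖ = 1) (hμ : IsOptimalTilt S u μ)
    (hη : 0 < ‖firstMoment (tilt J μ)‖) :
    firstMoment (tilt J μ) = ‖firstMoment (tilt J μ)‖ • u := by
  set η := firstMoment (tilt J μ) with hηdef
  have hle := real_inner_le_norm η u
  rcases hle.eq_or_lt with h | h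
  · have := inner_eq_norm_mul_iff_real.mp h
    rwa [hu, one_smul] at this
  · exfalso
    rw [hu, mul_one] at h
    -- If `η` is not parallel to `u`, the direction `u - η / ‖η‖` points against the drift yet
    -- increases the component along `u`, contradicting optimality.
    obtain ⟨ε, hε, hmem⟩ := hE.exists_mem_closure_of_inner_neg hS hM hK hζ hμ.1
      (v := u - ‖η‖⁻¹ • η) (by
        rw [← hηdef, inner_sub_right, real_inner_smul_right, real_inner_self_eq_norm_sq, sq,
          inv_mul_cancel_left₀ hη.ne']
        linarith)
    have h1 := hμ.2 _ hmem
    rw [inner_add_left, real_inner_smul_left, inner_sub_left, real_inner_smul_left,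
      real_inner_self_eq_norm_sq, hu, one_pow, inv_mul_eq_div] at h1
    have h2 : (inner ℝ η u : ℝ) / ‖η‖ < 1 := (div_lt_one hη).mpr h
    have : 0 < ε * (1 - inner ℝ η u / ‖η‖) := mul_pos hε (by linarith)
    linarith

/-- The maximum of `μ · u` is at least the mass over `√d`, so `μ` is not short, and the drift is at
least `2 * K` times as long. The dependence of the error term on the mass enters here. -/
lemma mass_le_norm_drift (hE : OZEquation M K ζ S g J) (hS : AveragedDecay S) (hM : 0 < M)
    (hK : 0 < K) (hζ : 0 < ζ) (hu : ‖u‖ = 1) (hμ : IsOptimalTilt S u μ) :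
    2 * K * mass S / √d ≤ ‖firstMoment (tilt J μ)‖ := by
  have hd : (0 : ℝ) < √d := Real.sqrt_pos.mpr (by exact_mod_cast NeZero.pos d)
  refine le_trans ?_ (hE.le_norm_drift hS hM hζ (frontier_subset_closure hμ.1))
  have h1 := hS.mass_le_mul_of_forall_le hu fun ν hν => hμ.2 ν (subset_closure hν)
  have h2 := real_inner_le_norm μ u
  rw [hu, mul_one] at h2
  rw [div_le_iff₀ hd, mul_assoc (2 * K) ‖μ‖]
  exact mul_le_mul_of_nonneg_left (h1.trans (mul_le_mul_of_nonneg_right h2 hd.le)) (by positivity)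

end OZEquation

/-! ### The leading term in final form, and conclusion -/

lemma optimalTilt_spec {d : ℕ} [NeZero d] {S : Lat d → ℝ} (hS : AveragedDecay S) {u : Vec d}
    (hu : u ≠ 0) : IsOptimalTilt S u (optimalTilt S u) :=
  Classical.epsilon_spec (exists_isOptimalTilt hS hu)

lemma norm_dir {d : ℕ} {x : Vec d} (hx : x ≠ 0) : ‖dir x‖ = 1 := by
  rw [dir, norm_smul, norm_inv, norm_norm, inv_mul_cancel₀ (norm_ne_zero_iff.mpr hx)]

lemma mass_mul_normS {d : ℕ} [NeZero d] {S : Lat d → ℝ} (hS : AveragedDecay S) (x : Vec d) :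
    mass S * normS S x = inner ℝ (optimalTilt S (dir x)) x :=
  mul_div_cancel₀ _ hS.mass_pos.ne'

lemma invForm_smul {d : ℕ} (A : Matrix (Fin d) (Fin d) ℝ) (a : ℝ) (u : Vec d) :
    invForm A (a • u) = a ^ 2 * invForm A u := by
  simp only [invForm, WithLp.ofLp_smul, Matrix.mulVec_smul, dotProduct_smul, smul_dotProduct, smul_eq_mul]
  ring

/-- Homogeneity along the drift: the time scale contributes `‖η‖ ^ ((d-1)/2)` and the inverse form
takes away one power of `‖η‖`, leaving the exponent `(d-3)/2`. -/
lemma greenConst_mul_rpow_eq {d : ℕ} {A : Lat d → ℝ} {u : Vec d} {n : ℝ} (hn : 0 < n)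
    (hη : 0 < ‖firstMoment A‖) (hd : firstMoment A = ‖firstMoment A‖ • u)
    (h0 : 0 ≤ invForm (secondMoment A) u) :
    greenConst A * (n / ‖firstMoment A‖) ^ (-((d : ℝ) - 1) / 2) =
      1 / ((2 * Real.pi) ^ (((d : ℝ) - 1) / 2) * √(secondMoment A).det) *
        (1 / invForm (secondMoment A) u ^ ((1 : ℝ) / 2)) *
        (‖firstMoment A‖ ^ (((d : ℝ) - 3) / 2) / n ^ (((d : ℝ) - 1) / 2)) := by
  set a := ‖firstMoment A‖ with ha
  have e1 : invForm (secondMoment A) (firstMoment A) ^ (1 / 2 : ℝ) =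
      a * invForm (secondMoment A) u ^ (1 / 2 : ℝ) := by
    rw [hd, invForm_smul, Real.mul_rpow (sq_nonneg _) h0, ← Real.sqrt_eq_rpow, Real.sqrt_sq hη.le]
  have e2 : (n / a) ^ (-((d : ℝ) - 1) / 2) = a ^ (((d : ℝ) - 1) / 2) / n ^ (((d : ℝ) - 1) / 2) := by
    rw [neg_div, Real.rpow_neg (by positivity), Real.div_rpow hn.le hη.le, inv_div]
  have e3 : a ^ (((d : ℝ) - 1) / 2) = a * a ^ (((d : ℝ) - 3) / 2) := by
    nth_rewrite 2 [← Real.rpow_one a]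
    rw [← Real.rpow_add hη]
    congr 1; ring
  rw [greenConst, e1, e2, e3]
  field_simp

/-- With `w` the inverse matrix applied to `η`, the inverse form equals both `η · w` and the
original form at `w`; coercivity and Cauchy–Schwarz then close the estimate. -/
lemma invForm_le {d : ℕ} {f : Lat d → ℝ} (h : Summable fun y => ‖toVec y‖ ^ 2 * |f y|)
    {κ : ℝ} (hκ : 0 < κ) (hq : ∀ k, κ * ‖k‖ ^ 2 ≤ quadForm f k) (η : Vec d) :
    invForm (secondMoment f) η ≤ ‖η‖ ^ 2 / κ := by
  have hdet : IsUnit (secondMoment f).det :=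
    isUnit_iff_ne_zero.mpr (secondMoment_posDef h hκ hq).det_pos.ne'
  set w : Vec d := WithLp.toLp 2 ((secondMoment f)⁻¹.mulVec η.ofLp) with hw
  set V := invForm (secondMoment f) η with hV
  have h1 : V = inner ℝ η w := by rw [inner_eq_dotProduct]; rfl
  have h2 : quadForm f w = V := by
    rw [quadForm_eq_dotProduct h, hw, Matrix.mulVec_mulVec, Matrix.mul_nonsing_inv _ hdet,
      Matrix.one_mulVec, dotProduct_comm]
    rfl
  have h3 := hq w
  rw [h2] at h3
  have h4 := real_inner_le_norm η w
  rw [← h1] at h4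
  rw [le_div_iff₀ hκ]
  have hV0 : 0 ≤ V := le_trans (by positivity) h3
  rcases hV0.eq_or_lt with h0 | h0
  · rw [← h0, zero_mul]; positivity
  · have h5 : V * (V * κ) ≤ V * ‖η‖ ^ 2 := by
      calc V * (V * κ) = κ * V ^ 2 := by ring
        _ ≤ κ * (‖η‖ * ‖w‖) ^ 2 := by gcongr
        _ = (κ * ‖w‖ ^ 2) * ‖η‖ ^ 2 := by ring
        _ ≤ V * ‖η‖ ^ 2 := by gcongr
    exact le_of_mul_le_mul_left h5 h0

lemma abs_secondMoment_le {d : ℕ} {f : Lat d → ℝ} (h : Summable fun y => ‖toVec y‖ ^ 2 * |f y|)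
    (j l : Fin d) : |secondMoment f j l| ≤ ∑' y, ‖toVec y‖ ^ 2 * |f y| := by
  rw [secondMoment, Matrix.of_apply, ← Real.norm_eq_abs]
  refine tsum_of_norm_bounded h.hasSum fun y => ?_
  rw [norm_mul, norm_mul, Real.norm_eq_abs (f y), sq]
  have hc : ∀ i, ‖(y i : ℝ)‖ ≤ ‖toVec y‖ := fun i => PiLp.norm_apply_le (toVec y) i
  gcongr <;> exact hc _

/-- A uniform lower bound is what turns an absolute error into a relative one. The determinant is
bounded through its entries, each at most `M`. -/
lemma CritKernel.le_greenConst {d : ℕ} {M K ζ c : ℝ} {A : Lat d → ℝ} (h : CritKernel M K ζ c A)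
    (hM : 0 < M) (hK : 0 < K) (hζ : 0 < ζ) (hζ1 : ζ ≤ 1) (hc : 0 < c) :
    ((2 * Real.pi) ^ (((d : ℝ) - 1) / 2) * √(d.factorial * M ^ d))⁻¹ *
      ((M ^ 2 / (2 * K)) ^ (1 / 2 : ℝ))⁻¹ ≤ greenConst A := by
  obtain ⟨m1, m2⟩ := h.mom_two hζ
  have hV : 0 < invForm (secondMoment A) (firstMoment A) :=
    lt_of_lt_of_le (by positivity) (h.le_invForm hM hK hζ hζ1 hc)
  have hVle : invForm (secondMoment A) (firstMoment A) ≤ M ^ 2 / (2 * K) := by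
    refine (invForm_le m1 (by positivity) (h.le_quadForm hζ hζ1) _).trans ?_
    have := h.norm_drift_le hζ
    gcongr
  have hdet : (secondMoment A).det ≤ d.factorial * M ^ d := by
    have := Matrix.det_le (A := secondMoment A) (abv := AbsoluteValue.abs) (x := M)
      fun i j => (abs_secondMoment_le m1 i j).trans m2
    rw [Fintype.card_fin, nsmul_eq_mul] at this
    exact (le_abs_self _).trans this
  have hdet0 : 0 < √(secondMoment A).det := Real.sqrt_pos.mpr (h.posDef hK hζ hζ1).det_pos
  have hp : 0 < (2 * Real.pi) ^ (((d : ℝ) - 1) / 2) := by positivity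
  unfold greenConst
  refine mul_le_mul (inv_anti₀ (mul_pos hp hdet0) ?_) (inv_anti₀ (by positivity) ?_) (by positivity)
    (by positivity)
  · exact mul_le_mul_of_nonneg_left (Real.sqrt_le_sqrt hdet) hp.le
  · exact Real.rpow_le_rpow hV.le hVle (by norm_num)

/-- Fourier inversion takes place at tilt zero, which is subcritical; the infrared bound then gives
the spectral gap `1 - ∑ J`. -/
lemma OZEquation.tilt_eq_tsum {d : ℕ} [NeZero d] {M K ζ : ℝ} {S g J : Lat d → ℝ} {μ : Vec d}
    (hE : OZEquation M K ζ S g J) (hS : AveragedDecay S) (hM : 0 < M) (hK : 0 < K)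
    (hμ : μ ∈ closure (Omega S)) (x : Lat d) :
    (tilt S μ x : ℂ) = ∑' y, (tilt g μ y : ℂ) * green (tilt J μ) (x - y) := by
  have h1 := hE.tsum_tilt_lt_one hS hM hS.zero_mem
  have h2 := (hE.mem_class 0 (subset_closure hS.zero_mem)).infrared
  have h3 := (mem_Omega_iff hS.nonneg).mp hS.zero_mem
  rw [tilt_zero] at h1 h2 h3
  refine tilt_eq_tsum_mul_green h3 hE.g_summable hE.J_summable hE.equation
    (s := 1 - ∑' y, J y) (by linarith) (fun k hk => ?_) ((hE.mem_class μ hμ).summable hM) x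
  have h4 := h2 k (by simpa [cube] using hk)
  rw [fourierSum_zero, Complex.sub_re, Complex.ofReal_re] at h4
  rw [Complex.sub_re, Complex.one_re]
  have : 0 ≤ K * ‖k‖ ^ 2 := by positivity
  linarith

end OZ

end

theorem corollary1p5 (d : ℕ) [NeZero d] (M K ζ m : ℝ) (hM : 0 < M) (hK : 0 < K) (hζ : 0 < ζ) :
    ∀ ε : ℝ, 0 < ε → ∃ R : ℝ, ∀ S g J : OZ.Lat d → ℝ,
      OZ.AveragedDecay S → OZ.OZEquation M K ζ S g J → OZ.mass S = m →
      ∀ x : OZ.Lat d, x ≠ 0 →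
        -- the optimal tilt in the direction of `x` exists and is unique
        (∃! μ : OZ.Vec d, OZ.IsOptimalTilt S (OZ.dir (OZ.toVec x)) μ) ∧
        (R ≤ ‖OZ.toVec x‖ →
          ∃ r : ℝ, |r| ≤ ε ∧
            S x =
              1 / ((2 * Real.pi) ^ (((d : ℝ) - 1) / 2) *
                  Real.sqrt (OZ.covariance S J (OZ.dir (OZ.toVec x))).det)
                * (1 / (OZ.invForm (OZ.covariance S J (OZ.dir (OZ.toVec x)))
                    (OZ.dir (OZ.toVec x))) ^ ((1 : ℝ) / 2))
                * (‖OZ.drift S J (OZ.dir (OZ.toVec x))‖ ^ (((d : ℝ) - 3) / 2) /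
                    ‖OZ.toVec x‖ ^ (((d : ℝ) - 1) / 2))
                * Real.exp (-(OZ.mass S * OZ.normS S (OZ.toVec x)))
                * ((OZ.fourierSum (OZ.tilt g (OZ.optimalTilt S (OZ.dir (OZ.toVec x)))) 0).re + r)) := by
  intro ε hε
  by_cases hm : 0 < m
  swap
  -- The mass is always positive, so other values of `m` are vacuous.
  · exact ⟨0, fun S g J hS _ hmass => absurd (hmass ▸ hS.mass_pos) hm⟩
  have hd : (0 : ℝ) < √d := Real.sqrt_pos.mpr (by exact_mod_cast NeZero.pos d)
  have hζ' : 0 < min ζ 1 := lt_min hζ one_pos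
  have hζ1 : min ζ 1 ≤ 1 := min_le_right _ _
  have hc : 0 < 2 * K * m / √d := by positivity
  set γ : ℝ := ((2 * Real.pi) ^ (((d : ℝ) - 1) / 2) * √(d.factorial * M ^ d))⁻¹ *
    ((M ^ 2 / (2 * K)) ^ (1 / 2 : ℝ))⁻¹ with hγ
  have hγ0 : 0 < γ := by positivity
  -- The tolerance carries the factor `γ`, a uniform lower bound for the leading constant, so that
  -- the error after division is at most `ε`.
  obtain ⟨T₀, hT₀, hmain⟩ := OZ.exists_tsum_mul_green_sub_le d hM hK hζ' hζ1 hc (mul_pos hε hγ0)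
  -- The drift has length at most `M`, so this threshold on the norm of `x` gives `T ≥ T₀`.
  refine ⟨T₀ * M, fun S g J hS hE hmass x hx => ?_⟩
  have hx1 := OZ.one_le_norm_toVec hx
  have hx0 : OZ.toVec x ≠ 0 := norm_pos_iff.mp (by linarith)
  set u := OZ.dir (OZ.toVec x) with hu
  have hu1 : ‖u‖ = 1 := OZ.norm_dir hx0
  have hu0 : u ≠ 0 := norm_pos_iff.mp (by linarith)
  have hopt := OZ.optimalTilt_spec hS hu0
  refine ⟨⟨_, hopt, fun ν hν => hE.isOptimalTilt_unique hS hM hK hζ hu0 hν hopt⟩, fun hR => ?_⟩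
  rw [OZ.mass_mul_normS hS, OZ.covariance, OZ.drift, ← hu]
  set μ := OZ.optimalTilt S u with hμ
  have hμC := frontier_subset_closure hopt.1
  set A := OZ.tilt J μ with hA
  set n := ‖OZ.toVec x‖ with hn
  have hdr := hE.mass_le_norm_drift hS hM hK hζ hu1 hopt
  rw [hmass] at hdr
  have hη0 : 0 < ‖OZ.firstMoment A‖ := hc.trans_le hdr
  have hCK := (hE.mem_class μ hμC).critKernel hM hζ (hE.tsum_tilt_eq_one hS hM hopt.1) hdr
  have hSK := (hE.mem_class μ hμC).sourceKernel hM hζ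
  have hdir := hE.drift_eq hS hM hK hζ hu1 hopt hη0
  set T := n / ‖OZ.firstMoment A‖ with hT
  have hT0 : T₀ ≤ T := by
    rw [hT, le_div_iff₀ hη0]
    exact (mul_le_mul_of_nonneg_left (hCK.norm_drift_le hζ') (by linarith)).trans hR
  have hxT : OZ.toVec x = T • OZ.firstMoment A := by
    rw [hdir, smul_smul, hT, div_mul_cancel₀ _ hη0.ne', hu, OZ.dir, smul_smul,
      mul_inv_cancel₀ (by linarith), one_smul]
  have hkey := hmain A (OZ.tilt g μ) hCK hSK T x hT0 hxT
  rw [← hE.tilt_eq_tsum hS hM hK hμC x, ← Complex.ofReal_sub, Complex.norm_real, Real.norm_eq_abs] at hkey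
  have hpre := OZ.greenConst_mul_rpow_eq (A := A) (u := u) (n := n) (by linarith) hη0 hdir
    ((hCK.posDef hK hζ' hζ1).posSemidef.inv.dotProduct_mulVec_nonneg u.ofLp)
  rw [← hpre, ← hT, OZ.fourierSum_zero, Complex.ofReal_re]
  set P := T ^ (-((d : ℝ) - 1) / 2) with hP
  have hP0 : 0 < P := Real.rpow_pos_of_pos (by linarith) _
  have hγle : γ ≤ OZ.greenConst A := hCK.le_greenConst hM hK hζ' hζ1 hc
  have hG0 : 0 < OZ.greenConst A * P := mul_pos (hγ0.trans_le hγle) hP0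
  set G := ∑' y, OZ.tilt g μ y with hGdef
  refine ⟨(OZ.tilt S μ x - OZ.greenConst A * P * G) / (OZ.greenConst A * P), ?_, ?_⟩
  · rw [abs_div, abs_of_pos hG0, div_le_iff₀ hG0]
    refine hkey.trans ?_
    rw [mul_assoc]
    exact mul_le_mul_of_nonneg_left (mul_le_mul_of_nonneg_right hγle hP0.le) hε.le
  · have e1 : S x = OZ.tilt S μ x * Real.exp (-inner ℝ μ (OZ.toVec x)) := by
      rw [OZ.tilt, mul_assoc, ← Real.exp_add, add_neg_cancel, Real.exp_zero, mul_one]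
    rw [e1, mul_right_comm, mul_add, mul_div_cancel₀ _ hG0.ne', add_sub_cancel]
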